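/- **Theorem (Equivalent problems).** Let $d\ge 1$, $T>0$, let $\Omega\subset\mathbb{R}^d$ be a bounded Lipschitz domain, $Q=(0,T)\times\Omega$, and let $\mathcal T$ be a finite partition of $Q$ into non-overlapping cells (represented by nonempty, pairwise disjoint open sets $K\subset Q$ that cover $Q$ up to a null set). For $(v,\tau)\in L^2(Q)\times L^2(Q;\mathbb{R}^d)$ let $\nabla_x v$ and $\operatorname{div}(v,\tau)=\partial_t v+\operatorname{div}_x\tau$ denote the weak spatial gradient and the weak space-time divergence. Let $U$ be the space of all $(v,\tau)\in L^2(Q)\times L^2(Q;\mathbb{R}^d)$ with $\nabla_x v\in L^2(Q;\mathbb{R}^d)$ and $\operatorname{div}(v,\tau)\in L^2(Q)$, and $$U_0=\{(v,\tau)\in U:\ \langle\nabla_x v,\chi\rangle_{L^2(Q)}=-\langle v,\operatorname{div}_x\chi\rangle_{L^2(Q)}\ \text{ for all }\chi\in C^\infty(\overline Q;\mathbb{R}^d)\}.$$ Set $A(v,\tau)=(\operatorname{div}(v,\tau),\nabla_x v+\tau)$. For $\mathbf v=(v,\tau)\in U_0$ let $\gamma_0\mathbf v=v(0,\cdot)\in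 L^2(\Omega)$, where $v$ is identified with its representative in $C([0,T];L^2(\Omega))$. Let $H(A^*,\mathcal T)$ be the space of all $\mathbf w=(w,\chi)\in L^2(Q)\times L^2(Q;\mathbb{R}^d)$ such that on every cell $K\in\mathcal T$ the weak derivatives satisfy $\nabla_x w\in L^2(K;\mathbb{R}^d)$ and $\operatorname{div}(w,\chi)\in L^2(K)$, and define $A_h^*\mathbf w$ by $(A^*_h\mathbf w)|_K=(-\operatorname{div}(w,\chi),-\nabla_x w+\chi)$ on every $K$. Let $Y=H(A^*,\mathcal T)\times L^2(\Omega)$ with the norm $\|(\mathbf w,\xi)\|_Y^2=\|\mathbf w\|_{L^2(Q)}^2+\|A_h^*\mathbf w\|_{L^2(Q)}^2+\|\xi\|_{L^2(\Omega)}^2$ and dual space $Y^*$. Define $\gamma_A:U_0\to Y^*$ by $$(\gamma_A\mathbf v)(\mathbf w,\xi)=\langle A\mathbf v,\mathbf w\rangle_{L^2(Q)}-\langle\mathbf v,A_h^*\mathbf w\rangle_{L^2(Q)}+\langle\gamma_0\mathbf v,\xi\rangle_{L^2(\Omega)},$$ and set $\Gamma(\partial\mathcal T)=\gamma_A U_0\subset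 Y^*$ and $X=\big(L^2(Q)\times L^2(Q;\mathbb{R}^d)\big)\times\Gamma(\partial\mathcal T)$. Let $\mathbf f\in L^2(Q)\times L^2(Q;\mathbb{R}^d)$ and $u_0\in L^2(\Omega)$. Then the following hold. 0. The trace is well defined: for every $(v,\tau)\in U_0$, $v$ has a representative in $C([0,T];L^2(\Omega))$, and its value at $t=0$ is unique. 1. If $\mathbf u\in U_0$ solves the first-order system $A\mathbf u=\mathbf f$, $\gamma_0\mathbf u=u_0$, then $(\mathbf u,\gamma_A\mathbf u)\in X$ solves the broken variational problem $$\langle\mathbf u,A_h^*\mathbf w\rangle_{L^2(Q)}+\mathbf s(\mathbf w,\xi)=\langle\mathbf f,\mathbf w\rangle_{L^2(Q)}+\langle u_0,\xi\rangle_{L^2(\Omega)}\qquad\text{for all }(\mathbf w,\xi)\in Y \tag{$*$}$$ with $\mathbf s=\gamma_A\mathbf u$. 2. Conversely, if $(\mathbf u,\mathbf s)\in X$ solves $(*)$, then $\mathbf u\in U_0$, $\mathbf s=\gamma_A\mathbf u$, $A\mathbf u=\mathbf f$ and $\gamma_0\mathbf u=u_0$. -/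

import Mathlib

open MeasureTheory Set
open scoped ContDiff InnerProductSpace NNReal

namespace HeatDPG

noncomputable section

/-- The spatial Euclidean space `ℝᵈ`. -/
abbrev Space (d : ℕ) : Type := EuclideanSpace ℝ (Fin d)

/-- Time-space `ℝ × ℝᵈ`; the first coordinate is time. It carries the product Lebesgue measure. -/
abbrev SpaceTime (d : ℕ) : Type := ℝ × Space d

/-- A bounded Lipschitz domain: a nonempty bounded open set that near each of its boundary points
is, after a choice of a unit vector `e`, the strict epigraph in direction `e` of a Lipschitz function
of the component orthogonal to `e` (only the values of `φ` on the hyperplane orthogonal to `e`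
matter). -/
structure IsBoundedLipschitzDomain {d : ℕ} (Ω : Set (Space d)) : Prop where
  isOpen : IsOpen Ω
  nonempty : Ω.Nonempty
  isBounded : Bornology.IsBounded Ω
  lipschitz_boundary : ∀ z ∈ frontier Ω, ∃ e : Space d, ‖e‖ = 1 ∧
    ∃ (C : ℝ≥0) (φ : Space d → ℝ), LipschitzWith C φ ∧
      ∃ r : ℝ, 0 < r ∧ ∀ x ∈ Metric.ball z r,
        (x ∈ Ω ↔ φ (x - ⟪e, x⟫_ℝ • e) < ⟪e, x⟫_ℝ)

/-- The time-space cylinder `Q = (0, Tend) × Ω`. -/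
def cylinder {d : ℕ} (Tend : ℝ) (Ω : Set (Space d)) : Set (SpaceTime d) := Ioo 0 Tend ×ˢ Ω

/-- A (finite) partition of `Q` into non-overlapping cells. The cells are represented by their
interiors: nonempty open subsets of `Q` that are pairwise disjoint and cover `Q` up to a set of
measure zero. -/
structure Mesh {d : ℕ} (Q : Set (SpaceTime d)) where
  cells : Finset (Set (SpaceTime d))
  isOpen : ∀ K ∈ cells, IsOpen K
  nonempty : ∀ K ∈ cells, K.Nonempty
  subset : ∀ K ∈ cells, K ⊆ Q
  disjoint : (cells : Set (Set (SpaceTime d))).PairwiseDisjoint id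
  covers : volume (Q \ ⋃ K ∈ cells, K) = 0

/-! ### Classical derivatives of smooth test functions -/

/-- Time derivative `∂ₜ φ`. -/
def dt {d : ℕ} (φ : SpaceTime d → ℝ) (z : SpaceTime d) : ℝ := fderiv ℝ φ z (1, 0)

/-- Spatial gradient `∇ₓ φ`. -/
def gradX {d : ℕ} (φ : SpaceTime d → ℝ) (z : SpaceTime d) : Space d :=
  WithLp.toLp 2 fun i => fderiv ℝ φ z (0, EuclideanSpace.single i 1)

/-- Spatial divergence `divₓ χ`. -/
def divX {d : ℕ} (χ : SpaceTime d → Space d) (z : SpaceTime d) : ℝ :=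
  ∑ i, (fderiv ℝ χ z (0, EuclideanSpace.single i 1)) i

/-! ### Weak derivatives on an open set -/

/-- `g = div (v, τ) = ∂ₜ v + divₓ τ` weakly in `G`. -/
def HasWeakDiv {d : ℕ} (G : Set (SpaceTime d)) (v : SpaceTime d → ℝ) (τ : SpaceTime d → Space d)
    (g : SpaceTime d → ℝ) : Prop :=
  ∀ φ : SpaceTime d → ℝ, ContDiff ℝ ∞ φ → HasCompactSupport φ → tsupport φ ⊆ G →
    ∫ z in G, g z * φ z = - ∫ z in G, (v z * dt φ z + ⟪τ z, gradX φ z⟫_ℝ)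

/-- `σ = ∇ₓ v` weakly in `G`. -/
def HasWeakGrad {d : ℕ} (G : Set (SpaceTime d)) (v : SpaceTime d → ℝ)
    (σ : SpaceTime d → Space d) : Prop :=
  ∀ χ : SpaceTime d → Space d, ContDiff ℝ ∞ χ → HasCompactSupport χ → tsupport χ ⊆ G →
    ∫ z in G, ⟪σ z, χ z⟫_ℝ = - ∫ z in G, v z * divX χ z

/-- For `(v, τ)` square integrable on `G`: the weak divergence `div (v, τ)` and the weak spatial
gradient `∇ₓ v` exist in `L²(G)`. Equivalently, `(v, τ) ∈ H(A, G) = H(A*, G)`. -/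
def MemGraph {d : ℕ} (G : Set (SpaceTime d)) (v : SpaceTime d → ℝ) (τ : SpaceTime d → Space d) :
    Prop :=
  (∃ g : SpaceTime d → ℝ, MemLp g 2 (volume.restrict G) ∧ HasWeakDiv G v τ g) ∧
  (∃ σ : SpaceTime d → Space d, MemLp σ 2 (volume.restrict G) ∧ HasWeakGrad G v σ)

/-! ### Lebesgue spaces -/

/-- `L²(Q)`. -/
abbrev L2 {d : ℕ} (Q : Set (SpaceTime d)) : Type := Lp ℝ 2 (volume.restrict Q)

/-- `L²(Q; ℝᵈ)`. -/
abbrev L2Vec {d : ℕ} (Q : Set (SpaceTime d)) : Type := Lp (Space d) 2 (volume.restrict Q)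

/-- `L²(Q) × L²(Q; ℝᵈ)` with its Hilbert space structure. -/
abbrev L2Pair {d : ℕ} (Q : Set (SpaceTime d)) : Type := WithLp 2 (L2 Q × L2Vec Q)

/-- `L²(Ω)`. -/
abbrev L2Space {d : ℕ} (Ω : Set (Space d)) : Type := Lp ℝ 2 (volume.restrict Ω)

/-! ### Element-wise differential operators -/

/-- The function in `L²(Q)` that equals the weak divergence of `w` on each of the given sets, if
there is one (zero otherwise). -/
def cellDiv {d : ℕ} {Q : Set (SpaceTime d)} (cells : Finset (Set (SpaceTime d))) (w : L2Pair Q) :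
    L2 Q :=
  open Classical in
  if h : ∃ g : L2 Q, ∀ K ∈ cells, HasWeakDiv K w.fst w.snd g then h.choose else 0

/-- The function in `L²(Q; ℝᵈ)` that equals the weak spatial gradient of the first component of `w`
on each of the given sets, if there is one (zero otherwise). -/
def cellGrad {d : ℕ} {Q : Set (SpaceTime d)} (cells : Finset (Set (SpaceTime d))) (w : L2Pair Q) :
    L2Vec Q :=
  open Classical in
  if h : ∃ σ : L2Vec Q, ∀ K ∈ cells, HasWeakGrad K w.fst σ then h.choose else 0

/-- `A (v, τ) = (div (v, τ), ∇ₓ v + τ)`. -/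
def opA {d : ℕ} {Q : Set (SpaceTime d)} (v : L2Pair Q) : L2Pair Q :=
  WithLp.toLp 2 (cellDiv {Q} v, cellGrad {Q} v + v.snd)

/-- The element-wise adjoint `A*ₕ (w, χ) = (- div (w, χ), - ∇ₓ w + χ)` on each cell. -/
def opAstarH {d : ℕ} {Q : Set (SpaceTime d)} (𝒯 : Mesh Q) (w : L2Pair Q) : L2Pair Q :=
  WithLp.toLp 2 (- cellDiv 𝒯.cells w, - cellGrad 𝒯.cells w + w.snd)

/-! ### The spaces `U` and `U₀` -/

/-- The space `U`. -/
def spaceU {d : ℕ} (Q : Set (SpaceTime d)) : Set (L2Pair Q) :=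
  {v | MemGraph Q v.fst v.snd}

/-- The space `U₀`: the integration by parts formula for `∇ₓ v` holds for all
`χ ∈ C^∞(closure Q; ℝᵈ)`, i.e. for the restrictions of smooth functions on the whole space. -/
def spaceU0 {d : ℕ} (Q : Set (SpaceTime d)) : Set (L2Pair Q) :=
  {v | v ∈ spaceU Q ∧ ∀ χ : SpaceTime d → Space d, ContDiff ℝ ∞ χ →
    ∫ z in Q, ⟪cellGrad {Q} v z, χ z⟫_ℝ = - ∫ z in Q, v.fst z * divX χ z}

/-! ### The initial trace -/

/-- `g = v(0, ·)`, where `v` is read as its representative in `C([0, Tend]; L²(Ω))`. -/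
def HasInitialTrace {d : ℕ} {Tend : ℝ} {Ω : Set (Space d)} (v : L2 (cylinder Tend Ω))
    (g : L2Space Ω) : Prop :=
  ∃ V : ℝ → L2Space Ω, ContinuousOn V (Icc 0 Tend) ∧
    (∀ᵐ t ∂(volume.restrict (Ioo 0 Tend)),
      (fun x => v (t, x)) =ᵐ[volume.restrict Ω] (V t : Space d → ℝ)) ∧
    V 0 = g

/-- The trace operator `γ₀ (v, τ) = v(0, ·)` (zero if `v` has no representative in
`C([0, Tend]; L²(Ω))`). -/
def gamma0 {d : ℕ} {Tend : ℝ} {Ω : Set (Space d)} (v : L2Pair (cylinder Tend Ω)) : L2Space Ω :=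
  open Classical in
  if h : ∃ g : L2Space Ω, HasInitialTrace v.fst g then h.choose else 0

/-! ### Auxiliary facts on weak derivatives -/

section Auxiliary

variable {d : ℕ}

lemma continuous_dt {φ : SpaceTime d → ℝ} (h : ContDiff ℝ ∞ φ) : Continuous (dt φ) :=
  (h.continuous_fderiv (by simp)).clm_apply continuous_const

lemma continuous_gradX {φ : SpaceTime d → ℝ} (h : ContDiff ℝ ∞ φ) : Continuous (gradX φ) := by
  refine (PiLp.continuous_toLp 2 _).comp (continuous_pi fun i => ?_)
  exact (h.continuous_fderiv (by simp)).clm_apply continuous_const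

lemma continuous_divX {χ : SpaceTime d → Space d} (h : ContDiff ℝ ∞ χ) : Continuous (divX χ) := by
  refine continuous_finsetSum _ fun i _ => ?_
  have h1 : Continuous fun z => fderiv ℝ χ z (0, EuclideanSpace.single i 1) :=
    (h.continuous_fderiv (by simp)).clm_apply continuous_const
  exact (EuclideanSpace.proj i : Space d →L[ℝ] ℝ).continuous.comp h1

lemma compact_dt {φ : SpaceTime d → ℝ} (h : HasCompactSupport φ) : HasCompactSupport (dt φ) :=
  (h.fderiv (𝕜 := ℝ)).mono' <| by
    refine fun z hz => subset_tsupport _ ?_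
    intro h0
    exact hz (by simp [dt, h0])

lemma compact_gradX {φ : SpaceTime d → ℝ} (h : HasCompactSupport φ) :
    HasCompactSupport (gradX φ) :=
  (h.fderiv (𝕜 := ℝ)).mono' <| by
    refine fun z hz => subset_tsupport _ ?_
    intro h0
    exact hz (by ext i; simp [gradX, h0])

lemma compact_divX {χ : SpaceTime d → Space d} (h : HasCompactSupport χ) :
    HasCompactSupport (divX χ) :=
  (h.fderiv (𝕜 := ℝ)).mono' <| by
    refine fun z hz => subset_tsupport _ ?_
    intro h0
    exact hz (by simp [divX, h0])

lemma integrable_mul_test {G : Set (SpaceTime d)} {v : SpaceTime d → ℝ}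
    (hv : MemLp v 2 (volume.restrict G)) {ψ : SpaceTime d → ℝ} (h1 : Continuous ψ)
    (h2 : HasCompactSupport ψ) : Integrable (fun z => v z * ψ z) (volume.restrict G) :=
  hv.integrable_mul (h1.memLp_of_hasCompactSupport (p := 2) h2)

lemma integrable_inner_test {G : Set (SpaceTime d)} {v : SpaceTime d → Space d}
    (hv : MemLp v 2 (volume.restrict G)) {ψ : SpaceTime d → Space d} (h1 : Continuous ψ)
    (h2 : HasCompactSupport ψ) : Integrable (fun z => ⟪v z, ψ z⟫_ℝ) (volume.restrict G) := by
  have hψ : MemLp ψ 2 (volume.restrict G) := h1.memLp_of_hasCompactSupport h2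
  refine (L2.integrable_inner (𝕜 := ℝ) (hv.toLp v) (hψ.toLp ψ)).congr ?_
  filter_upwards [hv.coeFn_toLp, hψ.coeFn_toLp] with z a b
  rw [a, b]

lemma HasWeakDiv.congr {G : Set (SpaceTime d)} {v v' : SpaceTime d → ℝ}
    {τ τ' : SpaceTime d → Space d} {g g' : SpaceTime d → ℝ} (h : HasWeakDiv G v τ g)
    (hv : v =ᵐ[volume.restrict G] v') (hτ : τ =ᵐ[volume.restrict G] τ')
    (hg : g =ᵐ[volume.restrict G] g') : HasWeakDiv G v' τ' g' := by
  intro φ h1 h2 h3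
  have e1 : ∫ z in G, g' z * φ z = ∫ z in G, g z * φ z := by
    refine integral_congr_ae ?_
    filter_upwards [hg] with z a
    simp only [a]
  have e2 : ∫ z in G, (v' z * dt φ z + ⟪τ' z, gradX φ z⟫_ℝ) =
      ∫ z in G, (v z * dt φ z + ⟪τ z, gradX φ z⟫_ℝ) := by
    refine integral_congr_ae ?_
    filter_upwards [hv, hτ] with z a b
    simp only [a, b]
  rw [e1, e2, h φ h1 h2 h3]

lemma HasWeakGrad.congr {G : Set (SpaceTime d)} {v v' : SpaceTime d → ℝ}
    {σ σ' : SpaceTime d → Space d} (h : HasWeakGrad G v σ)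
    (hv : v =ᵐ[volume.restrict G] v') (hσ : σ =ᵐ[volume.restrict G] σ') :
    HasWeakGrad G v' σ' := by
  intro χ h1 h2 h3
  have e1 : ∫ z in G, ⟪σ' z, χ z⟫_ℝ = ∫ z in G, ⟪σ z, χ z⟫_ℝ := by
    refine integral_congr_ae ?_
    filter_upwards [hσ] with z a
    simp only [a]
  have e2 : ∫ z in G, v' z * divX χ z = ∫ z in G, v z * divX χ z := by
    refine integral_congr_ae ?_
    filter_upwards [hv] with z a
    simp only [a]
  rw [e1, e2, h χ h1 h2 h3]

lemma HasWeakDiv.add {G : Set (SpaceTime d)} {v v' : SpaceTime d → ℝ}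
    {τ τ' : SpaceTime d → Space d} {g g' : SpaceTime d → ℝ}
    (h : HasWeakDiv G v τ g) (h' : HasWeakDiv G v' τ' g')
    (mv : MemLp v 2 (volume.restrict G)) (mv' : MemLp v' 2 (volume.restrict G))
    (mτ : MemLp τ 2 (volume.restrict G)) (mτ' : MemLp τ' 2 (volume.restrict G))
    (mg : MemLp g 2 (volume.restrict G)) (mg' : MemLp g' 2 (volume.restrict G)) :
    HasWeakDiv G (v + v') (τ + τ') (g + g') := by
  intro φ h1 h2 h3
  have c1 := continuous_dt h1
  have c2 := continuous_gradX h1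
  have k1 := compact_dt h2
  have k2 := compact_gradX h2
  have e1 : ∫ z in G, (g + g') z * φ z = (∫ z in G, g z * φ z) + ∫ z in G, g' z * φ z := by
    rw [← integral_add (integrable_mul_test mg h1.continuous h2)
      (integrable_mul_test mg' h1.continuous h2)]
    simp [add_mul]
  have e2 : ∫ z in G, ((v + v') z * dt φ z + ⟪(τ + τ') z, gradX φ z⟫_ℝ) =
      (∫ z in G, (v z * dt φ z + ⟪τ z, gradX φ z⟫_ℝ)) +
        ∫ z in G, (v' z * dt φ z + ⟪τ' z, gradX φ z⟫_ℝ) := by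
    have i1 : Integrable (fun z => v z * dt φ z + ⟪τ z, gradX φ z⟫_ℝ) (volume.restrict G) :=
      (integrable_mul_test mv c1 k1).add (integrable_inner_test mτ c2 k2)
    have i2 : Integrable (fun z => v' z * dt φ z + ⟪τ' z, gradX φ z⟫_ℝ) (volume.restrict G) :=
      (integrable_mul_test mv' c1 k1).add (integrable_inner_test mτ' c2 k2)
    rw [← integral_add i1 i2]
    refine integral_congr_ae (Filter.Eventually.of_forall fun z => ?_)
    simp only [Pi.add_apply, inner_add_left]
    ring
  rw [e1, e2, h φ h1 h2 h3, h' φ h1 h2 h3]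
  ring

lemma HasWeakDiv.smul {G : Set (SpaceTime d)} {v : SpaceTime d → ℝ}
    {τ : SpaceTime d → Space d} {g : SpaceTime d → ℝ} (h : HasWeakDiv G v τ g) (c : ℝ) :
    HasWeakDiv G (c • v) (c • τ) (c • g) := by
  intro φ h1 h2 h3
  have e1 : ∫ z in G, (c • g) z * φ z = c * ∫ z in G, g z * φ z := by
    rw [← integral_const_mul]
    simp [mul_assoc]
  have e2 : ∫ z in G, ((c • v) z * dt φ z + ⟪(c • τ) z, gradX φ z⟫_ℝ) =
      c * ∫ z in G, (v z * dt φ z + ⟪τ z, gradX φ z⟫_ℝ) := by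
    rw [← integral_const_mul]
    refine integral_congr_ae (Filter.Eventually.of_forall fun z => ?_)
    simp only [Pi.smul_apply, real_inner_smul_left, smul_eq_mul]
    ring
  rw [e1, e2, h φ h1 h2 h3]
  ring

lemma HasWeakGrad.add {G : Set (SpaceTime d)} {v v' : SpaceTime d → ℝ}
    {σ σ' : SpaceTime d → Space d} (h : HasWeakGrad G v σ) (h' : HasWeakGrad G v' σ')
    (mv : MemLp v 2 (volume.restrict G)) (mv' : MemLp v' 2 (volume.restrict G))
    (mσ : MemLp σ 2 (volume.restrict G)) (mσ' : MemLp σ' 2 (volume.restrict G)) :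
    HasWeakGrad G (v + v') (σ + σ') := by
  intro χ h1 h2 h3
  have c1 := continuous_divX h1
  have k1 := compact_divX h2
  have e1 : ∫ z in G, ⟪(σ + σ') z, χ z⟫_ℝ =
      (∫ z in G, ⟪σ z, χ z⟫_ℝ) + ∫ z in G, ⟪σ' z, χ z⟫_ℝ := by
    rw [← integral_add (integrable_inner_test mσ h1.continuous h2)
      (integrable_inner_test mσ' h1.continuous h2)]
    simp [inner_add_left]
  have e2 : ∫ z in G, (v + v') z * divX χ z =
      (∫ z in G, v z * divX χ z) + ∫ z in G, v' z * divX χ z := by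
    rw [← integral_add (integrable_mul_test mv c1 k1) (integrable_mul_test mv' c1 k1)]
    simp [add_mul]
  rw [e1, e2, h χ h1 h2 h3, h' χ h1 h2 h3]
  ring

lemma HasWeakGrad.smul {G : Set (SpaceTime d)} {v : SpaceTime d → ℝ}
    {σ : SpaceTime d → Space d} (h : HasWeakGrad G v σ) (c : ℝ) :
    HasWeakGrad G (c • v) (c • σ) := by
  intro χ h1 h2 h3
  have e1 : ∫ z in G, ⟪(c • σ) z, χ z⟫_ℝ = c * ∫ z in G, ⟪σ z, χ z⟫_ℝ := by
    rw [← integral_const_mul]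
    simp [real_inner_smul_left]
  have e2 : ∫ z in G, (c • v) z * divX χ z = c * ∫ z in G, v z * divX χ z := by
    rw [← integral_const_mul]
    simp [mul_assoc]
  rw [e1, e2, h χ h1 h2 h3]
  ring

lemma ae_eq_zero_of_tests {F : Type*} [NormedAddCommGroup F] [NormedSpace ℝ F] [CompleteSpace F]
    {G : Set (SpaceTime d)} (hG : IsOpen G) {f : SpaceTime d → F}
    (m : MemLp f 2 (volume.restrict G))
    (h : ∀ φ : SpaceTime d → ℝ, ContDiff ℝ ∞ φ → HasCompactSupport φ → tsupport φ ⊆ G →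
      ∫ z in G, φ z • f z = 0) : f =ᵐ[volume.restrict G] 0 := by
  have hl : LocallyIntegrableOn f G volume :=
    locallyIntegrableOn_of_locallyIntegrable_restrict (m.locallyIntegrable (by norm_num))
  have := hG.ae_eq_zero_of_integral_contDiff_smul_eq_zero hl fun φ h1 h2 h3 => by
    rw [← setIntegral_eq_integral_of_forall_compl_eq_zero (s := G)]
    · exact h φ h1 h2 h3
    · intro z hz
      rw [image_eq_zero_of_notMem_tsupport fun hz' => hz (h3 hz'), zero_smul]
  rw [Filter.EventuallyEq, ae_restrict_iff' hG.measurableSet]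
  exact this

/-- Weak divergences are unique. -/
lemma HasWeakDiv.unique {G : Set (SpaceTime d)} (hG : IsOpen G) {v : SpaceTime d → ℝ}
    {τ : SpaceTime d → Space d} {g g' : SpaceTime d → ℝ}
    (h : HasWeakDiv G v τ g) (h' : HasWeakDiv G v τ g')
    (mg : MemLp g 2 (volume.restrict G)) (mg' : MemLp g' 2 (volume.restrict G)) :
    g =ᵐ[volume.restrict G] g' := by
  have key := ae_eq_zero_of_tests hG (mg.sub mg') ?_
  · filter_upwards [key] with z hz
    simpa [sub_eq_zero] using hz
  · intro φ h1 h2 h3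
    have e : ∫ z in G, φ z • (g - g') z =
        (∫ z in G, g z * φ z) - ∫ z in G, g' z * φ z := by
      rw [← integral_sub (integrable_mul_test mg h1.continuous h2)
        (integrable_mul_test mg' h1.continuous h2)]
      refine integral_congr_ae (Filter.Eventually.of_forall fun z => ?_)
      simp only [Pi.sub_apply, smul_eq_mul]
      ring
    rw [e, h φ h1 h2 h3, h' φ h1 h2 h3, sub_self]

/-- Weak gradients are unique. -/
lemma HasWeakGrad.unique {G : Set (SpaceTime d)} (hG : IsOpen G) {v : SpaceTime d → ℝ}
    {σ σ' : SpaceTime d → Space d} (h : HasWeakGrad G v σ) (h' : HasWeakGrad G v σ')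
    (mσ : MemLp σ 2 (volume.restrict G)) (mσ' : MemLp σ' 2 (volume.restrict G)) :
    σ =ᵐ[volume.restrict G] σ' := by
  have key := ae_eq_zero_of_tests hG (mσ.sub mσ') ?_
  · filter_upwards [key] with z hz
    simpa [sub_eq_zero] using hz
  · intro φ h1 h2 h3
    have mφ : MemLp φ 2 (volume.restrict G) := h1.continuous.memLp_of_hasCompactSupport h2
    have hint : Integrable (fun z => φ z • (σ - σ') z) (volume.restrict G) :=
      memLp_one_iff_integrable.1 ((mσ.sub mσ').smul mφ)
    refine ext_inner_left ℝ fun e => ?_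
    rw [inner_zero_right, ← integral_inner hint]
    have hs : HasCompactSupport fun z => φ z • e := h2.smul_right
    have hc : ContDiff ℝ ∞ fun z => φ z • e := h1.smul contDiff_const
    have ht : tsupport (fun z => φ z • e) ⊆ G :=
      (closure_mono (Function.support_smul_subset_left φ fun _ => e)).trans h3
    have e1 : ∫ z in G, ⟪e, φ z • (σ - σ') z⟫_ℝ =
        (∫ z in G, ⟪σ z, φ z • e⟫_ℝ) - ∫ z in G, ⟪σ' z, φ z • e⟫_ℝ := by
      rw [← integral_sub (integrable_inner_test mσ hc.continuous hs)
        (integrable_inner_test mσ' hc.continuous hs)]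
      refine integral_congr_ae (Filter.Eventually.of_forall fun z => ?_)
      simp only [Pi.sub_apply, inner_smul_right, inner_sub_right, real_inner_comm]
      ring
    rw [e1, h _ hc hs ht, h' _ hc hs ht, sub_self]

variable {Q : Set (SpaceTime d)}

/-- Two functions that agree almost everywhere on each cell agree almost everywhere. -/
lemma Mesh.ae_eq {F : Type*} (𝒯 : Mesh Q) {f g : SpaceTime d → F}
    (h : ∀ K ∈ 𝒯.cells, f =ᵐ[volume.restrict K] g) : f =ᵐ[volume.restrict Q] g := by
  have h1 : ∀ᵐ z ∂(volume.restrict (⋃ K ∈ 𝒯.cells, K)), f z = g z := by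
    rw [ae_restrict_biUnion_finset_iff]
    exact h
  have h2 : (volume.restrict Q : Measure (SpaceTime d)) ≤ volume.restrict (⋃ K ∈ 𝒯.cells, K) :=
    Measure.restrict_mono_ae ((ae_le_set).2 𝒯.covers)
  exact h2.absolutelyContinuous.ae_le h1

lemma Mesh.restrict_le (𝒯 : Mesh Q) {K : Set (SpaceTime d)} (hK : K ∈ 𝒯.cells) :
    (volume.restrict K : Measure (SpaceTime d)) ≤ volume.restrict Q :=
  Measure.restrict_mono (𝒯.subset K hK) le_rfl

lemma Mesh.ae_cell {F : Type*} (𝒯 : Mesh Q) {K : Set (SpaceTime d)} (hK : K ∈ 𝒯.cells)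
    {f g : SpaceTime d → F} (h : f =ᵐ[volume.restrict Q] g) : f =ᵐ[volume.restrict K] g :=
  (𝒯.restrict_le hK).absolutelyContinuous.ae_le h

/-- Square integrable functions on the cells glue to a square integrable function on `Q`. -/
lemma Mesh.glue {F : Type*} [NormedAddCommGroup F] (𝒯 : Mesh Q)
    (f : Set (SpaceTime d) → SpaceTime d → F)
    (hf : ∀ K ∈ 𝒯.cells, MemLp (f K) 2 (volume.restrict K)) :
    ∃ g : Lp F 2 (volume.restrict Q), ∀ K ∈ 𝒯.cells, g =ᵐ[volume.restrict K] f K := by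
  have m : MemLp (fun z => ∑ K ∈ 𝒯.cells, K.indicator (f K) z) 2 (volume.restrict Q) := by
    refine memLp_finsetSum _ fun K hK => ?_
    rw [memLp_indicator_iff_restrict (𝒯.isOpen K hK).measurableSet]
    exact (hf K hK).mono_measure
      (by rw [Measure.restrict_restrict (𝒯.isOpen K hK).measurableSet]
          exact Measure.restrict_mono inter_subset_left le_rfl)
  refine ⟨m.toLp _, fun K hK => ?_⟩
  have h1 := 𝒯.ae_cell hK m.coeFn_toLp
  filter_upwards [h1, ae_restrict_mem (𝒯.isOpen K hK).measurableSet] with z hz hzK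
  rw [hz, Finset.sum_eq_single_of_mem K hK]
  · exact indicator_of_mem hzK _
  · intro L hL hLK
    exact indicator_of_notMem
      (fun hzL => (Set.disjoint_left.1 (𝒯.disjoint hL hK hLK)) hzL hzK) _

end Auxiliary

/-! ### Broken spaces -/

/-- The space `H(A*, 𝒯)` of broken functions. -/
def brokenSpace {d : ℕ} {Q : Set (SpaceTime d)} (𝒯 : Mesh Q) : Submodule ℝ (L2Pair Q) where
  carrier := {w | ∀ K ∈ 𝒯.cells, MemGraph K w.fst w.snd}
  add_mem' := by
    intro a b ha hb K hK
    have hle := 𝒯.restrict_le hK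
    obtain ⟨⟨g, mg, hg⟩, σ, mσ, hσ⟩ := ha K hK
    obtain ⟨⟨g', mg', hg'⟩, σ', mσ', hσ'⟩ := hb K hK
    have e1 := (𝒯.ae_cell hK (Lp.coeFn_add a.fst b.fst)).symm
    have e2 := (𝒯.ae_cell hK (Lp.coeFn_add a.snd b.snd)).symm
    have n1 := (Lp.memLp a.fst).mono_measure hle
    have n2 := (Lp.memLp b.fst).mono_measure hle
    have n3 := (Lp.memLp a.snd).mono_measure hle
    have n4 := (Lp.memLp b.snd).mono_measure hle
    exact ⟨⟨g + g', mg.add mg', (hg.add hg' n1 n2 n3 n4 mg mg').congr e1 e2 .rfl⟩,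
      σ + σ', mσ.add mσ', (hσ.add hσ' n1 n2 mσ mσ').congr e1 .rfl⟩
  zero_mem' := by
    intro K hK
    have e1 := 𝒯.ae_cell hK (Lp.coeFn_zero ℝ 2 (volume.restrict Q))
    have e2 := 𝒯.ae_cell hK (Lp.coeFn_zero (Space d) 2 (volume.restrict Q))
    have z1 : HasWeakDiv K 0 0 0 := fun φ _ _ _ => by simp
    have z2 : HasWeakGrad K 0 0 := fun φ _ _ _ => by simp
    exact ⟨⟨0, MemLp.zero, z1.congr e1.symm e2.symm .rfl⟩, 0, MemLp.zero,
      z2.congr e1.symm .rfl⟩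
  smul_mem' := by
    intro c a ha K hK
    obtain ⟨⟨g, mg, hg⟩, σ, mσ, hσ⟩ := ha K hK
    have e1 := (𝒯.ae_cell hK (Lp.coeFn_smul c a.fst)).symm
    have e2 := (𝒯.ae_cell hK (Lp.coeFn_smul c a.snd)).symm
    exact ⟨⟨c • g, mg.const_smul c, (hg.smul c).congr e1 e2 .rfl⟩,
      c • σ, mσ.const_smul c, (hσ.smul c).congr e1 .rfl⟩

section Operators

variable {d : ℕ} {Q : Set (SpaceTime d)}

lemma cellDiv_spec (𝒯 : Mesh Q) {w : L2Pair Q} (hw : w ∈ brokenSpace 𝒯) :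
    ∀ K ∈ 𝒯.cells, HasWeakDiv K w.fst w.snd (cellDiv 𝒯.cells w) := by
  have h : ∃ g : L2 Q, ∀ K ∈ 𝒯.cells, HasWeakDiv K w.fst w.snd g := by
    have h0 : ∀ K, K ∈ 𝒯.cells → ∃ g : SpaceTime d → ℝ, MemLp g 2 (volume.restrict K) ∧
      HasWeakDiv K w.fst w.snd g := fun K hK => (hw K hK).1
    choose! f m hf using h0
    obtain ⟨g, hg⟩ := 𝒯.glue f m
    exact ⟨g, fun K hK => (hf K hK).congr .rfl .rfl (hg K hK).symm⟩
  rw [cellDiv, dif_pos h]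
  exact h.choose_spec

lemma cellGrad_spec (𝒯 : Mesh Q) {w : L2Pair Q} (hw : w ∈ brokenSpace 𝒯) :
    ∀ K ∈ 𝒯.cells, HasWeakGrad K w.fst (cellGrad 𝒯.cells w) := by
  have h : ∃ g : L2Vec Q, ∀ K ∈ 𝒯.cells, HasWeakGrad K w.fst g := by
    have h0 : ∀ K, K ∈ 𝒯.cells → ∃ g : SpaceTime d → Space d, MemLp g 2 (volume.restrict K) ∧
      HasWeakGrad K w.fst g := fun K hK => (hw K hK).2
    choose! f m hf using h0
    obtain ⟨g, hg⟩ := 𝒯.glue f m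
    exact ⟨g, fun K hK => (hf K hK).congr .rfl (hg K hK).symm⟩
  rw [cellGrad, dif_pos h]
  exact h.choose_spec

lemma cellDiv_eq (𝒯 : Mesh Q) {w : L2Pair Q} (hw : w ∈ brokenSpace 𝒯) {g : L2 Q}
    (hg : ∀ K ∈ 𝒯.cells, HasWeakDiv K w.fst w.snd g) : cellDiv 𝒯.cells w = g := by
  refine Lp.ext (𝒯.ae_eq fun K hK => ?_)
  exact (cellDiv_spec 𝒯 hw K hK).unique (𝒯.isOpen K hK) (hg K hK)
    ((Lp.memLp _).mono_measure (𝒯.restrict_le hK)) ((Lp.memLp _).mono_measure (𝒯.restrict_le hK))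

lemma cellGrad_eq (𝒯 : Mesh Q) {w : L2Pair Q} (hw : w ∈ brokenSpace 𝒯) {σ : L2Vec Q}
    (hσ : ∀ K ∈ 𝒯.cells, HasWeakGrad K w.fst σ) : cellGrad 𝒯.cells w = σ := by
  refine Lp.ext (𝒯.ae_eq fun K hK => ?_)
  exact (cellGrad_spec 𝒯 hw K hK).unique (𝒯.isOpen K hK) (hσ K hK)
    ((Lp.memLp _).mono_measure (𝒯.restrict_le hK)) ((Lp.memLp _).mono_measure (𝒯.restrict_le hK))

lemma cellDiv_add (𝒯 : Mesh Q) {a b : L2Pair Q} (ha : a ∈ brokenSpace 𝒯)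
    (hb : b ∈ brokenSpace 𝒯) :
    cellDiv 𝒯.cells (a + b) = cellDiv 𝒯.cells a + cellDiv 𝒯.cells b := by
  refine cellDiv_eq 𝒯 (add_mem ha hb) fun K hK => ?_
  have hle := 𝒯.restrict_le hK
  exact ((cellDiv_spec 𝒯 ha K hK).add (cellDiv_spec 𝒯 hb K hK)
    ((Lp.memLp _).mono_measure hle) ((Lp.memLp _).mono_measure hle)
    ((Lp.memLp _).mono_measure hle) ((Lp.memLp _).mono_measure hle)
    ((Lp.memLp _).mono_measure hle) ((Lp.memLp _).mono_measure hle)).congr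
    (𝒯.ae_cell hK (Lp.coeFn_add a.fst b.fst)).symm (𝒯.ae_cell hK (Lp.coeFn_add a.snd b.snd)).symm
    (𝒯.ae_cell hK (Lp.coeFn_add _ _)).symm

lemma cellGrad_add (𝒯 : Mesh Q) {a b : L2Pair Q} (ha : a ∈ brokenSpace 𝒯)
    (hb : b ∈ brokenSpace 𝒯) :
    cellGrad 𝒯.cells (a + b) = cellGrad 𝒯.cells a + cellGrad 𝒯.cells b := by
  refine cellGrad_eq 𝒯 (add_mem ha hb) fun K hK => ?_
  have hle := 𝒯.restrict_le hK
  exact ((cellGrad_spec 𝒯 ha K hK).add (cellGrad_spec 𝒯 hb K hK)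
    ((Lp.memLp _).mono_measure hle) ((Lp.memLp _).mono_measure hle)
    ((Lp.memLp _).mono_measure hle) ((Lp.memLp _).mono_measure hle)).congr
    (𝒯.ae_cell hK (Lp.coeFn_add a.fst b.fst)).symm (𝒯.ae_cell hK (Lp.coeFn_add _ _)).symm

lemma cellDiv_smul (𝒯 : Mesh Q) (c : ℝ) {a : L2Pair Q} (ha : a ∈ brokenSpace 𝒯) :
    cellDiv 𝒯.cells (c • a) = c • cellDiv 𝒯.cells a := by
  refine cellDiv_eq 𝒯 (Submodule.smul_mem _ c ha) fun K hK => ?_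
  exact ((cellDiv_spec 𝒯 ha K hK).smul c).congr
    (𝒯.ae_cell hK (Lp.coeFn_smul c a.fst)).symm (𝒯.ae_cell hK (Lp.coeFn_smul c a.snd)).symm
    (𝒯.ae_cell hK (Lp.coeFn_smul c _)).symm

lemma cellGrad_smul (𝒯 : Mesh Q) (c : ℝ) {a : L2Pair Q} (ha : a ∈ brokenSpace 𝒯) :
    cellGrad 𝒯.cells (c • a) = c • cellGrad 𝒯.cells a := by
  refine cellGrad_eq 𝒯 (Submodule.smul_mem _ c ha) fun K hK => ?_
  exact ((cellGrad_spec 𝒯 ha K hK).smul c).congr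
    (𝒯.ae_cell hK (Lp.coeFn_smul c a.fst)).symm (𝒯.ae_cell hK (Lp.coeFn_smul c _)).symm

lemma opAstarH_add (𝒯 : Mesh Q) {a b : L2Pair Q} (ha : a ∈ brokenSpace 𝒯)
    (hb : b ∈ brokenSpace 𝒯) : opAstarH 𝒯 (a + b) = opAstarH 𝒯 a + opAstarH 𝒯 b := by
  have e : (a + b).snd = a.snd + b.snd := rfl
  rw [opAstarH, cellDiv_add 𝒯 ha hb, cellGrad_add 𝒯 ha hb, e]
  refine congrArg (WithLp.toLp 2) (Prod.ext ?_ ?_)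
  · exact neg_add _ _
  · change -(_ + _) + (_ + _) = (-_ + _) + (-_ + _)
    abel

lemma opAstarH_smul (𝒯 : Mesh Q) (c : ℝ) {a : L2Pair Q} (ha : a ∈ brokenSpace 𝒯) :
    opAstarH 𝒯 (c • a) = c • opAstarH 𝒯 a := by
  have e : (c • a).snd = c • a.snd := rfl
  rw [opAstarH, cellDiv_smul 𝒯 c ha, cellGrad_smul 𝒯 c ha, e]
  refine congrArg (WithLp.toLp 2) (Prod.ext ?_ ?_)
  · exact (smul_neg _ _).symm
  · change -(c • _) + c • _ = c • (-_ + _)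
    rw [smul_add, smul_neg]

end Operators

/-! ### The test space `Y`, its dual, and the broken variational problem -/

/-- The test space `Y = H(A*, 𝒯) × L²(Ω)`. -/
def TestSpace {d : ℕ} {Tend : ℝ} {Ω : Set (Space d)} (𝒯 : Mesh (cylinder Tend Ω)) : Type :=
  brokenSpace 𝒯 × L2Space Ω

section Problem

variable {d : ℕ} {Tend : ℝ} {Ω : Set (Space d)}

instance (𝒯 : Mesh (cylinder Tend Ω)) : AddCommGroup (TestSpace 𝒯) :=
  inferInstanceAs (AddCommGroup (brokenSpace 𝒯 × L2Space Ω))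

instance (𝒯 : Mesh (cylinder Tend Ω)) : Module ℝ (TestSpace 𝒯) :=
  inferInstanceAs (Module ℝ (brokenSpace 𝒯 × L2Space Ω))

/-- The first component `(w, ξ) ↦ w`. -/
def TestSpace.wLin (𝒯 : Mesh (cylinder Tend Ω)) : TestSpace 𝒯 →ₗ[ℝ] L2Pair (cylinder Tend Ω) where
  toFun y := (y.1 : L2Pair (cylinder Tend Ω))
  map_add' _ _ := rfl
  map_smul' _ _ := rfl

/-- The map `(w, ξ) ↦ A*ₕ w`. -/
def TestSpace.astarLin (𝒯 : Mesh (cylinder Tend Ω)) :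
    TestSpace 𝒯 →ₗ[ℝ] L2Pair (cylinder Tend Ω) where
  toFun y := opAstarH 𝒯 (y.1 : L2Pair (cylinder Tend Ω))
  map_add' y y' := opAstarH_add 𝒯 y.1.2 y'.1.2
  map_smul' c y := opAstarH_smul 𝒯 c y.1.2

/-- The second component `(w, ξ) ↦ ξ`. -/
def TestSpace.xiLin (𝒯 : Mesh (cylinder Tend Ω)) : TestSpace 𝒯 →ₗ[ℝ] L2Space Ω where
  toFun y := y.2
  map_add' _ _ := rfl
  map_smul' _ _ := rfl

/-- The inner product
`⟨(w, ξ), (w', ξ')⟩ = ⟨w, w'⟩ + ⟨A*ₕ w, A*ₕ w'⟩ + ⟨ξ, ξ'⟩` of `Y`. -/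
@[reducible]
def TestSpace.core (𝒯 : Mesh (cylinder Tend Ω)) : InnerProductSpace.Core ℝ (TestSpace 𝒯) where
  inner y y' := ⟪TestSpace.wLin 𝒯 y, TestSpace.wLin 𝒯 y'⟫_ℝ +
    ⟪TestSpace.astarLin 𝒯 y, TestSpace.astarLin 𝒯 y'⟫_ℝ +
    ⟪TestSpace.xiLin 𝒯 y, TestSpace.xiLin 𝒯 y'⟫_ℝ
  conj_inner_symm y y' := by
    simp only [conj_trivial]
    rw [real_inner_comm, real_inner_comm (TestSpace.astarLin 𝒯 y),
      real_inner_comm (TestSpace.xiLin 𝒯 y)]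
  re_inner_nonneg y := by
    simp only [RCLike.re_to_real]
    exact add_nonneg (add_nonneg real_inner_self_nonneg real_inner_self_nonneg)
      real_inner_self_nonneg
  add_left x y z := by
    simp only [map_add, inner_add_left]
    ring
  smul_left x y r := by
    simp only [map_smul, real_inner_smul_left, conj_trivial]
    ring
  definite y h := by
    have h1 : 0 ≤ ⟪TestSpace.wLin 𝒯 y, TestSpace.wLin 𝒯 y⟫_ℝ := real_inner_self_nonneg
    have h2 : 0 ≤ ⟪TestSpace.astarLin 𝒯 y, TestSpace.astarLin 𝒯 y⟫_ℝ := real_inner_self_nonneg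
    have h3 : 0 ≤ ⟪TestSpace.xiLin 𝒯 y, TestSpace.xiLin 𝒯 y⟫_ℝ := real_inner_self_nonneg
    have k1 : TestSpace.wLin 𝒯 y = 0 := inner_self_eq_zero (𝕜 := ℝ).1 (by linarith)
    have k3 : TestSpace.xiLin 𝒯 y = 0 := inner_self_eq_zero (𝕜 := ℝ).1 (by linarith)
    exact Prod.ext (Subtype.ext k1) k3

instance (𝒯 : Mesh (cylinder Tend Ω)) : NormedAddCommGroup (TestSpace 𝒯) :=
  (TestSpace.core 𝒯).toNormedAddCommGroup

instance (𝒯 : Mesh (cylinder Tend Ω)) : InnerProductSpace ℝ (TestSpace 𝒯) :=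
  InnerProductSpace.ofCore (TestSpace.core 𝒯).toCore

lemma TestSpace.norm_sq (𝒯 : Mesh (cylinder Tend Ω)) (y : TestSpace 𝒯) :
    ‖y‖ ^ 2 = ‖TestSpace.wLin 𝒯 y‖ ^ 2 + ‖TestSpace.astarLin 𝒯 y‖ ^ 2 +
      ‖TestSpace.xiLin 𝒯 y‖ ^ 2 := by
  rw [← real_inner_self_eq_norm_sq, ← real_inner_self_eq_norm_sq, ← real_inner_self_eq_norm_sq,
    ← real_inner_self_eq_norm_sq]
  rfl

/-- The bounded map `(w, ξ) ↦ w`. -/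
def TestSpace.w (𝒯 : Mesh (cylinder Tend Ω)) : TestSpace 𝒯 →L[ℝ] L2Pair (cylinder Tend Ω) :=
  (TestSpace.wLin 𝒯).mkContinuous 1 fun y => by
    rw [one_mul]
    refine le_of_sq_le_sq ?_ (norm_nonneg _)
    rw [TestSpace.norm_sq]
    nlinarith [sq_nonneg ‖TestSpace.astarLin 𝒯 y‖, sq_nonneg ‖TestSpace.xiLin 𝒯 y‖]

/-- The bounded map `(w, ξ) ↦ A*ₕ w`. -/
def TestSpace.astar (𝒯 : Mesh (cylinder Tend Ω)) :
    TestSpace 𝒯 →L[ℝ] L2Pair (cylinder Tend Ω) :=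
  (TestSpace.astarLin 𝒯).mkContinuous 1 fun y => by
    rw [one_mul]
    refine le_of_sq_le_sq ?_ (norm_nonneg _)
    rw [TestSpace.norm_sq]
    nlinarith [sq_nonneg ‖TestSpace.wLin 𝒯 y‖, sq_nonneg ‖TestSpace.xiLin 𝒯 y‖]

/-- The bounded map `(w, ξ) ↦ ξ`. -/
def TestSpace.xi (𝒯 : Mesh (cylinder Tend Ω)) : TestSpace 𝒯 →L[ℝ] L2Space Ω :=
  (TestSpace.xiLin 𝒯).mkContinuous 1 fun y => by
    rw [one_mul]
    refine le_of_sq_le_sq ?_ (norm_nonneg _)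
    rw [TestSpace.norm_sq]
    nlinarith [sq_nonneg ‖TestSpace.wLin 𝒯 y‖, sq_nonneg ‖TestSpace.astarLin 𝒯 y‖]

/-- The trace operator `γ_A : U₀ → Y*`,
`⟨γ_A v, (w, ξ)⟩ = ⟨A v, w⟩ - ⟨v, A*ₕ w⟩ + ⟨γ₀ v, ξ⟩`. -/
def gammaA (𝒯 : Mesh (cylinder Tend Ω)) (v : L2Pair (cylinder Tend Ω)) :
    StrongDual ℝ (TestSpace 𝒯) :=
  (innerSL ℝ (opA v)).comp (TestSpace.w 𝒯) - (innerSL ℝ v).comp (TestSpace.astar 𝒯) +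
    (innerSL ℝ (gamma0 v)).comp (TestSpace.xi 𝒯)

/-- The trace space `Γ(∂𝒯) = γ_A U₀ ⊆ Y*`. -/
def traceSpace (𝒯 : Mesh (cylinder Tend Ω)) : Set (StrongDual ℝ (TestSpace 𝒯)) :=
  gammaA 𝒯 '' spaceU0 (cylinder Tend Ω)

/-- The trial space `X = (L²(Q) × L²(Q; ℝᵈ)) × Γ(∂𝒯)`. -/
def trialSpace (𝒯 : Mesh (cylinder Tend Ω)) :
    Set (L2Pair (cylinder Tend Ω) × StrongDual ℝ (TestSpace 𝒯)) :=
  univ ×ˢ traceSpace 𝒯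

/-- The form `b(v, t; w, ξ) = ⟨v, A*ₕ w⟩ + ⟨t, (w, ξ)⟩`. -/
def formB (𝒯 : Mesh (cylinder Tend Ω))
    (x : L2Pair (cylinder Tend Ω) × StrongDual ℝ (TestSpace 𝒯)) (y : TestSpace 𝒯) : ℝ :=
  ⟪x.1, TestSpace.astar 𝒯 y⟫_ℝ + x.2 y

/-- The functional `F(w, ξ) = ⟨f, w⟩ + ⟨u₀, ξ⟩` in `Y*`. -/
def load (𝒯 : Mesh (cylinder Tend Ω)) (f : L2Pair (cylinder Tend Ω)) (u₀ : L2Space Ω) :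
    StrongDual ℝ (TestSpace 𝒯) :=
  (innerSL ℝ f).comp (TestSpace.w 𝒯) + (innerSL ℝ u₀).comp (TestSpace.xi 𝒯)

/-- `u ∈ U₀` solves the first-order system `A u = f`, `γ₀ u = u₀`. -/
def SolvesFirstOrderSystem (f : L2Pair (cylinder Tend Ω)) (u₀ : L2Space Ω)
    (u : L2Pair (cylinder Tend Ω)) : Prop :=
  u ∈ spaceU0 (cylinder Tend Ω) ∧ opA u = f ∧ gamma0 u = u₀

/-- `x = (u, s) ∈ X` solves the broken variational problem `b(u, s; w, ξ) = F(w, ξ)` for all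
`(w, ξ) ∈ Y`. -/
def SolvesBrokenProblem (𝒯 : Mesh (cylinder Tend Ω)) (F : StrongDual ℝ (TestSpace 𝒯))
    (x : L2Pair (cylinder Tend Ω) × StrongDual ℝ (TestSpace 𝒯)) : Prop :=
  x ∈ trialSpace 𝒯 ∧ ∀ y : TestSpace 𝒯, formB 𝒯 x y = F y

end Problem

end

end HeatDPG

/-! Once the initial trace exists, the equivalence is short. If `u` is in `U₀`, inserting the
definition of `γ_A u` cancels the terms `⟨u, A*ₕ w⟩` and leaves `⟨A u, w⟩ + ⟨γ₀ u, ξ⟩`; this is the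
first implication. For the converse, write `s = γ_A a` with `a ∈ U₀`. Testing with `w = 0` gives `γ₀
a = u₀`, and testing with `ξ = 0` shows that `e = u - a` satisfies `⟨e, A*ₕ w⟩ = ⟨f - A a, w⟩` for
all broken `w`. Restrictions of functions smooth on the whole space are admissible `w`, and they
need not vanish on the boundary of `Q`. The vector tests give the weak gradient of `e` together with
its lateral condition. The scalar tests give the divergence and, since they are free at `t = 0`,
also `γ₀ e = 0` (`HasInitialTrace.eq_zero`). So `e ∈ U₀`, `u = a + e` solves the system, and `s =
γ_A u` because both satisfy `(*)`.

The substantial part is the existence of the trace. The functions `v_κ(t) = ∫₀¹ v((1 - κ) t + κ T r)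
dr` average over windows that stay inside `(0, T)`. They are absolutely continuous in time and
converge to `v` in `L²` as `κ → 0`. For `w = v_κ - v_l` the energy identity expresses `‖w(t)‖² -
‖w(s)‖²` as twice the integral of `∂ₜw · w` over `(s, t) × Ω`. Here `∂ₜw = g' - divₓ τ'` weakly,
with `g'`, `τ'` bounded in `L²`, and `w` has no lateral boundary values, so Green's formula turns
the integral into `∫ (g' w + τ' · ∇ₓ w)`. This tends to zero because `w` and `∇ₓ w` do. Hence the
averages form a uniform Cauchy sequence of continuous curves in `L²(Ω)`, and their limit represents
`v` (`ZeroTraceData.exists_continuous_representative`).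

Green's formula (`HasZeroTraceGrad.green`) is needed for a function with only a spatial gradient and
for data that satisfy their equation only against compactly supported tests. The lateral condition
makes the zero extension of the function weakly differentiable in space on all of space-time. After
localization, the Lipschitz boundary allows a small shift of the support into `Q`, where
mollification yields admissible tests; the shift then tends to zero. No time derivative of the
function occurs, so sharp cut-offs in time are allowed. -/

namespace HeatDPG

/-! ### `L²` pairings with translates -/

section L2Pairing

variable {F : Type*} [NormedAddCommGroup F] [InnerProductSpace ℝ F]

lemma integrable_inner_of_memLp {α : Type*} {m : MeasurableSpace α} {μ : Measure α} {f g : α → F}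
    (hf : MemLp f 2 μ) (hg : MemLp g 2 μ) : Integrable (fun z => ⟪f z, g z⟫_ℝ) μ := by
  refine (L2.integrable_inner (𝕜 := ℝ) (hf.toLp f) (hg.toLp g)).congr ?_
  filter_upwards [hf.coeFn_toLp, hg.coeFn_toLp] with z a b
  rw [a, b]

lemma inner_toLp {α : Type*} {m : MeasurableSpace α} {μ : Measure α} {f g : α → F}
    (hf : MemLp f 2 μ) (hg : MemLp g 2 μ) :
    ⟪hf.toLp f, hg.toLp g⟫_ℝ = ∫ z, ⟪f z, g z⟫_ℝ ∂μ := by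
  rw [L2.inner_def]
  refine integral_congr_ae ?_
  filter_upwards [hf.coeFn_toLp, hg.coeFn_toLp] with z a b
  rw [a, b]

variable {Z : Type*} [NormedAddCommGroup Z] [NormedSpace ℝ Z] [FiniteDimensional ℝ Z]
  [MeasurableSpace Z] [BorelSpace Z] {μ : Measure Z} [μ.IsAddHaarMeasure]

/-- Translation acts continuously on `L²`, and the inner product with `f` is continuous. -/
lemma continuous_integral_inner_translate {f g : Z → F} (hf : MemLp f 2 μ) (hg : MemLp g 2 μ) :
    Continuous fun y => ∫ z, ⟪f z, g (z - y)⟫_ℝ ∂μ := by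
  let s : C(Z, C(Z, Z)) := ContinuousMap.curry ⟨fun p : Z × Z => p.2 - p.1, by fun_prop⟩
  have hp : ∀ y : Z, MeasurePreserving (s y) μ μ := fun y => measurePreserving_sub_right μ y
  have h1 : Continuous fun y => Lp.compMeasurePreserving (s y) (hp y) (hg.toLp g) :=
    Continuous.compMeasurePreservingLp continuous_const s.continuous hp (by norm_num)
  have h2 : ∀ y, ∫ z, ⟪f z, g (z - y)⟫_ℝ ∂μ =
      ⟪hf.toLp f, Lp.compMeasurePreserving (s y) (hp y) (hg.toLp g)⟫_ℝ := by
    intro y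
    rw [Lp.toLp_compMeasurePreserving, inner_toLp]
    rfl
  simp only [h2]
  fun_prop

/-- The bound `|f| |g| ≤ |f|² + |g|²` dominates the integrand by a product of two integrable
functions plus the integrand of a convolution of integrable functions. -/
lemma integrable_smul_inner_translate {f g : Z → F} (hf : MemLp f 2 μ) (hg : MemLp g 2 μ)
    {ρ : Z → ℝ} (h1 : Continuous ρ) (h2 : HasCompactSupport ρ) :
    Integrable (fun p : Z × Z => ⟪f p.1, ρ p.2 • g (p.1 - p.2)⟫_ℝ) (μ.prod μ) := by
  have iρ : Integrable ρ μ := h1.integrable_of_hasCompactSupport h2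
  have nf : Integrable (fun z => ‖f z‖ ^ 2) μ := hf.integrable_norm_pow (by norm_num)
  have ng : Integrable (fun z => ‖g z‖ ^ 2) μ := hg.integrable_norm_pow (by norm_num)
  have m : AEStronglyMeasurable (fun p : Z × Z => ρ p.2 • g (p.1 - p.2)) (μ.prod μ) :=
    AEStronglyMeasurable.convolution_integrand (ContinuousLinearMap.lsmul ℝ ℝ) iρ.1 hg.1
  have k1 : Integrable (fun p : Z × Z => ‖f p.1‖ ^ 2 * ‖ρ p.2‖) (μ.prod μ) := nf.mul_prod iρ.norm
  have k2 : Integrable (fun p : Z × Z => ‖ρ p.2‖ * ‖g (p.1 - p.2)‖ ^ 2) (μ.prod μ) :=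
    iρ.norm.convolution_integrand (ContinuousLinearMap.mul ℝ ℝ) ng
  refine (k1.add k2).mono' (hf.1.comp_fst.inner m) (Filter.Eventually.of_forall fun p => ?_)
  simp only [Pi.add_apply]
  calc ‖⟪f p.1, ρ p.2 • g (p.1 - p.2)⟫_ℝ‖ ≤ ‖f p.1‖ * ‖ρ p.2 • g (p.1 - p.2)‖ :=
        norm_inner_le_norm _ _
    _ = ‖ρ p.2‖ * (‖f p.1‖ * ‖g (p.1 - p.2)‖) := by rw [norm_smul]; ring
    _ ≤ ‖ρ p.2‖ * (‖f p.1‖ ^ 2 + ‖g (p.1 - p.2)‖ ^ 2) := by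
        gcongr
        nlinarith [sq_nonneg (‖f p.1‖ - ‖g (p.1 - p.2)‖), sq_nonneg ‖f p.1‖,
          sq_nonneg ‖g (p.1 - p.2)‖]
    _ = _ := by ring

/-- Fubini: averaging the translated pairings against `ρ` is the same as pairing `f` with the
mollification of `g`. -/
lemma integral_mul_integral_inner_translate [CompleteSpace F] {f g : Z → F} (hf : MemLp f 2 μ)
    (hg : MemLp g 2 μ) {ρ : Z → ℝ} (h1 : Continuous ρ) (h2 : HasCompactSupport ρ) :
    ∫ y, ρ y * ∫ z, ⟪f z, g (z - y)⟫_ℝ ∂μ ∂μ = ∫ z, ⟪f z, ∫ y, ρ y • g (z - y) ∂μ⟫_ℝ ∂μ := by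
  have key := integrable_smul_inner_translate hf hg h1 h2
  have e1 : ∀ y, ρ y * ∫ z, ⟪f z, g (z - y)⟫_ℝ ∂μ = ∫ z, ⟪f z, ρ y • g (z - y)⟫_ℝ ∂μ := by
    intro y
    rw [← integral_const_mul]
    simp only [real_inner_smul_right]
  simp only [e1]
  rw [integral_integral_swap (f := fun y z => ⟪f z, ρ y • g (z - y)⟫_ℝ) key.swap]
  refine integral_congr_ae (Filter.Eventually.of_forall fun z => ?_)
  have hloc : LocallyIntegrable g μ := hg.locallyIntegrable (by norm_num)
  have := h2.convolutionExists_left (ContinuousLinearMap.lsmul ℝ ℝ) h1 hloc z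
  exact integral_inner this (f z)

end L2Pairing

/-! ### The segment property of Lipschitz cylinders -/

section SegmentProperty

/-- Near each point of its closure, the set is mapped into itself by small shifts in some fixed
direction. -/
def SegmentProperty {Z : Type*} [NormedAddCommGroup Z] [NormedSpace ℝ Z] (G : Set Z) : Prop :=
  ∀ z ∈ closure G, ∃ e : Z, ∃ r : ℝ, 0 < r ∧
    ∀ x ∈ closure G ∩ Metric.ball z r, ∀ s ∈ Ioo 0 r, x + s • e ∈ G

variable {Z Z' : Type*} [NormedAddCommGroup Z] [NormedSpace ℝ Z] [NormedAddCommGroup Z']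
  [NormedSpace ℝ Z']

lemma SegmentProperty.prod {G : Set Z} {G' : Set Z'} (h : SegmentProperty G)
    (h' : SegmentProperty G') : SegmentProperty (G ×ˢ G') := by
  rintro ⟨z, z'⟩ hz
  rw [closure_prod_eq] at hz ⊢
  obtain ⟨e, r, hr, he⟩ := h z hz.1
  obtain ⟨e', r', hr', he'⟩ := h' z' hz.2
  refine ⟨(e, e'), min r r', lt_min hr hr', ?_⟩
  rintro ⟨x, x'⟩ ⟨⟨hx, hx'⟩, hb⟩ s hs
  rw [← ball_prod_same] at hb
  exact ⟨he x ⟨hx, Metric.ball_subset_ball (min_le_left _ _) hb.1⟩ s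
      ⟨hs.1, hs.2.trans_le (min_le_left _ _)⟩,
    he' x' ⟨hx', Metric.ball_subset_ball (min_le_right _ _) hb.2⟩ s
      ⟨hs.1, hs.2.trans_le (min_le_right _ _)⟩⟩

/-- Near an interior point the shift direction can be `0`, so only boundary points need an argument.
-/
lemma segmentProperty_of_frontier {G : Set Z} (hG : IsOpen G)
    (h : ∀ z ∈ frontier G, ∃ e : Z, ∃ r : ℝ, 0 < r ∧
      ∀ x ∈ closure G ∩ Metric.ball z r, ∀ s ∈ Ioo 0 r, x + s • e ∈ G) : SegmentProperty G := by
  intro z hz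
  by_cases hzG : z ∈ G
  · obtain ⟨r, hr, hb⟩ := Metric.isOpen_iff.1 hG z hzG
    exact ⟨0, r, hr, fun x hx s _ => by simpa using hb hx.2⟩
  · exact h z ⟨hz, by rwa [hG.interior_eq]⟩

lemma segmentProperty_Ioo {a b : ℝ} (hab : a < b) : SegmentProperty (Ioo a b) := by
  intro z hz
  rw [closure_Ioo hab.ne] at hz ⊢
  by_cases hzb : z < b
  · refine ⟨1, (b - z) / 2, by linarith, ?_⟩
    rintro x ⟨hx, hb⟩ s hs
    rw [Metric.mem_ball, Real.dist_eq, abs_lt] at hb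
    rw [smul_eq_mul, mul_one]
    exact ⟨by linarith [hx.1, hs.1], by linarith [hs.2, hb.2]⟩
  · have : z = b := le_antisymm hz.2 (not_lt.1 hzb)
    refine ⟨-1, (b - a) / 2, by linarith, ?_⟩
    rintro x ⟨hx, hb⟩ s hs
    rw [Metric.mem_ball, Real.dist_eq, abs_lt] at hb
    rw [smul_eq_mul, mul_neg, mul_one]
    exact ⟨by linarith [hs.2, hb.1], by linarith [hx.2, hs.1]⟩

/-- Points of the closure lie weakly above the graph. A shift along `e` raises the height and leaves
the component orthogonal to `e` unchanged, so the inequality becomes strict. -/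
lemma IsBoundedLipschitzDomain.segmentProperty {d : ℕ} {Ω : Set (Space d)}
    (hΩ : IsBoundedLipschitzDomain Ω) : SegmentProperty Ω := by
  refine segmentProperty_of_frontier hΩ.isOpen fun z hz => ?_
  obtain ⟨e, he, C, φ, hφ, r, hr, h⟩ := hΩ.lipschitz_boundary z hz
  -- Half the radius for the points and half for the shift: the shifted point stays in the ball
  -- where the graph describes `Ω`.
  refine ⟨e, r / 2, by linarith, ?_⟩
  rintro x ⟨hx, hb⟩ s hs
  have hxr : x ∈ Metric.ball z r := Metric.ball_subset_ball (by linarith) hb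
  have hee : ⟪e, e⟫_ℝ = 1 := by rw [real_inner_self_eq_norm_sq, he, one_pow]
  have h1 : φ (x - ⟪e, x⟫_ℝ • e) ≤ ⟪e, x⟫_ℝ := by
    have hc : IsClosed {y : Space d | φ (y - ⟪e, y⟫_ℝ • e) ≤ ⟪e, y⟫_ℝ} := by
      refine isClosed_le (hφ.continuous.comp ?_) ?_ <;> fun_prop
    have hx' : x ∈ closure (Metric.ball z r ∩ Ω) :=
      Metric.isOpen_ball.inter_closure ⟨hxr, hx⟩
    exact closure_minimal (fun y hy => ((h y hy.1).1 hy.2).le) hc hx'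
  rw [h (x + s • e)]
  · have h2 : ⟪e, x + s • e⟫_ℝ = ⟪e, x⟫_ℝ + s := by
      rw [inner_add_right, real_inner_smul_right, hee, mul_one]
    have h3 : x + s • e - (⟪e, x⟫_ℝ + s) • e = x - ⟪e, x⟫_ℝ • e := by
      rw [add_smul]
      abel
    rw [h2, h3]
    linarith [hs.1]
  · rw [Metric.mem_ball] at hb ⊢
    calc dist (x + s • e) z ≤ dist (x + s • e) x + dist x z := dist_triangle _ _ _
      _ = s + dist x z := by
        rw [dist_eq_norm, add_sub_cancel_left, norm_smul, he, mul_one, Real.norm_of_nonneg hs.1.le]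
      _ < r := by linarith [hs.2]

lemma IsBoundedLipschitzDomain.segmentProperty_cylinder {d : ℕ} {Tend : ℝ} (hT : 0 < Tend)
    {Ω : Set (Space d)} (hΩ : IsBoundedLipschitzDomain Ω) : SegmentProperty (cylinder Tend Ω) :=
  (segmentProperty_Ioo hT).prod hΩ.segmentProperty

lemma IsBoundedLipschitzDomain.isOpen_cylinder {d : ℕ} {Tend : ℝ} {Ω : Set (Space d)}
    (hΩ : IsBoundedLipschitzDomain Ω) : IsOpen (cylinder Tend Ω) :=
  isOpen_Ioo.prod hΩ.isOpen

lemma IsBoundedLipschitzDomain.isBounded_cylinder {d : ℕ} {Tend : ℝ} {Ω : Set (Space d)}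
    (hΩ : IsBoundedLipschitzDomain Ω) : Bornology.IsBounded (cylinder Tend Ω) :=
  (Metric.isBounded_Ioo 0 Tend).prod hΩ.isBounded

end SegmentProperty

/-! ### Green's formula without boundary terms -/

section

open scoped Pointwise

section Green

variable {d : ℕ}

instance : (volume : Measure (SpaceTime d)).IsAddHaarMeasure :=
  inferInstanceAs ((volume : Measure ℝ).prod (volume : Measure (Space d))).IsAddHaarMeasure

lemma integrable_const_mul_inner_add {G v : SpaceTime d → ℝ} {Θ σ : SpaceTime d → Space d}
    {μ : Measure (SpaceTime d)} (mG : MemLp G 2 μ) (mΘ : MemLp Θ 2 μ) (mv : MemLp v 2 μ)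
    (mσ : MemLp σ 2 μ) : Integrable (fun z => G z * v z + ⟪Θ z, σ z⟫_ℝ) μ :=
  (mG.integrable_mul mv).add (integrable_inner_of_memLp mΘ mσ)

lemma inner_gradX {φ : SpaceTime d → ℝ} (z : SpaceTime d) (x : Space d) :
    ⟪gradX φ z, x⟫_ℝ = ∑ i, fderiv ℝ φ z (0, EuclideanSpace.single i 1) * x i := by
  simp [gradX, PiLp.inner_apply, mul_comm]

lemma divX_smul {η : SpaceTime d → ℝ} {χ : SpaceTime d → Space d} {z : SpaceTime d}
    (h1 : DifferentiableAt ℝ η z) (h2 : DifferentiableAt ℝ χ z) :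
    divX (fun y => η y • χ y) z = η z * divX χ z + ⟪gradX η z, χ z⟫_ℝ := by
  rw [inner_gradX, divX, divX, fderiv_fun_smul h1 h2, Finset.mul_sum, ← Finset.sum_add_distrib]
  refine Finset.sum_congr rfl fun i _ => ?_
  simp

lemma divX_smul_const {η : SpaceTime d → ℝ} {z : SpaceTime d} (h1 : DifferentiableAt ℝ η z)
    (x : Space d) : divX (fun y => η y • x) z = ⟪gradX η z, x⟫_ℝ := by
  rw [divX_smul h1 (differentiableAt_const x)]
  simp [divX]

lemma gradX_comp_sub_left {ρ : SpaceTime d → ℝ} (h : Differentiable ℝ ρ) (z y : SpaceTime d) :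
    gradX (fun y => ρ (z - y)) y = - gradX ρ (z - y) := by
  ext i
  have h1 : HasFDerivAt (fun y => z - y) (-ContinuousLinearMap.id ℝ (SpaceTime d)) y :=
    (hasFDerivAt_id y).const_sub z
  have h2 := ((h (z - y)).hasFDerivAt.comp y h1).fderiv
  simp only [Function.comp_def] at h2
  simp [gradX, h2]

/-- `σ` is the weak spatial gradient on the whole space-time. -/
def HasGlobalGrad (v : SpaceTime d → ℝ) (σ : SpaceTime d → Space d) : Prop :=
  ∀ χ : SpaceTime d → Space d, ContDiff ℝ ∞ χ → HasCompactSupport χ →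
    ∫ z, ⟪σ z, χ z⟫_ℝ = - ∫ z, v z * divX χ z

/-- The derivative of the mollification falls on `ρ`. Each component is then the weak gradient
identity tested with `ρ (z - ·)` times a unit vector. -/
lemma HasGlobalGrad.gradX_convolution {v : SpaceTime d → ℝ} {σ : SpaceTime d → Space d}
    (mv : MemLp v 2 volume) (mσ : MemLp σ 2 volume) (h : HasGlobalGrad v σ)
    {ρ : SpaceTime d → ℝ} (h1 : ContDiff ℝ ∞ ρ) (h2 : HasCompactSupport ρ) (z : SpaceTime d) :
    gradX (fun z => ∫ y, ρ y • v (z - y)) z = ∫ y, ρ y • σ (z - y) := by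
  have lv : LocallyIntegrable v := mv.locallyIntegrable (by norm_num)
  have lσ : LocallyIntegrable σ := mσ.locallyIntegrable (by norm_num)
  have hd := h2.hasFDerivAt_convolution_left (μ := (volume : Measure (SpaceTime d)))
    (ContinuousLinearMap.lsmul ℝ ℝ) (h1.of_le (by simp)) lv z
  have hfd : fderiv ℝ (fun z => ∫ y, ρ y • v (z - y)) z =
      (convolution (fderiv ℝ ρ) v
        ((ContinuousLinearMap.lsmul ℝ ℝ).precompL (SpaceTime d)) volume z) := hd.fderiv
  have hex := (h2.fderiv (𝕜 := ℝ)).convolutionExists_left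
    ((ContinuousLinearMap.lsmul ℝ ℝ : ℝ →L[ℝ] ℝ →L[ℝ] ℝ).precompL (SpaceTime d))
    (h1.continuous_fderiv (by simp)) lv z
  have hσ := h2.convolutionExists_left (ContinuousLinearMap.lsmul ℝ ℝ) h1.continuous lσ z
  ext i
  set ei : Space d := EuclideanSpace.single i 1 with hei
  have e1 : (gradX (fun z => ∫ y, ρ y • v (z - y)) z) i =
      ∫ y, fderiv ℝ ρ y (0, ei) * v (z - y) := by
    change fderiv ℝ (fun z => ∫ y, ρ y • v (z - y)) z (0, ei) = _
    rw [hfd, convolution, ContinuousLinearMap.integral_apply hex]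
    rfl
  have e2 : (∫ y, ρ y • σ (z - y)) i = ∫ y, ⟪σ y, ρ (z - y) • ei⟫_ℝ := by
    have : (∫ y, ρ y • σ (z - y)) i = ⟪ei, ∫ y, ρ y • σ (z - y)⟫_ℝ := by
      simp [hei, EuclideanSpace.inner_single_left]
    have hσ' : Integrable (fun y => ρ y • σ (z - y)) := hσ
    rw [this, ← integral_inner hσ', ← integral_sub_left_eq_self _ volume z]
    refine integral_congr_ae (Filter.Eventually.of_forall fun y => ?_)
    simp only [sub_sub_cancel, inner_smul_right, real_inner_comm]
  have hρ' : ContDiff ℝ ∞ fun y => ρ (z - y) := h1.comp (contDiff_const.sub contDiff_id)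
  have hs' : HasCompactSupport fun y => ρ (z - y) :=
    h2.comp_homeomorph (Homeomorph.subLeft z)
  rw [e1, e2, h (fun y => ρ (z - y) • ei) (hρ'.smul contDiff_const) hs'.smul_right,
    ← integral_sub_left_eq_self _ volume z, ← integral_neg]
  refine integral_congr_ae (Filter.Eventually.of_forall fun y => ?_)
  simp only [sub_sub_cancel]
  rw [divX_smul_const (hρ'.differentiable (by simp) y), gradX_comp_sub_left (h1.differentiable (by simp)), inner_neg_left,
    inner_gradX]
  simp [hei, mul_comm]

/-- The pairing `J y` of the data with the translate of `(v, σ)` by `y` is continuous. Averaged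
against a bump supported among the shifts that move `K` into `Q`, it is the equation tested with a
mollification of `v`, hence zero. So `J` vanishes at all such shifts, and also at their limit `0`.
-/
lemma green_of_shift {Q K : Set (SpaceTime d)} (hQ : IsOpen Q) (hK : IsCompact K)
    {e : SpaceTime d} {r : ℝ} (hr : 0 < r) (he : ∀ x ∈ K, ∀ s ∈ Ioo 0 r, x + s • e ∈ Q)
    {G v : SpaceTime d → ℝ} {Θ σ : SpaceTime d → Space d}
    (mG : MemLp G 2 volume) (mΘ : MemLp Θ 2 volume) (mv : MemLp v 2 volume)
    (mσ : MemLp σ 2 volume)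
    (h1 : ∀ φ : SpaceTime d → ℝ, ContDiff ℝ ∞ φ → HasCompactSupport φ → tsupport φ ⊆ Q →
      ∫ z, (G z * φ z + ⟪Θ z, gradX φ z⟫_ℝ) = 0)
    (h2 : HasGlobalGrad v σ) (hv : ∀ z ∉ K, v z = 0) :
    ∫ z, (G z * v z + ⟪Θ z, σ z⟫_ℝ) = 0 := by
  set J : SpaceTime d → ℝ := fun y => (∫ z, ⟪G z, v (z - y)⟫_ℝ) + ∫ z, ⟪Θ z, σ (z - y)⟫_ℝ
    with hJ
  have cJ : Continuous J :=
    (continuous_integral_inner_translate mG mv).add (continuous_integral_inner_translate mΘ mσ)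
  -- The admissible shifts; compactness of `K` makes this set open.
  set O : Set (SpaceTime d) := {y | ∀ x ∈ K, x + y ∈ Q} with hO
  have oO : IsOpen O := by
    rw [isOpen_iff_eventually]
    intro y hy
    refine hK.eventually_forall_of_forall_eventually fun x hx => ?_
    have hc : Continuous fun p : SpaceTime d × SpaceTime d => p.2 + p.1 := by fun_prop
    exact hc.continuousAt.eventually_mem (hQ.mem_nhds (hy x hx))
  have hJO : ∀ y ∈ O, J y = 0 := by
    have hae : ∀ᵐ y ∂volume, y ∈ O → J y = 0 := by
      refine oO.ae_eq_zero_of_integral_contDiff_smul_eq_zero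
        (cJ.locallyIntegrable.locallyIntegrableOn O) fun ρ r1 r2 r3 => ?_
      have mv' : LocallyIntegrable v := mv.locallyIntegrable (by norm_num)
      set u : SpaceTime d → ℝ := fun z => ∫ y, ρ y • v (z - y) with hu
      have u1 : ContDiff ℝ ∞ u :=
        r2.contDiff_convolution_left (ContinuousLinearMap.lsmul ℝ ℝ) r1 mv'
      have cKρ : IsCompact (K + tsupport ρ) := hK.add r2
      have u2 : Function.support u ⊆ K + tsupport ρ := by
        intro z hz
        by_contra hcon
        refine hz ?_
        have : ∀ y, ρ y • v (z - y) = 0 := by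
          intro y
          by_cases hy : y ∈ tsupport ρ
          · rw [hv, smul_zero]
            intro hzy
            exact hcon ⟨z - y, hzy, y, hy, by simp⟩
          · rw [image_eq_zero_of_notMem_tsupport hy, zero_smul]
        simp only [hu, this, integral_zero]
      have u3 : tsupport u ⊆ K + tsupport ρ := closure_minimal u2 cKρ.isClosed
      have u4 : HasCompactSupport u := cKρ.of_isClosed_subset (isClosed_tsupport u) u3
      -- The support of `u` lies in `K + tsupport ρ`, and `tsupport ρ ⊆ O` says precisely that such
      -- sums are in `Q`.
      have u5 : tsupport u ⊆ Q := by
        intro z hz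
        obtain ⟨x, hx, y, hy, rfl⟩ := u3 hz
        exact r3 hy x hx
      have key := h1 u u1 u4 u5
      have gu : ∀ z, gradX u z = ∫ y, ρ y • σ (z - y) := h2.gradX_convolution mv mσ r1 r2
      rw [integral_add] at key
      · have i1 : Integrable (fun y => ρ y * ∫ z, ⟪G z, v (z - y)⟫_ℝ) :=
          ((r1.continuous.mul (continuous_integral_inner_translate mG mv))
            |>.integrable_of_hasCompactSupport r2.mul_right)
        have i2 : Integrable (fun y => ρ y * ∫ z, ⟪Θ z, σ (z - y)⟫_ℝ) :=
          ((r1.continuous.mul (continuous_integral_inner_translate mΘ mσ))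
            |>.integrable_of_hasCompactSupport r2.mul_right)
        simp only [hJ, smul_eq_mul, mul_add]
        rw [integral_add i1 i2,
          integral_mul_integral_inner_translate mG mv r1.continuous r2,
          integral_mul_integral_inner_translate mΘ mσ r1.continuous r2, ← key]
        congr 1
        · refine integral_congr_ae (Filter.Eventually.of_forall fun z => ?_)
          simp [hu, mul_comm]
        · simp only [gu]
      · exact mG.integrable_mul (u1.continuous.memLp_of_hasCompactSupport (p := 2) u4)
      · exact integrable_inner_of_memLp mΘ
          ((continuous_gradX u1).memLp_of_hasCompactSupport (compact_gradX u4))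
    -- Continuity upgrades the almost everywhere statement, which is needed because the shifts `s •
    -- e` form a null set in general.
    have hEq : EqOn J (fun _ => 0) O := by
      refine Measure.eqOn_open_of_ae_eq (μ := volume) ?_ oO cJ.continuousOn continuousOn_const
      rw [Filter.EventuallyEq, ae_restrict_iff' oO.measurableSet]
      exact hae
    exact hEq
  have h0 : J 0 = 0 := by
    have t1 : Filter.Tendsto (fun s : ℝ => s • e) (nhdsWithin 0 (Ioi 0)) (nhds 0) := by
      have : Continuous fun s : ℝ => s • e := by fun_prop
      simpa using (this.tendsto 0).mono_left nhdsWithin_le_nhds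
    have t2 : Filter.Tendsto (fun s : ℝ => J (s • e)) (nhdsWithin 0 (Ioi 0)) (nhds (J 0)) :=
      (cJ.tendsto 0).comp t1
    refine tendsto_nhds_unique t2 (tendsto_const_nhds.congr' ?_)
    filter_upwards [Ioo_mem_nhdsGT hr] with s hs
    exact (hJO _ fun x hx => he x hx s hs).symm
  have iG : Integrable (fun z => G z * v z) := mG.integrable_mul mv
  rw [integral_add iG (integrable_inner_of_memLp mΘ mσ), ← h0]
  simp [hJ, mul_comm]

/-- `σ` is the weak spatial gradient of `v` in `Q`, and `v` has no lateral boundary values: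
integration by parts holds without boundary terms. -/
def HasZeroTraceGrad (Q : Set (SpaceTime d)) (v : SpaceTime d → ℝ) (σ : SpaceTime d → Space d) :
    Prop :=
  ∀ χ : SpaceTime d → Space d, ContDiff ℝ ∞ χ →
    ∫ z in Q, ⟪σ z, χ z⟫_ℝ = - ∫ z in Q, v z * divX χ z

lemma memLp_of_continuous_mul {F F' : Type*} [NormedAddCommGroup F] [NormedAddCommGroup F']
    {Q : Set (SpaceTime d)} (hQ : IsOpen Q) (hb : Bornology.IsBounded Q)
    {f : SpaceTime d → F} {g : SpaceTime d → F'} {c : SpaceTime d → ℝ} (hc : Continuous c)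
    (hf : MemLp f 2 (volume.restrict Q)) (mg : AEStronglyMeasurable g (volume.restrict Q))
    (h : ∀ z, ‖g z‖ ≤ c z * ‖f z‖) : MemLp g 2 (volume.restrict Q) := by
  obtain ⟨C, hC⟩ := hb.isCompact_closure.bddAbove_image hc.continuousOn
  refine hf.of_le_mul (c := C) mg ?_
  filter_upwards [ae_restrict_mem hQ.measurableSet] with z hz
  exact (h z).trans (mul_le_mul_of_nonneg_right (hC ⟨z, subset_closure hz, rfl⟩) (norm_nonneg _))

lemma memLp_of_continuous {F : Type*} [NormedAddCommGroup F] [SecondCountableTopology F]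
    {Q : Set (SpaceTime d)} (hQ : IsOpen Q) (hb : Bornology.IsBounded Q) {f : SpaceTime d → F}
    (hf : Continuous f) : MemLp f 2 (volume.restrict Q) := by
  have : IsFiniteMeasure ((volume : Measure (SpaceTime d)).restrict Q) :=
    ⟨by simpa using hb.measure_lt_top⟩
  exact memLp_of_continuous_mul hQ hb hf.norm (memLp_const (1 : ℝ)) hf.aestronglyMeasurable
    fun z => by simp

/-- Since the tests for `v` are unrestricted at the boundary, `η • χ` is again one. The product rule
for its divergence gives the gradient of `η v`. -/
lemma HasZeroTraceGrad.smul {Q : Set (SpaceTime d)} (hQ : IsOpen Q) (hb : Bornology.IsBounded Q)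
    {v : SpaceTime d → ℝ} {σ : SpaceTime d → Space d} (mv : MemLp v 2 (volume.restrict Q))
    (mσ : MemLp σ 2 (volume.restrict Q)) (h : HasZeroTraceGrad Q v σ) {η : SpaceTime d → ℝ}
    (hη : ContDiff ℝ ∞ η) :
    MemLp (fun z => η z * v z) 2 (volume.restrict Q) ∧
    MemLp (fun z => η z • σ z + v z • gradX η z) 2 (volume.restrict Q) ∧
    HasZeroTraceGrad Q (fun z => η z * v z) (fun z => η z • σ z + v z • gradX η z) := by
  have m1 : ∀ {ψ : SpaceTime d → Space d}, Continuous ψ →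
      MemLp (fun z => v z • ψ z) 2 (volume.restrict Q) := fun {ψ} hψ =>
    memLp_of_continuous_mul hQ hb hψ.norm mv (mv.1.smul hψ.aestronglyMeasurable)
      fun z => by rw [norm_smul, mul_comm]
  have m1' : ∀ {ψ : SpaceTime d → ℝ}, Continuous ψ →
      MemLp (fun z => v z * ψ z) 2 (volume.restrict Q) := fun {ψ} hψ =>
    memLp_of_continuous_mul hQ hb hψ.norm mv (mv.1.mul hψ.aestronglyMeasurable)
      fun z => by rw [norm_mul, mul_comm]
  have m2 : MemLp (fun z => η z • σ z) 2 (volume.restrict Q) :=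
    memLp_of_continuous_mul hQ hb hη.continuous.norm mσ
      (hη.continuous.aestronglyMeasurable.smul mσ.1) fun z => by rw [norm_smul]
  have m3 := m1 (continuous_gradX hη)
  refine ⟨by simpa only [mul_comm] using m1' hη.continuous, m2.add m3, fun χ hχ => ?_⟩
  have key := h (fun z => η z • χ z) (hη.smul hχ)
  have i1 : Integrable (fun z => ⟪σ z, η z • χ z⟫_ℝ) (volume.restrict Q) :=
    integrable_inner_of_memLp mσ (memLp_of_continuous hQ hb (hη.continuous.smul hχ.continuous))
  have i2 : Integrable (fun z => v z * ⟪gradX η z, χ z⟫_ℝ) (volume.restrict Q) :=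
    mv.integrable_mul (memLp_of_continuous hQ hb ((continuous_gradX hη).inner hχ.continuous))
  have i3 : Integrable (fun z => v z * (η z * divX χ z)) (volume.restrict Q) :=
    mv.integrable_mul (memLp_of_continuous hQ hb (hη.continuous.mul (continuous_divX hχ)))
  have e1 : ∀ z, ⟪η z • σ z + v z • gradX η z, χ z⟫_ℝ =
      ⟪σ z, η z • χ z⟫_ℝ + v z * ⟪gradX η z, χ z⟫_ℝ := fun z => by
    rw [inner_add_left, real_inner_smul_left, real_inner_smul_left, real_inner_smul_right]
  have e2 : ∀ z, v z * divX (fun z => η z • χ z) z =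
      v z * (η z * divX χ z) + v z * ⟪gradX η z, χ z⟫_ℝ := fun z => by
    rw [divX_smul (hη.differentiable (by simp) z) (hχ.differentiable (by simp) z), mul_add]
  simp only [e1]
  simp only [e2] at key
  rw [integral_add i1 i2, key, integral_add i3 i2]
  have e3 : ∀ z, η z * v z * divX χ z = v z * (η z * divX χ z) := fun z => by ring
  simp only [e3]
  ring

/-- Green's formula on a set with the segment property. -/
theorem HasZeroTraceGrad.green {Q : Set (SpaceTime d)} (hQ : IsOpen Q)
    (hb : Bornology.IsBounded Q) (hs : SegmentProperty Q)
    {G v : SpaceTime d → ℝ} {Θ σ : SpaceTime d → Space d}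
    (mG : MemLp G 2 (volume.restrict Q)) (mΘ : MemLp Θ 2 (volume.restrict Q))
    (mv : MemLp v 2 (volume.restrict Q)) (mσ : MemLp σ 2 (volume.restrict Q))
    (h1 : ∀ φ : SpaceTime d → ℝ, ContDiff ℝ ∞ φ → HasCompactSupport φ → tsupport φ ⊆ Q →
      ∫ z in Q, (G z * φ z + ⟪Θ z, gradX φ z⟫_ℝ) = 0)
    (h2 : HasZeroTraceGrad Q v σ) :
    ∫ z in Q, (G z * v z + ⟪Θ z, σ z⟫_ℝ) = 0 := by
  have hm := hQ.measurableSet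
  choose! e r hr he using hs
  obtain ⟨t, ht, hcov⟩ := hb.isCompact_closure.elim_nhds_subcover (fun z => Metric.ball z (r z))
    fun z hz => Metric.ball_mem_nhds z (hr z hz)
  obtain ⟨f, hf⟩ := SmoothPartitionOfUnity.exists_isSubordinate (ι := t)
    (modelWithCornersSelf ℝ (SpaceTime d)) (isClosed_closure (s := Q))
    (fun i => Metric.ball (i : SpaceTime d) (r i)) (fun _ => Metric.isOpen_ball)
    (by simpa [iUnion_subtype] using hcov)
  have fs : ∀ i, ContDiff ℝ ∞ (f i) := fun i => (f i).contMDiff.contDiff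
  have hsum : ∀ z ∈ Q, ∑ i, f i z = 1 := fun z hz => by
    rw [← finsum_eq_sum_of_fintype]
    exact f.sum_eq_one (subset_closure hz)
  -- The partition sums to `1` on the open set `Q`, so the terms produced by differentiating the
  -- cut-offs cancel when the local identities are added.
  have hgrad : ∀ z ∈ Q, ∑ i, gradX (f i) z = 0 := by
    intro z hz
    have h0 : fderiv ℝ (fun y => ∑ i, f i y) z = 0 := by
      have : (fun y => ∑ i, f i y) =ᶠ[nhds z] fun _ => 1 := by
        filter_upwards [hQ.mem_nhds hz] with y hy using hsum y hy
      rw [this.fderiv_eq]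
      simp
    rw [fderiv_fun_sum fun i _ => (fs i).differentiable (by simp) z] at h0
    ext j
    have := congrArg (fun L => L (0, EuclideanSpace.single j (1 : ℝ))) h0
    simpa [gradX] using this
  have loc : ∀ i, ∫ z in Q, (G z * (f i z * v z) + ⟪Θ z, f i z • σ z + v z • gradX (f i) z⟫_ℝ)
      = 0 := by
    intro i
    obtain ⟨a1, a2, a3⟩ := h2.smul hQ hb mv mσ (fs i)
    -- Everything is extended by zero. The zero trace condition is what makes the extended `σ` a
    -- gradient on the whole space, across the boundary of `Q`.
    have := green_of_shift (K := closure Q ∩ tsupport (f i)) (e := e i) (r := r i) hQ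
      (hb.isCompact_closure.inter_right (isClosed_tsupport _)) (hr i (ht i i.2))
      (fun x hx s hs => he i (ht i i.2) x ⟨hx.1, hf i hx.2⟩ s hs)
      ((memLp_indicator_iff_restrict hm).2 mG) ((memLp_indicator_iff_restrict hm).2 mΘ)
      ((memLp_indicator_iff_restrict hm).2 a1) ((memLp_indicator_iff_restrict hm).2 a2)
      (fun φ c1 c2 c3 => ?_) (fun χ c1 c2 => ?_) (fun z hz => ?_)
    · rw [← this, ← integral_indicator hm]
      congr 1
      ext z
      by_cases hz : z ∈ Q <;> simp [hz]
    · rw [← h1 φ c1 c2 c3, ← integral_indicator hm]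
      congr 1
      ext z
      by_cases hz : z ∈ Q <;> simp [hz]
    · have := a3 χ c1
      rw [← integral_indicator hm, ← integral_indicator hm] at this
      refine (integral_congr_ae (Filter.Eventually.of_forall fun z => ?_)).trans (this.trans
        (congrArg Neg.neg (integral_congr_ae (Filter.Eventually.of_forall fun z => ?_))))
      · by_cases hz : z ∈ Q <;> simp [hz]
      · by_cases hz : z ∈ Q <;> simp [hz]
    · by_cases hzQ : z ∈ Q
      · have : z ∉ tsupport (f i) := fun h => hz ⟨subset_closure hzQ, h⟩
        simp [image_eq_zero_of_notMem_tsupport this]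
      · simp [hzQ]
  rw [← Finset.sum_eq_zero fun i (_ : i ∈ Finset.univ) => loc i, ← integral_finsetSum]
  · refine setIntegral_congr_fun hm fun z hz => ?_
    simp only [Finset.sum_add_distrib, ← Finset.mul_sum, ← Finset.sum_mul, ← inner_sum,
      ← Finset.sum_smul, ← Finset.smul_sum, hsum z hz, hgrad z hz]
    simp
  · intro i _
    obtain ⟨a1, a2, a3⟩ := h2.smul hQ hb mv mσ (fs i)
    exact integrable_const_mul_inner_add mG mΘ a1 a2

end Green

end

open Filter Topology

/-! ### `L²` bounds for averages over a parameter -/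

section Averages

variable {α β F : Type*} [MeasurableSpace α] [MeasurableSpace β] [NormedAddCommGroup F]

lemma eLpNorm_two_sq {μ : Measure α} (f : α → F) :
    eLpNorm f 2 μ ^ 2 = ∫⁻ z, ‖f z‖ₑ ^ 2 ∂μ := by
  have := eLpNorm_nnreal_pow_eq_lintegral (f := f) (μ := μ) (p := 2) (by norm_num)
  simpa using this

lemma eLpNorm_two_le_iff {μ : Measure α} (f : α → F) (C : ENNReal) :
    eLpNorm f 2 μ ≤ C ↔ ∫⁻ z, ‖f z‖ₑ ^ 2 ∂μ ≤ C ^ 2 := by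
  rw [← eLpNorm_two_sq]
  exact (ENNReal.pow_le_pow_left_iff two_ne_zero).symm

variable {P : Measure α} {μ : Measure β} [SFinite μ]

lemma eLpNorm_two_prod_le [IsProbabilityMeasure P] {f : α → β → F} (hf : StronglyMeasurable (Function.uncurry f))
    {C : ENNReal} (h : ∀ᵐ r ∂P, eLpNorm (f r) 2 μ ≤ C) :
    eLpNorm (Function.uncurry f) 2 (P.prod μ) ≤ C := by
  rw [eLpNorm_two_le_iff, lintegral_prod _ (by fun_prop)]
  calc ∫⁻ r, ∫⁻ z, ‖f r z‖ₑ ^ 2 ∂μ ∂P ≤ ∫⁻ _, C ^ 2 ∂P := by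
        refine lintegral_mono_ae ?_
        filter_upwards [h] with r hr
        exact (eLpNorm_two_le_iff _ _).1 hr
    _ = C ^ 2 := by simp

lemma memLp_slice_of_memLp_prod [SFinite P] {f : α → β → F} (hf : StronglyMeasurable (Function.uncurry f))
    (h : MemLp (Function.uncurry f) 2 (P.prod μ)) : ∀ᵐ z ∂μ, MemLp (fun r => f r z) 2 P := by
  have h1 : ∫⁻ z, ∫⁻ r, ‖f r z‖ₑ ^ 2 ∂P ∂μ ≠ ⊤ := by
    have h2 : eLpNorm (Function.uncurry f) 2 (P.prod μ) ^ 2 ≠ ⊤ := ENNReal.pow_ne_top h.2.ne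
    rw [eLpNorm_two_sq, lintegral_prod_symm _ (by fun_prop)] at h2
    exact h2
  have hm : Measurable fun z => ∫⁻ r, ‖f r z‖ₑ ^ 2 ∂P := by
    have : Measurable (Function.uncurry fun z r => ‖f r z‖ₑ ^ 2) :=
      (hf.comp_measurable measurable_swap).enorm.pow_const 2
    exact this.lintegral_prod_right
  filter_upwards [ae_lt_top hm h1] with z hz
  refine ⟨(hf.comp_measurable (g := fun r => (r, z)) (by fun_prop)).aestronglyMeasurable, ?_⟩
  rw [← eLpNorm_two_sq] at hz
  by_contra hcon
  rw [not_lt, top_le_iff] at hcon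
  simp [hcon] at hz

variable [NormedSpace ℝ F]

/-- Cauchy–Schwarz against the constant function `1`. -/
lemma enorm_integral_sq_le {f : α → F} (hf : AEStronglyMeasurable f P) :
    ‖∫ r, f r ∂P‖ₑ ^ 2 ≤ P univ * ∫⁻ r, ‖f r‖ₑ ^ 2 ∂P := by
  rw [← eLpNorm_two_sq]
  calc ‖∫ r, f r ∂P‖ₑ ^ 2 ≤ (∫⁻ r, ‖f r‖ₑ ∂P) ^ 2 := by
        gcongr
        exact enorm_integral_le_lintegral_enorm _
    _ = eLpNorm f 1 P ^ 2 := by rw [eLpNorm_one_eq_lintegral_enorm]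
    _ ≤ (eLpNorm f 2 P * P univ ^ (1 / (1 : ENNReal).toReal - 1 / (2 : ENNReal).toReal)) ^ 2 := by
        gcongr
        exact eLpNorm_le_eLpNorm_mul_rpow_measure_univ (by norm_num) hf
    _ = P univ * eLpNorm f 2 P ^ 2 := by
        rw [mul_pow, mul_comm, ← ENNReal.rpow_natCast (P univ ^ _), ← ENNReal.rpow_mul]
        norm_num

lemma eLpNorm_integral_le_prod [IsProbabilityMeasure P] {f : α → β → F}
    (hf : StronglyMeasurable (Function.uncurry f)) :
    eLpNorm (fun z => ∫ r, f r z ∂P) 2 μ ≤ eLpNorm (Function.uncurry f) 2 (P.prod μ) := by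
  rw [eLpNorm_two_le_iff, eLpNorm_two_sq, lintegral_prod_symm _ (by fun_prop)]
  refine lintegral_mono fun z => ?_
  simpa using enorm_integral_sq_le (P := P)
    (hf.comp_measurable (g := fun r => (r, z)) (by fun_prop)).aestronglyMeasurable

lemma eLpNorm_two_integral_le [IsProbabilityMeasure P] {f : α → β → F}
    (hf : StronglyMeasurable (Function.uncurry f))
    {C : ENNReal} (h : ∀ᵐ r ∂P, eLpNorm (f r) 2 μ ≤ C) :
    eLpNorm (fun z => ∫ r, f r z ∂P) 2 μ ≤ C :=
  (eLpNorm_integral_le_prod hf).trans (eLpNorm_two_prod_le hf h)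

end Averages

/-! ### Affine changes of time and their continuity in `L²` -/

section TimeMap

variable {d : ℕ}

/-- The affine change of time `(t, x) ↦ (a t + b, x)`. -/
def timeMap (a b : ℝ) (z : SpaceTime d) : SpaceTime d := (a * z.1 + b, z.2)

lemma continuous_timeMap (a b : ℝ) : Continuous (timeMap a b : SpaceTime d → SpaceTime d) := by
  unfold timeMap
  fun_prop

lemma contDiff_timeMap (a b : ℝ) :
    ContDiff ℝ ∞ (timeMap a b : SpaceTime d → SpaceTime d) := by
  unfold timeMap
  fun_prop

lemma timeMap_timeMap {a : ℝ} (ha : a ≠ 0) (b : ℝ) (z : SpaceTime d) :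
    timeMap a b (timeMap a⁻¹ (-(a⁻¹ * b)) z) = z := by
  refine Prod.ext ?_ rfl
  simp only [timeMap]
  field_simp
  ring

lemma timeMap_timeMap' {a : ℝ} (ha : a ≠ 0) (b : ℝ) (z : SpaceTime d) :
    timeMap a⁻¹ (-(a⁻¹ * b)) (timeMap a b z) = z := by
  refine Prod.ext ?_ rfl
  simp only [timeMap]
  field_simp
  ring

/-- The affine change of time as a homeomorphism. -/
noncomputable def timeHomeo {a : ℝ} (ha : a ≠ 0) (b : ℝ) : SpaceTime d ≃ₜ SpaceTime d where
  toFun := timeMap a b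
  invFun := timeMap a⁻¹ (-(a⁻¹ * b))
  left_inv := timeMap_timeMap' ha b
  right_inv := timeMap_timeMap ha b
  continuous_toFun := continuous_timeMap _ _
  continuous_invFun := continuous_timeMap _ _

lemma map_timeMap {a : ℝ} (ha : 0 < a) (b : ℝ) :
    Measure.map (timeMap a b) (volume : Measure (SpaceTime d)) =
      ENNReal.ofReal a⁻¹ • volume := by
  have h1 : Measure.map (fun t : ℝ => a * t + b) volume = ENNReal.ofReal a⁻¹ • volume := by
    have : (fun t : ℝ => a * t + b) = (fun t => t + b) ∘ fun t => a * t := rfl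
    rw [this, ← Measure.map_map (by fun_prop) (by fun_prop), Real.map_volume_mul_left ha.ne',
      Measure.map_smul, map_add_right_eq_self, abs_of_pos (inv_pos.2 ha)]
  have h2 := Measure.map_prod_map (f := fun t : ℝ => a * t + b) (g := (id : Space d → Space d))
    volume volume (by fun_prop) measurable_id
  rw [h1, Measure.map_id, Measure.prod_smul_left] at h2
  exact h2.symm

lemma integral_timeMap {F : Type*} [NormedAddCommGroup F] [NormedSpace ℝ F] {a : ℝ} (ha : 0 < a)
    (b : ℝ) (f : SpaceTime d → F) : ∫ z, f (timeMap a b z) = a⁻¹ • ∫ z, f z := by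
  have := (timeHomeo (d := d) ha.ne' b).measurableEmbedding.integral_map (μ := volume) f
  change ∫ y, f y ∂(Measure.map (timeMap a b) volume) = ∫ z, f (timeMap a b z) at this
  rw [← this, map_timeMap ha, integral_smul_measure, ENNReal.toReal_ofReal (inv_pos.2 ha).le]

variable {F : Type*} [NormedAddCommGroup F]

/-- The exact factor is the square root of `a⁻¹`; the cruder `2` is uniform for `a ≥ 1/2`. -/
lemma eLpNorm_timeMap_le {a : ℝ} (ha : 1 / 2 ≤ a) (b : ℝ) (f : SpaceTime d → F) :
    eLpNorm (fun z => f (timeMap a b z)) 2 volume ≤ 2 * eLpNorm f 2 volume := by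
  have ha0 : 0 < a := by linarith
  have h1 := (timeHomeo (d := d) ha0.ne' b).measurableEmbedding.lintegral_map (μ := volume)
    fun z => ‖f z‖ₑ ^ 2
  change ∫⁻ y, _ ∂(Measure.map (timeMap a b) volume) = ∫⁻ z, ‖f (timeMap a b z)‖ₑ ^ 2 at h1
  rw [eLpNorm_two_le_iff, ← h1, map_timeMap ha0, lintegral_smul_measure, mul_pow, eLpNorm_two_sq,
    smul_eq_mul]
  gcongr
  rw [ENNReal.ofReal_le_iff_le_toReal (by norm_num)]
  have : a⁻¹ ≤ (1 / 2)⁻¹ := inv_anti₀ (by norm_num) ha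
  norm_num at this ⊢
  linarith

lemma memLp_timeMap {a : ℝ} (ha : 0 < a) (b : ℝ) {f : SpaceTime d → F}
    (hf : MemLp f 2 volume) : MemLp (fun z => f (timeMap a b z)) 2 volume := by
  have h1 := hf.smul_measure (c := ENNReal.ofReal a⁻¹) ENNReal.ofReal_ne_top
  rw [← map_timeMap ha b] at h1
  exact (memLp_map_measure_iff h1.1 (continuous_timeMap a b).aemeasurable).1 h1

/-- Dominated convergence, with one ball containing all relevant supports once the change of time is
close to the identity. -/
lemma tendsto_eLpNorm_timeMap_of_continuous {g : SpaceTime d → F} (hg : Continuous g)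
    (hs : HasCompactSupport g) :
    Tendsto (fun p : ℝ × ℝ => eLpNorm (fun z => g (timeMap p.1 p.2 z) - g z) 2 volume)
      (𝓝 (1, 0)) (𝓝 0) := by
  obtain ⟨M, hM⟩ := hg.bounded_above_of_compact_support hs
  obtain ⟨R, hR⟩ := hs.isBounded.subset_closedBall (0 : SpaceTime d)
  have hR0 : ∀ z, R < ‖z‖ → g z = 0 := fun z hz => by
    refine image_eq_zero_of_notMem_tsupport fun h => ?_
    have := hR h
    rw [mem_closedBall_zero_iff] at this
    linarith
  have hsq : Tendsto (fun p : ℝ × ℝ => ∫⁻ z, ‖g (timeMap p.1 p.2 z) - g z‖ₑ ^ 2)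
      (𝓝 (1, 0)) (𝓝 (∫⁻ _ : SpaceTime d, 0)) := by
    -- If `|a - 1| < 1/2` and `|b| < 1`, then `|t| > 2 (|R| + 1)` forces `|a t + b| > |R|`. So the
    -- integrand vanishes outside this ball.
    refine tendsto_lintegral_filter_of_dominated_convergence
      ((Metric.closedBall (0 : SpaceTime d) (2 * (|R| + 1))).indicator
        fun _ => (ENNReal.ofReal (M + M)) ^ 2) ?_ ?_ ?_ ?_
    · refine Eventually.of_forall fun p => ?_
      have := ((hg.comp (continuous_timeMap p.1 p.2)).sub hg).enorm.measurable
      exact this.pow_const 2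
    · have h1 : ∀ᶠ p : ℝ × ℝ in 𝓝 (1, 0), |p.1 - 1| < 1 / 2 ∧ |p.2| < 1 := by
        have c1 : Continuous fun p : ℝ × ℝ => |p.1 - 1| := by fun_prop
        have c2 : Continuous fun p : ℝ × ℝ => |p.2| := by fun_prop
        exact (c1.continuousAt.eventually_lt continuousAt_const (by norm_num)).and
          (c2.continuousAt.eventually_lt continuousAt_const (by norm_num))
      filter_upwards [h1] with p hp
      refine Eventually.of_forall fun z => ?_
      by_cases hz : z ∈ Metric.closedBall (0 : SpaceTime d) (2 * (|R| + 1))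
      · rw [indicator_of_mem hz, ← ofReal_norm]
        gcongr
        exact (norm_sub_le _ _).trans (add_le_add (hM _) (hM _))
      · rw [indicator_of_notMem hz]
        rw [mem_closedBall_zero_iff, not_le] at hz
        have hRz : R < ‖z‖ := by linarith [le_abs_self R, abs_nonneg R]
        have hRt : R < ‖timeMap p.1 p.2 z‖ := by
          rw [Prod.norm_def] at hz ⊢
          rcases lt_max_iff.1 hz with h | h
          · refine lt_max_of_lt_left ?_
            simp only [timeMap, Real.norm_eq_abs] at h ⊢
            have e : z.1 = (p.1 * z.1 + p.2) - p.2 - (p.1 - 1) * z.1 := by ring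
            have b1 : |z.1| ≤ |p.1 * z.1 + p.2| + |p.2| + |p.1 - 1| * |z.1| := by
              calc |z.1| = |(p.1 * z.1 + p.2) - p.2 - (p.1 - 1) * z.1| := by rw [← e]
                _ ≤ |p.1 * z.1 + p.2 - p.2| + |(p.1 - 1) * z.1| := abs_sub _ _
                _ ≤ _ := by rw [abs_mul]; gcongr; exact abs_sub _ _
            have b2 : |p.1 - 1| * |z.1| ≤ 1 / 2 * |z.1| := by gcongr; exact hp.1.le
            linarith [le_abs_self R, hp.2]
          · exact lt_max_of_lt_right (by
              simp only [timeMap]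
              linarith [le_abs_self R, abs_nonneg R])
        simp [hR0 _ hRz, hR0 _ hRt]
    · rw [lintegral_indicator Metric.isClosed_closedBall.measurableSet, setLIntegral_const]
      refine ENNReal.mul_ne_top (by simp) ?_
      exact (isCompact_closedBall (0 : SpaceTime d) _).measure_ne_top
    · refine Eventually.of_forall fun z => ?_
      have hc : Continuous fun p : ℝ × ℝ => ‖g (timeMap p.1 p.2 z) - g z‖ₑ ^ 2 := by
        have : Continuous fun p : ℝ × ℝ => timeMap p.1 p.2 z := by
          unfold timeMap
          fun_prop
        exact (ENNReal.continuous_pow 2).comp ((hg.comp this).sub continuous_const).enorm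
      have := hc.tendsto (1, 0)
      simpa [timeMap] using this
  rw [lintegral_zero] at hsq
  have h2 := (ENNReal.continuous_rpow_const (y := 1 / 2)).tendsto 0 |>.comp hsq
  rw [ENNReal.zero_rpow_of_pos (by norm_num)] at h2
  refine h2.congr fun p => ?_
  simp only [Function.comp]
  rw [← eLpNorm_two_sq, ← ENNReal.rpow_natCast, ← ENNReal.rpow_mul]
  norm_num

/-- Density of continuous compactly supported functions. The approximation error enters twice, once
with the factor `2` from the change of time, which together with the main term uses up `4 (ε / 4)`.
-/
lemma tendsto_eLpNorm_timeMap [NormedSpace ℝ F] {q : SpaceTime d → F} (hq : MemLp q 2 volume) :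
    Tendsto (fun p : ℝ × ℝ => eLpNorm (fun z => q (timeMap p.1 p.2 z) - q z) 2 volume)
      (𝓝 (1, 0)) (𝓝 0) := by
  rw [ENNReal.tendsto_nhds_zero]
  intro ε hε
  obtain ⟨g, g1, g2, g3, g4⟩ := hq.exists_hasCompactSupport_eLpNorm_sub_le (by norm_num)
    (ε := ε / 4) (ENNReal.div_pos hε.ne' (by norm_num)).ne'
  have h1 := (ENNReal.tendsto_nhds_zero.1 (tendsto_eLpNorm_timeMap_of_continuous g3 g1)) (ε / 4)
    (ENNReal.div_pos hε.ne' (by norm_num))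
  have h2 : ∀ᶠ p : ℝ × ℝ in 𝓝 (1, 0), 1 / 2 ≤ p.1 :=
    (continuous_fst.continuousAt.eventually (lt_mem_nhds (by norm_num : (1 / 2 : ℝ) < 1))).mono
      fun _ h => le_of_lt h
  filter_upwards [h1, h2] with p hp hp2
  have m1 := hq.sub g4
  have hp0 : 0 < p.1 := by linarith
  have m2 := memLp_timeMap hp0 p.2 m1
  have m3 : MemLp (fun z => g (timeMap p.1 p.2 z) - g z) 2 volume :=
    (memLp_timeMap hp0 p.2 g4).sub g4
  have e : (fun z => q (timeMap p.1 p.2 z) - q z) =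
      ((fun z => (q - g) (timeMap p.1 p.2 z)) + fun z => g (timeMap p.1 p.2 z) - g z) -
        (q - g) := by
    ext z
    simp only [Pi.sub_apply, Pi.add_apply]
    abel
  rw [e]
  calc _ ≤ eLpNorm (fun z => (q - g) (timeMap p.1 p.2 z)) 2 volume +
        eLpNorm (fun z => g (timeMap p.1 p.2 z) - g z) 2 volume + eLpNorm (q - g) 2 volume :=
      (eLpNorm_sub_le (m2.1.add m3.1) m1.1 (by norm_num)).trans
        (add_le_add_left (eLpNorm_add_le m2.1 m3.1 (by norm_num)) _)
    _ ≤ 2 * (ε / 4) + ε / 4 + ε / 4 :=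
      add_le_add (add_le_add ((eLpNorm_timeMap_le hp2 p.2 _).trans (by gcongr)) hp) g2
    _ = 4 * (ε / 4) := by ring
    _ = ε := ENNReal.mul_div_cancel (by norm_num) (by norm_num)

end TimeMap

/-! ### Time averages and their convergence -/

section TimeAvg

variable {d : ℕ} {F : Type*} [NormedAddCommGroup F] {Tend κ : ℝ} {q : SpaceTime d → F}

instance : IsProbabilityMeasure (volume.restrict (Ioc (0 : ℝ) 1)) := ⟨by simp⟩

lemma stronglyMeasurable_uncurry_timeMap {q : SpaceTime d → F} (hq : StronglyMeasurable q)
    (a h : ℝ) :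
    StronglyMeasurable (Function.uncurry fun (r : ℝ) (z : SpaceTime d) =>
      q (timeMap a (h * r) z)) := by
  refine hq.comp_measurable (g := fun p : ℝ × SpaceTime d => timeMap a (h * p.1) p.2) ?_
  unfold timeMap
  fun_prop

lemma memLp_uncurry_timeMap (hκ : κ ≤ 1 / 2) (hq : StronglyMeasurable q)
    (mq : MemLp q 2 volume) :
    MemLp (Function.uncurry fun (r : ℝ) (z : SpaceTime d) =>
      q (timeMap (1 - κ) (κ * Tend * r) z)) 2 ((volume.restrict (Ioc (0 : ℝ) 1)).prod volume) :=
  ⟨(stronglyMeasurable_uncurry_timeMap hq _ _).aestronglyMeasurable,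
    (eLpNorm_two_prod_le (stronglyMeasurable_uncurry_timeMap hq (1 - κ) (κ * Tend))
      (Eventually.of_forall fun _ => eLpNorm_timeMap_le (by linarith) _ q)).trans_lt
      (ENNReal.mul_lt_top (by simp) mq.2)⟩

variable [NormedSpace ℝ F]

/-- Averages of `q` over time intervals of length `κ Tend` contained in `(0, Tend)`, after the time
contraction with factor `1 - κ`. -/
noncomputable def timeAvg (Tend κ : ℝ) (q : SpaceTime d → F) (z : SpaceTime d) : F :=
  ∫ r in Ioc (0 : ℝ) 1, q (timeMap (1 - κ) (κ * Tend * r) z)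


lemma stronglyMeasurable_timeAvg (hq : StronglyMeasurable q) :
    StronglyMeasurable (timeAvg Tend κ q) :=
  (stronglyMeasurable_uncurry_timeMap hq (1 - κ) (κ * Tend)).integral_prod_left'

lemma eLpNorm_timeAvg_le (hκ : κ ≤ 1 / 2) (hq : StronglyMeasurable q) :
    eLpNorm (timeAvg Tend κ q) 2 volume ≤ 2 * eLpNorm q 2 volume :=
  eLpNorm_two_integral_le (stronglyMeasurable_uncurry_timeMap hq (1 - κ) (κ * Tend))
    (Eventually.of_forall fun r => eLpNorm_timeMap_le (by linarith) _ q)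

lemma memLp_timeAvg (hκ : κ ≤ 1 / 2) (hq : StronglyMeasurable q) (mq : MemLp q 2 volume) :
    MemLp (timeAvg Tend κ q) 2 volume :=
  ⟨(stronglyMeasurable_timeAvg hq).aestronglyMeasurable,
    (eLpNorm_timeAvg_le hκ hq).trans_lt (ENNReal.mul_lt_top (by simp) mq.2)⟩

/-- The error is the average over `r` of `q ∘ timeMap - q`, and the parameters `(1 - κ, κ Tend r)`
tend to `(1, 0)` uniformly in `r`. -/
lemma tendsto_timeAvg [CompleteSpace F] (Tend : ℝ) (hq : StronglyMeasurable q)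
    (mq : MemLp q 2 volume) :
    Tendsto (fun κ => eLpNorm (timeAvg Tend κ q - q) 2 volume) (𝓝[>] 0) (𝓝 0) := by
  rw [ENNReal.tendsto_nhds_zero]
  intro ε hε
  have h1 := ENNReal.tendsto_nhds_zero.1 (tendsto_eLpNorm_timeMap mq) ε hε
  obtain ⟨δ, hδ, hb⟩ := Metric.eventually_nhds_iff.1 h1
  -- Both `κ` and `κ |Tend| r` are at most `κ (1 + |Tend|)`, which must be less than `δ`.
  have h2 : ∀ᶠ κ : ℝ in 𝓝[>] 0, κ < min (1 / 2) (δ / (1 + |Tend|)) :=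
    nhdsWithin_le_nhds (Iio_mem_nhds (by positivity))
  filter_upwards [h2, self_mem_nhdsWithin] with κ hκ hκ0
  have hκ0' : 0 < κ := hκ0
  have hκ1 : κ ≤ 1 / 2 := (hκ.trans_le (min_le_left _ _)).le
  have hκ2 : κ * (1 + |Tend|) < δ := by
    rw [← lt_div_iff₀ (by positivity)]
    exact hκ.trans_le (min_le_right _ _)
  have hsl := memLp_slice_of_memLp_prod (stronglyMeasurable_uncurry_timeMap hq (1 - κ) (κ * Tend))
    (memLp_uncurry_timeMap hκ1 hq mq)
  have e : timeAvg Tend κ q - q =ᵐ[volume]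
      fun z => ∫ r in Ioc (0 : ℝ) 1, (q (timeMap (1 - κ) (κ * Tend * r) z) - q z) := by
    filter_upwards [hsl] with z hz
    rw [integral_sub (hz.integrable (by norm_num)) (integrable_const _)]
    simp [timeAvg]
  rw [eLpNorm_congr_ae e]
  have hm : StronglyMeasurable (Function.uncurry fun (r : ℝ) (z : SpaceTime d) =>
      q (timeMap (1 - κ) (κ * Tend * r) z) - q z) :=
    (stronglyMeasurable_uncurry_timeMap hq (1 - κ) (κ * Tend)).sub
      (hq.comp_measurable measurable_snd)
  refine eLpNorm_two_integral_le hm ?_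
  filter_upwards [ae_restrict_mem measurableSet_Ioc] with r hr
  refine hb (y := (1 - κ, κ * Tend * r)) ?_
  rw [Prod.dist_eq, max_lt_iff, Real.dist_eq, Real.dist_eq]
  constructor
  · rw [show 1 - κ - 1 = -κ by ring, abs_neg, abs_of_pos hκ0']
    nlinarith [abs_nonneg Tend]
  · rw [sub_zero, abs_mul, abs_mul, abs_of_pos hκ0', abs_of_pos hr.1]
    have : |Tend| * r ≤ |Tend| * 1 := by gcongr; exact hr.2
    nlinarith [abs_nonneg Tend]

end TimeAvg

/-! ### Moving pairings inside the time average -/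

section Pairing

variable {d : ℕ} {F : Type*} [NormedAddCommGroup F] [InnerProductSpace ℝ F]
  {Tend κ : ℝ} {q φ : SpaceTime d → F}

lemma integrable_inner_timeMap (hκ : κ ≤ 1 / 2) (hq : StronglyMeasurable q)
    (mq : MemLp q 2 volume) (mφ : MemLp φ 2 volume) :
    Integrable (Function.uncurry fun (r : ℝ) (z : SpaceTime d) =>
      ⟪q (timeMap (1 - κ) (κ * Tend * r) z), φ z⟫_ℝ)
      ((volume.restrict (Ioc (0 : ℝ) 1)).prod volume) :=
  integrable_inner_of_memLp (memLp_uncurry_timeMap hκ hq mq) (mφ.comp_snd _)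

lemma integrable_integral_inner_timeMap (hκ : κ ≤ 1 / 2) (hq : StronglyMeasurable q)
    (mq : MemLp q 2 volume) (mφ : MemLp φ 2 volume) :
    Integrable (fun r => ∫ z, ⟪q (timeMap (1 - κ) (κ * Tend * r) z), φ z⟫_ℝ)
      (volume.restrict (Ioc (0 : ℝ) 1)) :=
  (integrable_inner_timeMap hκ hq mq mφ).integral_prod_left

lemma integral_inner_timeAvg [CompleteSpace F] (hκ : κ ≤ 1 / 2) (hq : StronglyMeasurable q)
    (mq : MemLp q 2 volume) (mφ : MemLp φ 2 volume) :
    ∫ z, ⟪timeAvg Tend κ q z, φ z⟫_ℝ =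
      ∫ r in Ioc (0 : ℝ) 1, ∫ z, ⟪q (timeMap (1 - κ) (κ * Tend * r) z), φ z⟫_ℝ := by
  have hsl := memLp_slice_of_memLp_prod (stronglyMeasurable_uncurry_timeMap hq (1 - κ) (κ * Tend))
    (memLp_uncurry_timeMap hκ hq mq)
  rw [integral_integral_swap (integrable_inner_timeMap hκ hq mq mφ)]
  refine integral_congr_ae ?_
  filter_upwards [hsl] with z hz
  rw [timeAvg, real_inner_comm, ← integral_inner (hz.integrable (by norm_num))]
  simp only [real_inner_comm]

end Pairing

/-! ### The lateral condition under cut-offs and averages in time -/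

section ZeroTrace

variable {d : ℕ} {Tend : ℝ} {Ω : Set (Space d)}

lemma restrict_cylinder (Tend : ℝ) (Ω : Set (Space d)) :
    (volume.restrict (cylinder Tend Ω) : Measure (SpaceTime d)) =
      (volume.restrict (Ioo 0 Tend)).prod (volume.restrict Ω) :=
  (Measure.prod_restrict _ _).symm

lemma contDiff_comp_fst {θ : ℝ → ℝ} (hθ : ContDiff ℝ ∞ θ) :
    ContDiff ℝ ∞ fun z : SpaceTime d => θ z.1 := hθ.comp contDiff_fst

lemma gradX_comp_fst {θ : ℝ → ℝ} (hθ : ContDiff ℝ ∞ θ) (z : SpaceTime d) :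
    gradX (fun z : SpaceTime d => θ z.1) z = 0 := by
  ext i
  have h1 : HasFDerivAt (fun z : SpaceTime d => θ z.1)
      ((fderiv ℝ θ z.1).comp (ContinuousLinearMap.fst ℝ ℝ (Space d))) z :=
    ((hθ.differentiable (by simp)) z.1).hasFDerivAt.comp z hasFDerivAt_fst
  simp [gradX, h1.fderiv]

/-- Integration by parts in space holds at almost every time. -/
lemma HasZeroTraceGrad.ae_slice (hΩ : IsOpen Ω) (hb : Bornology.IsBounded Ω)
    {v : SpaceTime d → ℝ} {σ : SpaceTime d → Space d}
    (mv : MemLp v 2 (volume.restrict (cylinder Tend Ω)))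
    (mσ : MemLp σ 2 (volume.restrict (cylinder Tend Ω)))
    (h : HasZeroTraceGrad (cylinder Tend Ω) v σ)
    {χ : SpaceTime d → Space d} (hχ : ContDiff ℝ ∞ χ) :
    ∀ᵐ t ∂(volume.restrict (Ioo 0 Tend)),
      ∫ x in Ω, (⟪σ (t, x), χ (t, x)⟫_ℝ + v (t, x) * divX χ (t, x)) = 0 := by
  have hQ : IsOpen (cylinder Tend Ω) := isOpen_Ioo.prod hΩ
  have hbQ : Bornology.IsBounded (cylinder Tend Ω) := (Metric.isBounded_Ioo 0 Tend).prod hb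
  have i1 : ∀ {χ : SpaceTime d → Space d}, ContDiff ℝ ∞ χ →
      Integrable (fun z => ⟪σ z, χ z⟫_ℝ) (volume.restrict (cylinder Tend Ω)) := fun hχ =>
    integrable_inner_of_memLp mσ (memLp_of_continuous hQ hbQ hχ.continuous)
  have i2 : ∀ {χ : SpaceTime d → Space d}, ContDiff ℝ ∞ χ →
      Integrable (fun z => v z * divX χ z) (volume.restrict (cylinder Tend Ω)) := fun hχ =>
    mv.integrable_mul (memLp_of_continuous hQ hbQ (continuous_divX hχ))
  have iN := (i1 hχ).add (i2 hχ)
  rw [restrict_cylinder] at iN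
  have in1 := iN.integral_prod_left
  rw [ae_restrict_iff' measurableSet_Ioo]
  refine isOpen_Ioo.ae_eq_zero_of_integral_contDiff_smul_eq_zero
    (locallyIntegrableOn_of_locallyIntegrable_restrict in1.locallyIntegrable) fun θ c1 c2 c3 => ?_
  rw [← setIntegral_eq_integral_of_forall_compl_eq_zero (s := Ioo 0 Tend)
    fun t ht => by rw [image_eq_zero_of_notMem_tsupport fun h => ht (c3 h), zero_smul]]
  have cθ := contDiff_comp_fst (d := d) c1
  -- A factor depending on time only commutes with the spatial divergence, so the identity in `Q`
  -- localizes in time.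
  have key := h (fun z => θ z.1 • χ z) (cθ.smul hχ)
  have e : ∀ z, divX (fun z => θ z.1 • χ z) z = θ z.1 * divX χ z := fun z => by
    rw [divX_smul (cθ.differentiable (by simp) z) (hχ.differentiable (by simp) z),
      gradX_comp_fst c1, inner_zero_left, add_zero]
  have j1 := i1 (show ContDiff ℝ ∞ (fun z : SpaceTime d => θ z.1 • χ z) from cθ.smul hχ)
  have j2 := i2 (show ContDiff ℝ ∞ (fun z : SpaceTime d => θ z.1 • χ z) from cθ.smul hχ)
  rw [eq_neg_iff_add_eq_zero, ← integral_add j1 j2, restrict_cylinder, integral_prod] at key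
  · refine Eq.trans (integral_congr_ae (Eventually.of_forall fun t => ?_)) key
    simp only [smul_eq_mul, e]
    rw [← integral_const_mul]
    refine integral_congr_ae (Eventually.of_forall fun x => ?_)
    simp only [real_inner_smul_right]
    ring
  · rw [← restrict_cylinder]
    exact j1.add j2

/-- Integration by parts is purely spatial and holds on almost every time slice, so cutting off with
an arbitrary measurable set of times costs nothing. -/
lemma HasZeroTraceGrad.integral_indicator (hΩ : IsOpen Ω) (hb : Bornology.IsBounded Ω)
    {v : SpaceTime d → ℝ} {σ : SpaceTime d → Space d}
    (mv : MemLp v 2 (volume.restrict (cylinder Tend Ω)))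
    (mσ : MemLp σ 2 (volume.restrict (cylinder Tend Ω)))
    (h : HasZeroTraceGrad (cylinder Tend Ω) v σ)
    {χ : SpaceTime d → Space d} (hχ : ContDiff ℝ ∞ χ) {I : Set ℝ} (hI : MeasurableSet I) :
    ∫ z in cylinder Tend Ω, (Prod.fst ⁻¹' I).indicator
      (fun z => ⟪σ z, χ z⟫_ℝ + v z * divX χ z) z = 0 := by
  have hQ : IsOpen (cylinder Tend Ω) := isOpen_Ioo.prod hΩ
  have hbQ : Bornology.IsBounded (cylinder Tend Ω) := (Metric.isBounded_Ioo 0 Tend).prod hb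
  have i1 : Integrable (fun z => ⟪σ z, χ z⟫_ℝ) (volume.restrict (cylinder Tend Ω)) :=
    integrable_inner_of_memLp mσ (memLp_of_continuous hQ hbQ hχ.continuous)
  have i2 : Integrable (fun z => v z * divX χ z) (volume.restrict (cylinder Tend Ω)) :=
    mv.integrable_mul (memLp_of_continuous hQ hbQ (continuous_divX hχ))
  have i3 := (i1.add i2).indicator (measurable_fst hI)
  rw [restrict_cylinder] at i3 ⊢
  refine (integral_prod _ i3).trans (integral_eq_zero_of_ae ?_)
  filter_upwards [h.ae_slice hΩ hb mv mσ hχ] with t ht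
  by_cases htI : t ∈ I
  · simpa [indicator, htI] using ht
  · simp [indicator, htI]

lemma divX_comp_timeMap (a b : ℝ) {χ : SpaceTime d → Space d} (hχ : ContDiff ℝ ∞ χ)
    (z : SpaceTime d) : divX (fun z => χ (timeMap a b z)) z = divX χ (timeMap a b z) := by
  have h0 : HasFDerivAt (timeMap a b : SpaceTime d → SpaceTime d)
      ((a • ContinuousLinearMap.fst ℝ ℝ (Space d)).prod (ContinuousLinearMap.snd ℝ ℝ _)) z :=
    ((hasFDerivAt_fst.const_mul a).add_const b).prodMk hasFDerivAt_snd
  have h1 := ((hχ.differentiable (by simp) (timeMap a b z)).hasFDerivAt.comp z h0).fderiv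
  simp only [Function.comp_def] at h1
  simp [divX, h1]

/-- For each fixed `r` the change of time carries the identity over to the pair `(v, σ)`, tested
with a transported field on a transported set of times. Averaging over `r` then preserves it. -/
lemma HasZeroTraceGrad.timeAvg (hΩ : IsOpen Ω) (hb : Bornology.IsBounded Ω) {κ : ℝ}
    (hκ : κ ≤ 1 / 2) {v : SpaceTime d → ℝ} {σ : SpaceTime d → Space d}
    (sv : StronglyMeasurable v) (sσ : StronglyMeasurable σ)
    (mv : MemLp v 2 volume) (mσ : MemLp σ 2 volume)
    (zv : ∀ z ∉ cylinder Tend Ω, v z = 0) (zσ : ∀ z ∉ cylinder Tend Ω, σ z = 0)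
    (h : HasZeroTraceGrad (cylinder Tend Ω) v σ) {I : Set ℝ} (hI : MeasurableSet I) :
    HasZeroTraceGrad (cylinder Tend Ω)
      ((Prod.fst ⁻¹' I).indicator (HeatDPG.timeAvg Tend κ v))
      ((Prod.fst ⁻¹' I).indicator (HeatDPG.timeAvg Tend κ σ)) := by
  intro χ hχ
  have hQ : IsOpen (cylinder Tend Ω) := isOpen_Ioo.prod hΩ
  have hbQ : Bornology.IsBounded (cylinder Tend Ω) := (Metric.isBounded_Ioo 0 Tend).prod hb
  set I' : Set ℝ := I ∩ Ioo 0 Tend with hI'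
  have mI' : MeasurableSet (I' ×ˢ Ω) := (hI.inter measurableSet_Ioo).prod hΩ.measurableSet
  have hsub : I' ×ˢ Ω ⊆ cylinder Tend Ω := prod_mono inter_subset_right le_rfl
  have m1 : MemLp ((I' ×ˢ Ω).indicator χ) 2 volume :=
    (memLp_indicator_iff_restrict mI').2 ((memLp_of_continuous hQ hbQ hχ.continuous).mono_measure
      (Measure.restrict_mono hsub le_rfl))
  have m2 : MemLp ((I' ×ˢ Ω).indicator (divX χ)) 2 volume :=
    (memLp_indicator_iff_restrict mI').2 ((memLp_of_continuous hQ hbQ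
      (continuous_divX hχ)).mono_measure (Measure.restrict_mono hsub le_rfl))
  have e1 : ∫ z in cylinder Tend Ω, ⟪(Prod.fst ⁻¹' I).indicator (HeatDPG.timeAvg Tend κ σ) z, χ z⟫_ℝ =
      ∫ z, ⟪HeatDPG.timeAvg Tend κ σ z, (I' ×ˢ Ω).indicator χ z⟫_ℝ := by
    rw [← MeasureTheory.integral_indicator hQ.measurableSet]
    refine integral_congr_ae (Eventually.of_forall fun z => ?_)
    by_cases h1 : z.1 ∈ I <;> by_cases h2 : z.1 ∈ Ioo 0 Tend <;> by_cases h3 : z.2 ∈ Ω <;>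
      simp [indicator, cylinder, mem_prod, h1, h2, h3, hI', -mem_Ioo]
  have e2 : ∫ z in cylinder Tend Ω,
      (Prod.fst ⁻¹' I).indicator (HeatDPG.timeAvg Tend κ v) z * divX χ z =
      ∫ z, ⟪HeatDPG.timeAvg Tend κ v z, (I' ×ˢ Ω).indicator (divX χ) z⟫_ℝ := by
    rw [← MeasureTheory.integral_indicator hQ.measurableSet]
    refine integral_congr_ae (Eventually.of_forall fun z => ?_)
    by_cases h1 : z.1 ∈ I <;> by_cases h2 : z.1 ∈ Ioo 0 Tend <;> by_cases h3 : z.2 ∈ Ω <;>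
      simp [indicator, cylinder, mem_prod, h1, h2, h3, hI', -mem_Ioo, mul_comm]
  rw [eq_neg_iff_add_eq_zero, e1, e2, integral_inner_timeAvg hκ sσ mσ m1,
    integral_inner_timeAvg hκ sv mv m2,
    ← integral_add (integrable_integral_inner_timeMap hκ sσ mσ m1)
      (integrable_integral_inner_timeMap hκ sv mv m2)]
  refine integral_eq_zero_of_ae (Eventually.of_forall fun r => ?_)
  have ha : 0 < 1 - κ := by linarith
  set b : ℝ := κ * Tend * r
  set a : ℝ := 1 - κ
  have j1 : Integrable fun z => ⟪σ (timeMap a b z), (I' ×ˢ Ω).indicator χ z⟫_ℝ :=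
    integrable_inner_of_memLp (memLp_timeMap ha b mσ) m1
  have j2 : Integrable fun z => ⟪v (timeMap a b z), (I' ×ˢ Ω).indicator (divX χ) z⟫_ℝ :=
    integrable_inner_of_memLp (memLp_timeMap ha b mv) m2
  change (∫ z, ⟪σ (timeMap a b z), (I' ×ˢ Ω).indicator χ z⟫_ℝ) +
    (∫ z, ⟪v (timeMap a b z), (I' ×ˢ Ω).indicator (divX χ) z⟫_ℝ) = 0
  rw [← integral_add j1 j2]
  set χ' : SpaceTime d → Space d := fun z => χ (timeMap a⁻¹ (-(a⁻¹ * b)) z) with hχ'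
  have cχ' : ContDiff ℝ ∞ χ' := hχ.comp (contDiff_timeMap _ _)
  -- Times whose preimage under the change of time lies in `I'`. The part of the transported domain
  -- that leaves `Q` is harmless because `v` and `σ` vanish there.
  set I'' : Set ℝ := (fun t => a⁻¹ * t + -(a⁻¹ * b)) ⁻¹' I' with hI''
  have mI'' : MeasurableSet I'' :=
    measurableSet_preimage (by fun_prop) (hI.inter measurableSet_Ioo)
  have key := h.integral_indicator hΩ hb (mv.mono_measure Measure.restrict_le_self)
    (mσ.mono_measure Measure.restrict_le_self) cχ' mI''
  rw [← MeasureTheory.integral_indicator hQ.measurableSet] at key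
  have hcv := integral_timeMap ha b ((cylinder Tend Ω).indicator fun z => (Prod.fst ⁻¹' I'').indicator
    (fun z => ⟪σ z, χ' z⟫_ℝ + v z * divX χ' z) z)
  rw [key, smul_zero] at hcv
  rw [← hcv]
  refine integral_congr_ae (Eventually.of_forall fun z => ?_)
  have hz1 : (timeMap a b z).1 ∈ I'' ↔ z.1 ∈ I' := by
    have : (timeMap a⁻¹ (-(a⁻¹ * b)) (timeMap a b z)).1 = z.1 := by
      rw [timeMap_timeMap' ha.ne']
    rw [hI'', mem_preimage, ← this]
    rfl
  have hz2 : χ' (timeMap a b z) = χ z := by simp only [hχ', timeMap_timeMap' ha.ne']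
  have hz3 : divX χ' (timeMap a b z) = divX χ z := by
    rw [divX_comp_timeMap _ _ hχ, timeMap_timeMap' ha.ne']
  by_cases hzQ : timeMap a b z ∈ cylinder Tend Ω
  · have hzΩ : z.2 ∈ Ω := hzQ.2
    by_cases hzI : z.1 ∈ I'
    · have : timeMap a b z ∈ (Prod.fst ⁻¹' I'' : Set (SpaceTime d)) := hz1.2 hzI
      simp only [indicator_of_mem hzQ, indicator_of_mem this,
        indicator_of_mem (show z ∈ I' ×ˢ Ω from ⟨hzI, hzΩ⟩), hz2, hz3]
      simp [mul_comm]
    · have : timeMap a b z ∉ (Prod.fst ⁻¹' I'' : Set (SpaceTime d)) := fun h => hzI (hz1.1 h)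
      simp only [indicator_of_mem hzQ, indicator_of_notMem this,
        indicator_of_notMem (show z ∉ I' ×ˢ Ω from fun h => hzI h.1)]
      simp
  · simp only [indicator_of_notMem hzQ, zv _ hzQ, zσ _ hzQ]
    simp

lemma HasZeroTraceGrad.sub {Q : Set (SpaceTime d)} (hQ : IsOpen Q) (hb : Bornology.IsBounded Q)
    {v v' : SpaceTime d → ℝ} {σ σ' : SpaceTime d → Space d}
    (mv : MemLp v 2 (volume.restrict Q)) (mσ : MemLp σ 2 (volume.restrict Q))
    (mv' : MemLp v' 2 (volume.restrict Q)) (mσ' : MemLp σ' 2 (volume.restrict Q))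
    (h : HasZeroTraceGrad Q v σ) (h' : HasZeroTraceGrad Q v' σ') :
    HasZeroTraceGrad Q (v - v') (σ - σ') := by
  intro χ hχ
  have mχ := memLp_of_continuous hQ hb hχ.continuous
  have mχ' := memLp_of_continuous hQ hb (continuous_divX hχ)
  have i1 : Integrable (fun z => v z * divX χ z) (volume.restrict Q) := mv.integrable_mul mχ'
  have i2 : Integrable (fun z => v' z * divX χ z) (volume.restrict Q) := mv'.integrable_mul mχ'
  simp only [Pi.sub_apply, inner_sub_left, sub_mul]
  rw [integral_sub (integrable_inner_of_memLp mσ mχ) (integrable_inner_of_memLp mσ' mχ),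
    integral_sub i1 i2, h χ hχ, h' χ hχ]
  ring

end ZeroTrace

/-! ### Primitives in time and the energy identity -/

lemma integral_mul_add_mul_of_primitive {F G f g : ℝ → ℝ} {a b : ℝ}
    (hf : IntervalIntegrable f volume a b) (hg : IntervalIntegrable g volume a b)
    (hF : ∀ t ∈ uIcc a b, F t - F a = ∫ s in a..t, f s)
    (hG : ∀ t ∈ uIcc a b, G t - G a = ∫ s in a..t, g s) :
    ∫ t in a..b, (f t * G t + F t * g t) = F b * G b - F a * G a := by
  -- The values of `F` are prescribed only on the interval. It is therefore replaced by `F a` plus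
  -- the integral of `f`, which is absolutely continuous with derivative `f` almost everywhere.
  have key : ∀ {F f : ℝ → ℝ}, IntervalIntegrable f volume a b →
      (∀ t ∈ uIcc a b, F t - F a = ∫ s in a..t, f s) →
      AbsolutelyContinuousOnInterval (fun t => (∫ s in a..t, f s) + F a) a b ∧
      (∀ᵐ t, t ∈ uIcc a b → deriv (fun t => (∫ s in a..t, f s) + F a) t = f t) ∧
      ∀ t ∈ uIcc a b, (∫ s in a..t, f s) + F a = F t := by
    intro F f hf hF
    refine ⟨?_, ?_, fun t ht => by rw [← hF t ht]; ring⟩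
    · have h1 := hf.absolutelyContinuousOnInterval_intervalIntegral (c := a) left_mem_uIcc
      have h2 : AbsolutelyContinuousOnInterval (fun _ : ℝ => F a) a b :=
        (LipschitzWith.const (F a)).lipschitzOnWith.absolutelyContinuousOnInterval
      exact h1.add h2
    · filter_upwards [hf.ae_hasDerivAt_integral] with t ht hmem
      exact ((ht hmem a left_mem_uIcc).add_const (F a)).deriv
  obtain ⟨F1, F2, F3⟩ := key hf hF
  obtain ⟨G1, G2, G3⟩ := key hg hG
  have h := F1.integral_deriv_mul_eq_sub G1
  rw [F3 b right_mem_uIcc, F3 a left_mem_uIcc, G3 b right_mem_uIcc, G3 a left_mem_uIcc] at h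
  rw [← h]
  refine intervalIntegral.integral_congr_ae ?_
  filter_upwards [F2, G2] with t h1 h2 ht
  have ht' := uIoc_subset_uIcc ht
  rw [h1 ht', h2 ht', F3 t ht', G3 t ht']

section Primitive

variable {d : ℕ}

/-- At almost every point in space, `w` is a primitive of `E` in time. -/
def IsTimePrimitive (w E : SpaceTime d → ℝ) : Prop :=
  ∀ᵐ x : Space d, (∀ a b, IntervalIntegrable (fun t => E (t, x)) volume a b) ∧
    ∀ s t, w (t, x) - w (s, x) = ∫ r in s..t, E (r, x)

lemma IsTimePrimitive.sub {w E w' E' : SpaceTime d → ℝ} (h : IsTimePrimitive w E)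
    (h' : IsTimePrimitive w' E') : IsTimePrimitive (w - w') (E - E') := by
  filter_upwards [h, h'] with x hx hx'
  refine ⟨fun a b => (hx.1 a b).sub (hx'.1 a b), fun s t => ?_⟩
  simp only [Pi.sub_apply]
  rw [intervalIntegral.integral_sub (hx.1 s t) (hx'.1 s t), ← hx.2, ← hx'.2]
  ring

/-- Cauchy–Schwarz in time at almost every point of space. It makes the curve `t ↦ w (t, ·)` Hölder
continuous of order `1/2` in `L²`. -/
lemma IsTimePrimitive.lintegral_sub_le {w E : SpaceTime d → ℝ} (h : IsTimePrimitive w E)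
    (hE : StronglyMeasurable E) {s t : ℝ} (hst : s ≤ t) :
    ∫⁻ x : Space d, ‖w (t, x) - w (s, x)‖ₑ ^ 2 ≤
      ENNReal.ofReal (t - s) * eLpNorm E 2 volume ^ 2 := by
  rw [eLpNorm_two_sq, Measure.volume_eq_prod, lintegral_prod_symm _ (by fun_prop),
    ← lintegral_const_mul' _ _ ENNReal.ofReal_ne_top]
  refine lintegral_mono_ae ?_
  filter_upwards [h] with x hx
  rw [hx.2, intervalIntegral.integral_of_le hst]
  refine (enorm_integral_sq_le (hE.comp_measurable
    (g := fun r => (r, x)) (by fun_prop)).aestronglyMeasurable).trans ?_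
  rw [Measure.restrict_apply_univ, Real.volume_Ioc]
  gcongr
  · exact Measure.restrict_le_self
  · exact le_rfl

/-- Integration by parts of `w · w` in time at almost every point of space, followed by Fubini. -/
lemma IsTimePrimitive.energy {w E : SpaceTime d → ℝ} (h : IsTimePrimitive w E)
    (mw : MemLp w 2 volume) (mE : MemLp E 2 volume)
    (hw : ∀ t, MemLp (fun x => w (t, x)) 2 volume) (Ω : Set (Space d)) {s t : ℝ} (hst : s ≤ t) :
    (∫ x in Ω, w (t, x) ^ 2) - ∫ x in Ω, w (s, x) ^ 2 =
      2 * ∫ z in Ioo s t ×ˢ Ω, E z * w z := by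
  have i1 : ∀ t, Integrable (fun x => w (t, x) ^ 2) (volume.restrict Ω) := fun t =>
    ((hw t).restrict Ω).integrable_sq
  have i2 : Integrable (fun z => E z * w z) := mE.integrable_mul mw
  have i3 := i2.integrableOn (s := Ioo s t ×ˢ Ω)
  rw [IntegrableOn, Measure.volume_eq_prod, ← Measure.prod_restrict] at i3
  rw [← integral_sub (i1 t) (i1 s), Measure.volume_eq_prod, ← Measure.prod_restrict,
    integral_prod_symm _ i3, ← integral_const_mul]
  refine integral_congr_ae (ae_restrict_of_ae ?_)
  filter_upwards [h] with x hx
  have := integral_mul_add_mul_of_primitive (hx.1 s t) (hx.1 s t)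
    (fun r _ => hx.2 s r) (fun r _ => hx.2 s r)
  rw [sq, sq, ← this, intervalIntegral.integral_of_le hst, ← integral_Ioc_eq_integral_Ioo,
    ← integral_const_mul]
  refine integral_congr_ae (Eventually.of_forall fun r => ?_)
  ring

/-- No value of `w` at a particular time is controlled beforehand. The energy identity is therefore
averaged over all starting times `s`, which replaces `‖w(s)‖²` by the space-time norm. -/
lemma IsTimePrimitive.mul_integral_sq_le {w E : SpaceTime d → ℝ} (h : IsTimePrimitive w E)
    (mw : MemLp w 2 volume) (mE : MemLp E 2 volume)
    (hw : ∀ t, MemLp (fun x => w (t, x)) 2 volume) (Ω : Set (Space d)) {Tend : ℝ} (hT : 0 < Tend)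
    {B : ℝ} (hB : ∀ s t, 0 ≤ s → s ≤ t → t ≤ Tend → |∫ z in Ioo s t ×ˢ Ω, E z * w z| ≤ B)
    {t : ℝ} (ht : t ∈ Icc 0 Tend) :
    Tend * ∫ x in Ω, w (t, x) ^ 2 ≤ (∫ z, w z ^ 2) + 2 * Tend * B := by
  set n : ℝ → ℝ := fun t => ∫ x in Ω, w (t, x) ^ 2 with hn
  have h1 : ∀ s ∈ Ioo 0 Tend, n t ≤ n s + 2 * B := by
    intro s hs
    rcases le_total s t with hst | hst
    · have := h.energy mw mE hw Ω hst
      have hb := (abs_le.1 (hB s t hs.1.le hst ht.2)).2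
      simp only [hn]
      linarith
    · have := h.energy mw mE hw Ω hst
      have hb := (abs_le.1 (hB t s ht.1 hst hs.2.le)).1
      simp only [hn]
      linarith
  have i0 : Integrable (fun z => w z ^ 2) := mw.integrable_sq
  have i1 : Integrable (fun z => w z ^ 2)
      ((volume.restrict (Ioo 0 Tend)).prod (volume.restrict Ω)) := by
    rw [Measure.prod_restrict]
    exact i0.integrableOn
  have i2 : Integrable n (volume.restrict (Ioo 0 Tend)) := i1.integral_prod_left
  have h2 : ∫ _ in Ioo 0 Tend, n t ≤ ∫ s in Ioo 0 Tend, (n s + 2 * B) :=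
    setIntegral_mono_on (integrable_const _) (i2.add (integrable_const _)) measurableSet_Ioo h1
  rw [integral_add i2 (integrable_const _)] at h2
  have h3 : ∫ s in Ioo 0 Tend, n s ≤ ∫ z, w z ^ 2 := by
    rw [← integral_prod (fun z : SpaceTime d => w z ^ 2) i1, Measure.prod_restrict]
    exact setIntegral_le_integral i0 (Eventually.of_forall fun z => sq_nonneg _)
  simp only [integral_const, measureReal_restrict_apply_univ, Real.volume_real_Ioo_of_le hT.le,
    smul_eq_mul, sub_zero] at h2
  linarith

end Primitive

/-! ### The averaged equation -/

section Difference

variable {d : ℕ} {Tend κ : ℝ} {Ω : Set (Space d)} {v : SpaceTime d → ℝ}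

/-- The time derivative of `timeAvg Tend κ v`. -/
noncomputable def timeDiff (Tend κ : ℝ) (v : SpaceTime d → ℝ) (z : SpaceTime d) : ℝ :=
  (1 - κ) / (κ * Tend) * (v (timeMap (1 - κ) (κ * Tend) z) - v (timeMap (1 - κ) 0 z))

lemma stronglyMeasurable_timeDiff (hv : StronglyMeasurable v) :
    StronglyMeasurable (timeDiff Tend κ v) :=
  ((hv.comp_measurable (continuous_timeMap _ _).measurable).sub
    (hv.comp_measurable (continuous_timeMap _ _).measurable)).const_mul _

lemma memLp_timeDiff (hκ : κ < 1) (mv : MemLp v 2 volume) :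
    MemLp (timeDiff Tend κ v) 2 volume :=
  ((memLp_timeMap (sub_pos.2 hκ) _ mv).sub (memLp_timeMap (sub_pos.2 hκ) _ mv)).const_mul _

/-- This holds at every time, not only almost every one. With `t` fixed, the averaging variable `r`
plays the role of time, and Jensen's inequality bounds the slice by the norm of a rescaled `v`. -/
lemma memLp_slice_timeAvg (hT : 0 < Tend) (hκ : 0 < κ) (hv : StronglyMeasurable v)
    (mv : MemLp v 2 volume) (t : ℝ) : MemLp (fun x => timeAvg Tend κ v (t, x)) 2 volume := by
  have m := memLp_timeMap (mul_pos hκ hT) ((1 - κ) * t) mv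
  have s := hv.comp_measurable (continuous_timeMap (d := d) (κ * Tend) ((1 - κ) * t)).measurable
  have e : (fun x => timeAvg Tend κ v (t, x)) = fun x => ∫ r in Ioc (0 : ℝ) 1,
      (fun (r : ℝ) (x : Space d) => v (timeMap (κ * Tend) ((1 - κ) * t) (r, x))) r x := by
    ext x
    simp only [timeAvg, timeMap, add_comm]
  rw [e]
  refine ⟨((stronglyMeasurable_timeAvg (Tend := Tend) (κ := κ) hv).comp_measurable
    (g := fun x => (t, x)) (by fun_prop)).aestronglyMeasurable.congr (by rw [← e]; rfl), ?_⟩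
  refine (eLpNorm_integral_le_prod (P := volume.restrict (Ioc (0 : ℝ) 1))
    (f := fun (r : ℝ) (x : Space d) => v (timeMap (κ * Tend) ((1 - κ) * t) (r, x))) s).trans_lt ?_
  refine lt_of_le_of_lt (eLpNorm_mono_measure _ ?_) m.2
  have : (volume.restrict (Ioc (0 : ℝ) 1)).prod (volume : Measure (Space d)) =
      (volume.prod volume).restrict (Ioc (0 : ℝ) 1 ×ˢ univ) := by
    rw [← Measure.prod_restrict, Measure.restrict_univ]
  rw [this]
  exact Measure.restrict_le_self

lemma ae_integrable_slice (sv : StronglyMeasurable v) (mv : MemLp v 2 volume)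
    (zv : ∀ z ∉ cylinder Tend Ω, v z = 0) : ∀ᵐ x : Space d, Integrable fun t => v (t, x) := by
  filter_upwards [memLp_slice_of_memLp_prod (f := fun (t : ℝ) (x : Space d) => v (t, x)) sv mv]
    with x hx
  have h1 : IntegrableOn (fun t => v (t, x)) (Ioo 0 Tend) :=
    (hx.restrict (Ioo 0 Tend)).integrable (by norm_num)
  refine (integrableOn_iff_integrable_of_support_subset fun t ht => ?_).1 h1
  by_contra hcon
  exact ht (zv _ fun h => hcon h.1)

/-- For fixed `x` the average is `(κ Tend)⁻¹` times the integral of `v` over a window of length `κ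
Tend` moving at speed `1 - κ`. Its increments are differences of the integrals over the two end
points of the window. -/
lemma isTimePrimitive_timeAvg (hT : 0 < Tend) (hκ : 0 < κ) (hκ1 : κ < 1)
    (h : ∀ᵐ x : Space d, Integrable fun t => v (t, x)) :
    IsTimePrimitive (timeAvg Tend κ v) (timeDiff Tend κ v) := by
  filter_upwards [h] with x hx
  set f : ℝ → ℝ := fun t => v (t, x) with hf
  have ha : 1 - κ ≠ 0 := (sub_pos.2 hκ1).ne'
  have hh : κ * Tend ≠ 0 := (mul_pos hκ hT).ne'
  have ii : ∀ a b, IntervalIntegrable f volume a b := fun a b => hx.intervalIntegrable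
  have ic : ∀ c : ℝ, Integrable fun t => f ((1 - κ) * t + c) := fun c =>
    (hx.comp_add_right c).comp_mul_left' ha
  have e0 : ∀ t, timeDiff Tend κ v (t, x) =
      (1 - κ) / (κ * Tend) * (f ((1 - κ) * t + κ * Tend) - f ((1 - κ) * t + 0)) := fun t => rfl
  have e1 : ∀ t, timeAvg Tend κ v (t, x) =
      (κ * Tend)⁻¹ * ∫ s in (1 - κ) * t..(1 - κ) * t + κ * Tend, f s := by
    intro t
    have : timeAvg Tend κ v (t, x) = ∫ r in (0 : ℝ)..1, f ((1 - κ) * t + κ * Tend * r) := by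
      rw [intervalIntegral.integral_of_le zero_le_one]
      rfl
    rw [this, intervalIntegral.integral_comp_add_mul f hh]
    simp
  refine ⟨fun a b => ?_, fun s t => ?_⟩
  · simp only [e0]
    exact (((ic _).sub (ic _)).const_mul _).intervalIntegrable
  · simp only [e0, e1]
    rw [intervalIntegral.integral_const_mul,
      intervalIntegral.integral_sub (ic _).intervalIntegrable (ic _).intervalIntegrable,
      intervalIntegral.integral_comp_mul_add f ha, intervalIntegral.integral_comp_mul_add f ha,
      ← mul_sub, ← smul_sub, intervalIntegral.integral_interval_sub_interval_comm (ii _ _) (ii _ _)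
        (ii _ _), intervalIntegral.integral_symm ((1 - κ) * s) ((1 - κ) * t),
      intervalIntegral.integral_symm ((1 - κ) * s + κ * Tend)]
    simp only [add_zero, smul_eq_mul]
    field_simp
    ring

lemma fderiv_comp_timeMap (a b : ℝ) {φ : SpaceTime d → ℝ} (hφ : ContDiff ℝ ∞ φ)
    (z y : SpaceTime d) :
    fderiv ℝ (fun z => φ (timeMap a b z)) z y = fderiv ℝ φ (timeMap a b z) (a * y.1, y.2) := by
  have h0 : HasFDerivAt (timeMap a b : SpaceTime d → SpaceTime d)
      ((a • ContinuousLinearMap.fst ℝ ℝ (Space d)).prod (ContinuousLinearMap.snd ℝ ℝ _)) z :=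
    ((hasFDerivAt_fst.const_mul a).add_const b).prodMk hasFDerivAt_snd
  have h1 := ((hφ.differentiable (by simp) (timeMap a b z)).hasFDerivAt.comp z h0).fderiv
  simp only [Function.comp_def] at h1
  simp [h1]

lemma dt_comp_timeMap (a b : ℝ) {φ : SpaceTime d → ℝ} (hφ : ContDiff ℝ ∞ φ) (z : SpaceTime d) :
    dt (fun z => φ (timeMap a b z)) z = a * dt φ (timeMap a b z) := by
  have : ((a * (1, (0 : Space d)).1, (1, (0 : Space d)).2) : SpaceTime d) = a • (1, 0) := by
    ext <;> simp
  simp only [dt]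
  rw [fderiv_comp_timeMap a b hφ, this, map_smul, smul_eq_mul]

lemma gradX_comp_timeMap (a b : ℝ) {φ : SpaceTime d → ℝ} (hφ : ContDiff ℝ ∞ φ)
    (z : SpaceTime d) : gradX (fun z => φ (timeMap a b z)) z = gradX φ (timeMap a b z) := by
  ext i
  simp [gradX, fderiv_comp_timeMap a b hφ]

/-- Integration by parts in time at almost every point of space, over an interval at whose ends the
test function vanishes. -/
lemma IsTimePrimitive.integral_mul_test {w E : SpaceTime d → ℝ} (h : IsTimePrimitive w E)
    (mw : MemLp w 2 volume) (mE : MemLp E 2 volume) {φ : SpaceTime d → ℝ}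
    (h1 : ContDiff ℝ ∞ φ) (h2 : HasCompactSupport φ) :
    ∫ z, E z * φ z = - ∫ z, w z * dt φ z := by
  have i1 : Integrable (fun z => E z * φ z) :=
    mE.integrable_mul (h1.continuous.memLp_of_hasCompactSupport (p := 2) h2)
  have i2 : Integrable (fun z => w z * dt φ z) :=
    mw.integrable_mul ((continuous_dt h1).memLp_of_hasCompactSupport (p := 2) (compact_dt h2))
  rw [eq_neg_iff_add_eq_zero, ← integral_add i1 i2]
  have i3 := i1.add i2
  rw [Measure.volume_eq_prod] at i3 ⊢
  refine (integral_prod_symm _ i3).trans (integral_eq_zero_of_ae ?_)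
  obtain ⟨R, hR⟩ := h2.isBounded.subset_closedBall (0 : SpaceTime d)
  have hR0 : ∀ (t : ℝ) (x : Space d), |R| < |t| → φ (t, x) = 0 ∧ dt φ (t, x) = 0 := by
    intro t x ht
    have hn : (t, x) ∉ tsupport φ := fun h => by
      have := hR h
      rw [mem_closedBall_zero_iff, Prod.norm_def, max_le_iff, Real.norm_eq_abs] at this
      linarith [le_abs_self R, this.1]
    refine ⟨image_eq_zero_of_notMem_tsupport hn, ?_⟩
    rw [dt, (notMem_tsupport_iff_eventuallyEq.1 hn).fderiv_eq]
    simp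
  filter_upwards [h] with x hx
  set L : ℝ := |R| + 1 with hL
  have hL0 : 0 < L := by positivity
  have cφ : Continuous fun t : ℝ => φ (t, x) := h1.continuous.comp (by fun_prop)
  have cφ' : Continuous fun t : ℝ => dt φ (t, x) := (continuous_dt h1).comp (by fun_prop)
  have hd : ∀ t, HasDerivAt (fun t : ℝ => φ (t, x)) (dt φ (t, x)) t := by
    intro t
    have a1 : HasDerivAt (fun t : ℝ => ((t, x) : SpaceTime d)) (1, 0) t :=
      (hasDerivAt_id t).prodMk (hasDerivAt_const t x)
    exact (h1.differentiable (by simp) (t, x)).hasFDerivAt.comp_hasDerivAt t a1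
  have key := integral_mul_add_mul_of_primitive (G := fun t => φ (t, x)) (a := -L) (b := L) (hx.1 _ _)
    (cφ'.intervalIntegrable _ _) (fun r _ => hx.2 (-L) r)
    (fun r _ => (intervalIntegral.integral_eq_sub_of_hasDerivAt (fun t _ => hd t)
      (cφ'.intervalIntegrable _ _)).symm)
  rw [(hR0 L x (by rw [abs_of_pos hL0]; linarith)).1,
    (hR0 (-L) x (by rw [abs_neg, abs_of_pos hL0]; linarith)).1,
    intervalIntegral.integral_of_le (by linarith)] at key
  simp only [mul_zero, sub_zero] at key
  rw [setIntegral_eq_integral_of_forall_compl_eq_zero] at key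
  · exact key
  · intro t ht
    have : |R| < |t| := by
      by_contra hcon
      have := abs_le.1 (not_lt.1 hcon)
      exact ht ⟨by linarith, by linarith⟩
    simp [(hR0 t x this).1, (hR0 t x this).2]

/-- The time average satisfies the averaged first-order equation. -/
lemma HasWeakDiv.timeAvg (hΩ : IsOpen Ω) (hT : 0 < Tend) (hκ : 0 < κ) (hκ1 : κ ≤ 1 / 2)
    {g : SpaceTime d → ℝ} {τ : SpaceTime d → Space d}
    (sv : StronglyMeasurable v) (sτ : StronglyMeasurable τ) (sg : StronglyMeasurable g)
    (mv : MemLp v 2 volume) (mτ : MemLp τ 2 volume) (mg : MemLp g 2 volume)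
    (zv : ∀ z ∉ cylinder Tend Ω, v z = 0) (zτ : ∀ z ∉ cylinder Tend Ω, τ z = 0)
    (zg : ∀ z ∉ cylinder Tend Ω, g z = 0)
    (h : HasWeakDiv (cylinder Tend Ω) v τ g) {φ : SpaceTime d → ℝ} (h1 : ContDiff ℝ ∞ φ)
    (h2 : HasCompactSupport φ) (h3 : tsupport φ ⊆ cylinder Tend Ω) :
    ∫ z, timeDiff Tend κ v z * φ z = (1 - κ) * ∫ z, (HeatDPG.timeAvg Tend κ g z * φ z +
      ⟪HeatDPG.timeAvg Tend κ τ z, gradX φ z⟫_ℝ) := by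
  have ha : 0 < 1 - κ := by linarith
  have hQ : IsOpen (cylinder Tend Ω) := isOpen_Ioo.prod hΩ
  have mφ : MemLp φ 2 volume := h1.continuous.memLp_of_hasCompactSupport h2
  have mφt : MemLp (dt φ) 2 volume :=
    (continuous_dt h1).memLp_of_hasCompactSupport (compact_dt h2)
  have mφx : MemLp (gradX φ) 2 volume :=
    (continuous_gradX h1).memLp_of_hasCompactSupport (compact_gradX h2)
  rw [(isTimePrimitive_timeAvg hT hκ (by linarith) (ae_integrable_slice sv mv zv)).integral_mul_test
    (memLp_timeAvg hκ1 sv mv) (memLp_timeDiff (by linarith) mv) h1 h2]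
  have e1 : ∫ z, HeatDPG.timeAvg Tend κ g z * φ z = ∫ z, ⟪HeatDPG.timeAvg Tend κ g z, φ z⟫_ℝ := by
    simp [mul_comm]
  have e2 : ∫ z, HeatDPG.timeAvg Tend κ v z * dt φ z =
      ∫ z, ⟪HeatDPG.timeAvg Tend κ v z, dt φ z⟫_ℝ := by
    simp [mul_comm]
  have i1 : Integrable fun z => HeatDPG.timeAvg Tend κ g z * φ z :=
    (memLp_timeAvg hκ1 sg mg).integrable_mul mφ
  rw [integral_add i1 (integrable_inner_of_memLp (memLp_timeAvg hκ1 sτ mτ) mφx), e1, e2,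
    integral_inner_timeAvg hκ1 sv mv mφt, integral_inner_timeAvg hκ1 sg mg mφ,
    integral_inner_timeAvg hκ1 sτ mτ mφx,
    ← integral_add (integrable_integral_inner_timeMap hκ1 sg mg mφ)
      (integrable_integral_inner_timeMap hκ1 sτ mτ mφx), ← integral_const_mul, ← integral_neg]
  refine setIntegral_congr_fun measurableSet_Ioc fun r hr => ?_
  set b : ℝ := κ * Tend * r with hb
  set a : ℝ := 1 - κ with ha'
  have j1 : Integrable fun z => ⟪g (timeMap a b z), φ z⟫_ℝ :=
    integrable_inner_of_memLp (memLp_timeMap ha b mg) mφ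
  have j2 : Integrable fun z => ⟪τ (timeMap a b z), gradX φ z⟫_ℝ :=
    integrable_inner_of_memLp (memLp_timeMap ha b mτ) mφx
  rw [← integral_add j1 j2]
  set φ' : SpaceTime d → ℝ := fun z => φ (timeMap a⁻¹ (-(a⁻¹ * b)) z) with hφ'
  have c1 : ContDiff ℝ ∞ φ' := h1.comp (contDiff_timeMap _ _)
  have c2 : HasCompactSupport φ' := h2.comp_homeomorph (timeHomeo ha.ne' b).symm
  -- The reason for the contraction: `(1 - κ) t + κ Tend r` stays in `(0, Tend)`, so the transported
  -- test function is admissible without extending the equation past the end times.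
  have c3 : tsupport φ' ⊆ cylinder Tend Ω := by
    intro z hz
    have hz' : timeMap a⁻¹ (-(a⁻¹ * b)) z ∈ tsupport φ :=
      tsupport_comp_subset_preimage φ (continuous_timeMap _ _) hz
    obtain ⟨⟨t1, t2⟩, hx⟩ := h3 hz'
    have hz1 : z.1 = a * (timeMap a⁻¹ (-(a⁻¹ * b)) z).1 + b :=
      (congrArg Prod.fst (timeMap_timeMap ha.ne' b z)).symm
    refine ⟨⟨?_, ?_⟩, hx⟩
    · rw [hz1]
      have : 0 < b := mul_pos (mul_pos hκ hT) hr.1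
      positivity
    · rw [hz1]
      have : b ≤ κ * Tend := mul_le_of_le_one_right (mul_pos hκ hT).le hr.2
      have := mul_lt_mul_of_pos_left t2 ha
      rw [ha'] at this ⊢
      linarith
  have key := h φ' c1 c2 c3
  rw [setIntegral_eq_integral_of_forall_compl_eq_zero fun z hz => by rw [zg z hz, zero_mul],
    setIntegral_eq_integral_of_forall_compl_eq_zero fun z hz => by
      rw [zv z hz, zτ z hz, zero_mul, inner_zero_left, add_zero]] at key
  have k1 : Integrable fun z => g z * φ' z :=
    mg.integrable_mul (c1.continuous.memLp_of_hasCompactSupport (p := 2) c2)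
  have k2 : Integrable fun z => ⟪τ z, gradX φ' z⟫_ℝ := integrable_inner_of_memLp mτ
    ((continuous_gradX c1).memLp_of_hasCompactSupport (compact_gradX c2))
  have k3 : Integrable fun z => v z * dt φ' z :=
    mv.integrable_mul ((continuous_dt c1).memLp_of_hasCompactSupport (p := 2) (compact_dt c2))
  rw [integral_add k3 k2] at key
  have key2 : ∫ z, (g z * φ' z + ⟪τ z, gradX φ' z⟫_ℝ) = - ∫ z, v z * dt φ' z := by
    rw [integral_add k1 k2, key]
    ring
  have t1 := integral_timeMap ha b fun z => g z * φ' z + ⟪τ z, gradX φ' z⟫_ℝ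
  have t2 := integral_timeMap ha b fun z => v z * dt φ' z
  have f1 : ∀ z, φ' (timeMap a b z) = φ z := fun z => by
    simp only [hφ', timeMap_timeMap' ha.ne']
  have f2 : ∀ z, gradX φ' (timeMap a b z) = gradX φ z := fun z => by
    rw [gradX_comp_timeMap _ _ h1, timeMap_timeMap' ha.ne']
  -- Only the time derivative feels the scaling; this produces the factor `1 - κ` in front of the
  -- averaged right-hand side.
  have f3 : ∀ z, dt φ' (timeMap a b z) = a⁻¹ * dt φ z := fun z => by
    rw [dt_comp_timeMap _ _ h1, timeMap_timeMap' ha.ne']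
  simp only [f1, f2, f3] at t1 t2
  rw [key2, smul_neg, ← t2] at t1
  have s1 : ∫ z, (⟪g (timeMap a b z), φ z⟫_ℝ + ⟪τ (timeMap a b z), gradX φ z⟫_ℝ) =
      ∫ z, (g (timeMap a b z) * φ z + ⟪τ (timeMap a b z), gradX φ z⟫_ℝ) := by
    simp [mul_comm]
  rw [s1, t1, mul_neg, ← integral_const_mul]
  refine congrArg Neg.neg (integral_congr_ae (Eventually.of_forall fun z => ?_))
  simp only [RCLike.inner_apply, conj_trivial]
  field_simp

end Difference

/-! ### Uniform estimate and the continuous representative -/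

section Estimate

variable {d : ℕ} {Tend : ℝ} {Ω : Set (Space d)}

/-- The real-valued `L²` seminorm. -/
noncomputable def l2norm {α F : Type*} [MeasurableSpace α] [NormedAddCommGroup F]
    (f : α → F) (μ : Measure α) : ℝ := (eLpNorm f 2 μ).toReal

section Seminorm

variable {α F : Type*} [MeasurableSpace α] [NormedAddCommGroup F] {μ : Measure α} {f g : α → F}

lemma l2norm_nonneg : 0 ≤ l2norm f μ := ENNReal.toReal_nonneg

lemma l2norm_sub_le (hf : MemLp f 2 μ) (hg : MemLp g 2 μ) :
    l2norm (f - g) μ ≤ l2norm f μ + l2norm g μ := by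
  rw [l2norm, l2norm, l2norm, ← ENNReal.toReal_add hf.2.ne hg.2.ne]
  exact ENNReal.toReal_mono (ENNReal.add_ne_top.2 ⟨hf.2.ne, hg.2.ne⟩)
    (eLpNorm_sub_le hf.1 hg.1 (by norm_num))

lemma l2norm_const_smul [NormedSpace ℝ F] (c : ℝ) : l2norm (c • f) μ = |c| * l2norm f μ := by
  rw [l2norm, eLpNorm_const_smul, ENNReal.toReal_mul, l2norm]
  simp

lemma l2norm_mono_measure {ν : Measure α} (h : ν ≤ μ) (hf : MemLp f 2 μ) :
    l2norm f ν ≤ l2norm f μ :=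
  ENNReal.toReal_mono hf.2.ne (eLpNorm_mono_measure f h)

lemma l2norm_indicator_le {s : Set α} (hf : MemLp f 2 μ) :
    l2norm (s.indicator f) μ ≤ l2norm f μ :=
  ENNReal.toReal_mono hf.2.ne (eLpNorm_indicator_le f)

lemma abs_integral_inner_le [InnerProductSpace ℝ F] (hf : MemLp f 2 μ) (hg : MemLp g 2 μ) :
    |∫ z, ⟪f z, g z⟫_ℝ ∂μ| ≤ l2norm f μ * l2norm g μ := by
  rw [← inner_toLp hf hg, l2norm, l2norm, ← Lp.norm_toLp f hf, ← Lp.norm_toLp g hg]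
  exact abs_real_inner_le_norm _ _

lemma integral_sq_eq_l2norm {f : α → ℝ} (hf : MemLp f 2 μ) :
    ∫ z, f z ^ 2 ∂μ = l2norm f μ ^ 2 := by
  rw [l2norm, ← Lp.norm_toLp f hf, ← real_inner_self_eq_norm_sq, inner_toLp hf hf]
  simp [sq]

end Seminorm

lemma l2norm_timeAvg_le {F : Type*} [NormedAddCommGroup F] [NormedSpace ℝ F] {κ : ℝ}
    (hκ : κ ≤ 1 / 2) {q : SpaceTime d → F} (hq : StronglyMeasurable q) (mq : MemLp q 2 volume) :
    l2norm (timeAvg Tend κ q) volume ≤ 2 * l2norm q volume := by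
  have := ENNReal.toReal_mono (ENNReal.mul_ne_top (by simp) mq.2.ne)
    (eLpNorm_timeAvg_le (Tend := Tend) hκ hq)
  simpa [l2norm] using this

/-- Mere boundedness suffices for the data `g` and `τ`; the smallness in the energy estimate comes
from `v` and `σ`. Each average contributes at most `2 ‖q‖`. -/
lemma l2norm_smul_timeAvg_sub_le {F : Type*} [NormedAddCommGroup F] [NormedSpace ℝ F]
    {κ l : ℝ} (hκ0 : 0 < κ) (hκ : κ ≤ 1 / 2) (hl0 : 0 < l) (hl : l ≤ 1 / 2)
    {q : SpaceTime d → F} (hq : StronglyMeasurable q) (mq : MemLp q 2 volume) :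
    l2norm ((1 - κ) • timeAvg Tend κ q - (1 - l) • timeAvg Tend l q) volume ≤
      4 * l2norm q volume := by
  refine (l2norm_sub_le ((memLp_timeAvg hκ hq mq).const_smul _)
    ((memLp_timeAvg hl hq mq).const_smul _)).trans ?_
  rw [l2norm_const_smul, l2norm_const_smul, abs_of_pos (by linarith), abs_of_pos (by linarith)]
  have a1 := l2norm_timeAvg_le (Tend := Tend) hκ hq mq
  have a2 := l2norm_timeAvg_le (Tend := Tend) hl hq mq
  have b1 := l2norm_nonneg (f := timeAvg Tend κ q) (μ := volume)
  have b2 := l2norm_nonneg (f := timeAvg Tend l q) (μ := volume)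
  nlinarith

/-- The data of a pair `(v, τ) ∈ U₀`, extended by zero: `g` is the divergence of `(v, τ)` and `σ`
is the spatial gradient of `v`. -/
structure ZeroTraceData (Tend : ℝ) (Ω : Set (Space d)) (v : SpaceTime d → ℝ)
    (τ σ : SpaceTime d → Space d) (g : SpaceTime d → ℝ) : Prop where
  sv : StronglyMeasurable v
  sτ : StronglyMeasurable τ
  sσ : StronglyMeasurable σ
  sg : StronglyMeasurable g
  mv : MemLp v 2 volume
  mτ : MemLp τ 2 volume
  mσ : MemLp σ 2 volume
  mg : MemLp g 2 volume
  zv : ∀ z ∉ cylinder Tend Ω, v z = 0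
  zτ : ∀ z ∉ cylinder Tend Ω, τ z = 0
  zσ : ∀ z ∉ cylinder Tend Ω, σ z = 0
  zg : ∀ z ∉ cylinder Tend Ω, g z = 0
  div : HasWeakDiv (cylinder Tend Ω) v τ g
  grad : HasZeroTraceGrad (cylinder Tend Ω) v σ

variable {v g : SpaceTime d → ℝ} {τ σ : SpaceTime d → Space d}

/-- The difference `E` of the time derivatives equals `g' - divₓ τ'` weakly. Green's formula with
the time-truncated `w` moves the divergence onto `w`, and Cauchy–Schwarz bounds the two resulting
terms. -/
lemma ZeroTraceData.abs_integral_timeDiff_mul_le (D : ZeroTraceData Tend Ω v τ σ g)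
    (hT : 0 < Tend) (hΩ : IsBoundedLipschitzDomain Ω) {κ l : ℝ} (hκ0 : 0 < κ) (hκ : κ ≤ 1 / 2)
    (hl0 : 0 < l) (hl : l ≤ 1 / 2) {s t : ℝ} (hs : 0 ≤ s) (ht : t ≤ Tend) :
    |∫ z in Ioo s t ×ˢ Ω, (timeDiff Tend κ v - timeDiff Tend l v) z *
      (timeAvg Tend κ v - timeAvg Tend l v) z| ≤
    4 * l2norm g volume * l2norm (timeAvg Tend κ v - timeAvg Tend l v) volume +
      4 * l2norm τ volume * l2norm (timeAvg Tend κ σ - timeAvg Tend l σ) volume := by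
  have hQ := hΩ.isOpen_cylinder (Tend := Tend)
  have hb := hΩ.isBounded_cylinder (Tend := Tend)
  set Q := cylinder Tend Ω with hQdef
  set E := timeDiff Tend κ v - timeDiff Tend l v with hE
  set w := timeAvg Tend κ v - timeAvg Tend l v with hw
  set ζ := timeAvg Tend κ σ - timeAvg Tend l σ with hζ
  set g' := (1 - κ) • timeAvg Tend κ g - (1 - l) • timeAvg Tend l g with hg'
  set τ' := (1 - κ) • timeAvg Tend κ τ - (1 - l) • timeAvg Tend l τ with hτ'
  have mE : MemLp E 2 volume :=
    (memLp_timeDiff (by linarith) D.mv).sub (memLp_timeDiff (by linarith) D.mv)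
  have mw : MemLp w 2 volume := (memLp_timeAvg hκ D.sv D.mv).sub (memLp_timeAvg hl D.sv D.mv)
  have mζ : MemLp ζ 2 volume := (memLp_timeAvg hκ D.sσ D.mσ).sub (memLp_timeAvg hl D.sσ D.mσ)
  have mg' : MemLp g' 2 volume := ((memLp_timeAvg hκ D.sg D.mg).const_smul _).sub
    ((memLp_timeAvg hl D.sg D.mg).const_smul _)
  have mτ' : MemLp τ' 2 volume := ((memLp_timeAvg hκ D.sτ D.mτ).const_smul _).sub
    ((memLp_timeAvg hl D.sτ D.mτ).const_smul _)
  set S : Set (SpaceTime d) := Prod.fst ⁻¹' Ioo s t with hS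
  have mS : MeasurableSet S := measurable_fst measurableSet_Ioo
  have mwS : MemLp (S.indicator w) 2 (volume.restrict Q) := (mw.indicator mS).restrict Q
  have mζS : MemLp (S.indicator ζ) 2 (volume.restrict Q) := (mζ.indicator mS).restrict Q
  have hgrad : HasZeroTraceGrad Q (S.indicator w) (S.indicator ζ) := by
    rw [hw, hζ, indicator_sub', indicator_sub']
    exact HasZeroTraceGrad.sub hQ hb
      (((memLp_timeAvg hκ D.sv D.mv).indicator mS).restrict Q)
      (((memLp_timeAvg hκ D.sσ D.mσ).indicator mS).restrict Q)
      (((memLp_timeAvg hl D.sv D.mv).indicator mS).restrict Q)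
      (((memLp_timeAvg hl D.sσ D.mσ).indicator mS).restrict Q)
      (D.grad.timeAvg hΩ.isOpen hΩ.isBounded hκ D.sv D.sσ D.mv D.mσ D.zv D.zσ measurableSet_Ioo)
      (D.grad.timeAvg hΩ.isOpen hΩ.isBounded hl D.sv D.sσ D.mv D.mσ D.zv D.zσ measurableSet_Ioo)
  -- The sharp cut-off at `s` and `t` is allowed because Green's formula involves only the spatial
  -- gradient of `S.indicator w`.
  have key := hgrad.green hQ hb (hΩ.segmentProperty_cylinder hT) (G := E - g') (Θ := -τ')
    ((mE.sub mg').restrict Q) (mτ'.neg.restrict Q) mwS mζS (fun φ h1 h2 h3 => by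
      have k1 := D.div.timeAvg hΩ.isOpen hT hκ0 hκ D.sv D.sτ D.sg D.mv D.mτ D.mg D.zv D.zτ D.zg
        h1 h2 h3
      have k2 := D.div.timeAvg hΩ.isOpen hT hl0 hl D.sv D.sτ D.sg D.mv D.mτ D.mg D.zv D.zτ D.zg
        h1 h2 h3
      have mφ : MemLp φ 2 volume := h1.continuous.memLp_of_hasCompactSupport h2
      have mφx : MemLp (gradX φ) 2 volume :=
        (continuous_gradX h1).memLp_of_hasCompactSupport (compact_gradX h2)
      have i1 : Integrable (fun z => timeDiff Tend κ v z * φ z) :=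
        (memLp_timeDiff (by linarith) D.mv).integrable_mul mφ
      have i2 : Integrable (fun z => timeDiff Tend l v z * φ z) :=
        (memLp_timeDiff (by linarith) D.mv).integrable_mul mφ
      have i3 := integrable_const_mul_inner_add (memLp_timeAvg (Tend := Tend) hκ D.sg D.mg)
        (memLp_timeAvg (Tend := Tend) hκ D.sτ D.mτ) mφ mφx
      have i4 := integrable_const_mul_inner_add (memLp_timeAvg (Tend := Tend) hl D.sg D.mg)
        (memLp_timeAvg (Tend := Tend) hl D.sτ D.mτ) mφ mφx
      rw [setIntegral_eq_integral_of_forall_compl_eq_zero]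
      · have e : ∀ z, (E - g') z * φ z + ⟪(-τ') z, gradX φ z⟫_ℝ =
            (timeDiff Tend κ v z * φ z - timeDiff Tend l v z * φ z) -
            ((1 - κ) * (timeAvg Tend κ g z * φ z + ⟪timeAvg Tend κ τ z, gradX φ z⟫_ℝ) -
            (1 - l) * (timeAvg Tend l g z * φ z + ⟪timeAvg Tend l τ z, gradX φ z⟫_ℝ)) := by
          intro z
          simp only [hE, hg', hτ', Pi.sub_apply, Pi.neg_apply, Pi.smul_apply, inner_neg_left,
            inner_sub_left, real_inner_smul_left, smul_eq_mul]
          ring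
        have i12 : Integrable (fun z => timeDiff Tend κ v z * φ z - timeDiff Tend l v z * φ z) :=
          i1.sub i2
        have i34 : Integrable (fun z =>
            (1 - κ) * (timeAvg Tend κ g z * φ z + ⟪timeAvg Tend κ τ z, gradX φ z⟫_ℝ) -
            (1 - l) * (timeAvg Tend l g z * φ z + ⟪timeAvg Tend l τ z, gradX φ z⟫_ℝ)) :=
          (i3.const_mul _).sub (i4.const_mul _)
        simp only [e]
        rw [integral_sub i12 i34, integral_sub i1 i2,
          integral_sub (i3.const_mul _) (i4.const_mul _), k1, k2, integral_const_mul,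
          integral_const_mul, sub_self]
      · intro z hz
        have hz' : z ∉ tsupport φ := fun h => hz (h3 h)
        have h0 : gradX φ z = 0 := by
          ext i
          rw [gradX, (notMem_tsupport_iff_eventuallyEq.1 hz').fderiv_eq]
          simp
        rw [image_eq_zero_of_notMem_tsupport hz', h0, mul_zero, inner_zero_right, add_zero])
  have j1 : Integrable (fun z => E z * S.indicator w z) (volume.restrict Q) :=
    (mE.restrict Q).integrable_mul mwS
  have j2 : Integrable (fun z => ⟪g' z, S.indicator w z⟫_ℝ) (volume.restrict Q) :=
    integrable_inner_of_memLp (mg'.restrict Q) mwS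
  have j3 : Integrable (fun z => ⟪τ' z, S.indicator ζ z⟫_ℝ) (volume.restrict Q) :=
    integrable_inner_of_memLp (mτ'.restrict Q) mζS
  have e1 : ∫ z in Ioo s t ×ˢ Ω, E z * w z = ∫ z in Q, E z * S.indicator w z := by
    have h1 : Ioo s t ×ˢ Ω = S ∩ Q := by
      ext z
      constructor
      · rintro ⟨hz1, hz2⟩
        exact ⟨hz1, ⟨hs.trans_lt hz1.1, hz1.2.trans_le ht⟩, hz2⟩
      · rintro ⟨hz1, _, hz2⟩
        exact ⟨hz1, hz2⟩
    rw [h1, ← Measure.restrict_restrict mS, ← integral_indicator mS]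
    refine integral_congr_ae (Eventually.of_forall fun z => ?_)
    by_cases hz : z ∈ S <;> simp [hz]
  have e2 : ∫ z in Q, E z * S.indicator w z =
      (∫ z in Q, ⟪g' z, S.indicator w z⟫_ℝ) + ∫ z in Q, ⟪τ' z, S.indicator ζ z⟫_ℝ := by
    have j23 : Integrable (fun z => ⟪g' z, S.indicator w z⟫_ℝ + ⟪τ' z, S.indicator ζ z⟫_ℝ)
        (volume.restrict Q) := j2.add j3
    rw [← integral_add j2 j3, ← sub_eq_zero, ← integral_sub j1 j23, ← key]
    refine integral_congr_ae (Eventually.of_forall fun z => ?_)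
    simp only [Pi.sub_apply, Pi.neg_apply, inner_neg_left, RCLike.inner_apply, conj_trivial]
    ring
  rw [e1, e2]
  refine (abs_add_le _ _).trans (add_le_add ?_ ?_)
  · refine (abs_integral_inner_le (mg'.restrict Q) mwS).trans
      (mul_le_mul ?_ ?_ l2norm_nonneg (mul_nonneg (by norm_num) l2norm_nonneg))
    · exact (l2norm_mono_measure Measure.restrict_le_self mg').trans
        (l2norm_smul_timeAvg_sub_le hκ0 hκ hl0 hl D.sg D.mg)
    · exact (l2norm_indicator_le (mw.restrict Q)).trans
        (l2norm_mono_measure Measure.restrict_le_self mw)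
  · refine (abs_integral_inner_le (mτ'.restrict Q) mζS).trans
      (mul_le_mul ?_ ?_ l2norm_nonneg (mul_nonneg (by norm_num) l2norm_nonneg))
    · exact (l2norm_mono_measure Measure.restrict_le_self mτ').trans
        (l2norm_smul_timeAvg_sub_le hκ0 hκ hl0 hl D.sτ D.mτ)
    · exact (l2norm_indicator_le (mζ.restrict Q)).trans
        (l2norm_mono_measure Measure.restrict_le_self mζ)

/-- The `L²(Ω)`-valued curve `t ↦ timeAvg Tend κ v (t, ·)`. -/
noncomputable def avgCurve (Ω : Set (Space d)) (hT : 0 < Tend) {κ : ℝ} (hκ : 0 < κ)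
    (sv : StronglyMeasurable v) (mv : MemLp v 2 volume) (t : ℝ) : L2Space Ω :=
  ((memLp_slice_timeAvg hT hκ sv mv t).restrict Ω).toLp _

/-- A bound uniform in `t` which tends to zero with `δ` and `ε`; this is the Cauchy property of the
averaged curves. -/
lemma ZeroTraceData.norm_avgCurve_sub_sq_le (D : ZeroTraceData Tend Ω v τ σ g)
    (hT : 0 < Tend) (hΩ : IsBoundedLipschitzDomain Ω) {κ l : ℝ} (hκ0 : 0 < κ) (hκ : κ ≤ 1 / 2)
    (hl0 : 0 < l) (hl : l ≤ 1 / 2) {t : ℝ} (ht : t ∈ Icc 0 Tend) {δ ε : ℝ}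
    (hδ : l2norm (timeAvg Tend κ v - timeAvg Tend l v) volume ≤ δ)
    (hε : l2norm (timeAvg Tend κ σ - timeAvg Tend l σ) volume ≤ ε) :
    Tend * ‖avgCurve Ω hT hκ0 D.sv D.mv t - avgCurve Ω hT hl0 D.sv D.mv t‖ ^ 2 ≤
      δ ^ 2 + 2 * Tend * (4 * l2norm g volume * δ + 4 * l2norm τ volume * ε) := by
  have m1 := (memLp_slice_timeAvg hT hκ0 D.sv D.mv t).restrict Ω
  have m2 := (memLp_slice_timeAvg hT hl0 D.sv D.mv t).restrict Ω
  have mE : MemLp (timeDiff Tend κ v - timeDiff Tend l v) 2 volume :=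
    (memLp_timeDiff (by linarith) D.mv).sub (memLp_timeDiff (by linarith) D.mv)
  have mw : MemLp (timeAvg Tend κ v - timeAvg Tend l v) 2 volume :=
    (memLp_timeAvg hκ D.sv D.mv).sub (memLp_timeAvg hl D.sv D.mv)
  have hp : IsTimePrimitive (timeAvg Tend κ v - timeAvg Tend l v)
      (timeDiff Tend κ v - timeDiff Tend l v) :=
    (isTimePrimitive_timeAvg hT hκ0 (by linarith) (ae_integrable_slice D.sv D.mv D.zv)).sub
      (isTimePrimitive_timeAvg hT hl0 (by linarith) (ae_integrable_slice D.sv D.mv D.zv))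
  have key := hp.mul_integral_sq_le mw mE (fun s => (memLp_slice_timeAvg hT hκ0 D.sv D.mv s).sub
    (memLp_slice_timeAvg hT hl0 D.sv D.mv s)) Ω hT
    (fun s t hs _ ht => D.abs_integral_timeDiff_mul_le hT hΩ hκ0 hκ hl0 hl hs ht) ht
  have e : ‖avgCurve Ω hT hκ0 D.sv D.mv t - avgCurve Ω hT hl0 D.sv D.mv t‖ ^ 2 =
      ∫ x in Ω, (timeAvg Tend κ v - timeAvg Tend l v) (t, x) ^ 2 := by
    rw [avgCurve, avgCurve, ← MemLp.toLp_sub m1 m2, Lp.norm_toLp]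
    exact (integral_sq_eq_l2norm (m1.sub m2)).symm
  rw [e]
  refine key.trans ?_
  rw [integral_sq_eq_l2norm mw]
  have n1 := l2norm_nonneg (f := g) (μ := volume)
  have n2 := l2norm_nonneg (f := τ) (μ := volume)
  have n3 := l2norm_nonneg (f := timeAvg Tend κ v - timeAvg Tend l v) (μ := volume)
  gcongr

lemma continuous_avgCurve (hT : 0 < Tend) {κ : ℝ} (hκ : 0 < κ) (hκ1 : κ < 1)
    (sv : StronglyMeasurable v) (mv : MemLp v 2 volume)
    (zv : ∀ z ∉ cylinder Tend Ω, v z = 0) : Continuous (avgCurve Ω hT hκ sv mv) := by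
  set M := l2norm (timeDiff Tend κ v) volume with hM
  have hp := isTimePrimitive_timeAvg hT hκ hκ1 (ae_integrable_slice sv mv zv)
  have mE := memLp_timeDiff (Tend := Tend) hκ1 mv
  have main : ∀ s t, s ≤ t → dist (avgCurve Ω hT hκ sv mv t) (avgCurve Ω hT hκ sv mv s) ≤
      √|t - s| * M := by
    intro s t hst
    have m1 := (memLp_slice_timeAvg hT hκ sv mv t).restrict Ω
    have m2 := (memLp_slice_timeAvg hT hκ sv mv s).restrict Ω
    have h1 := hp.lintegral_sub_le (stronglyMeasurable_timeDiff sv) hst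
    rw [dist_eq_norm, avgCurve, avgCurve, ← MemLp.toLp_sub m1 m2, Lp.norm_toLp]
    refine le_of_sq_le_sq ?_ (mul_nonneg (Real.sqrt_nonneg _) l2norm_nonneg)
    rw [mul_pow, Real.sq_sqrt (abs_nonneg _), abs_of_nonneg (sub_nonneg.2 hst), hM, l2norm,
      ← ENNReal.toReal_pow, ← ENNReal.toReal_pow, ← ENNReal.toReal_ofReal (sub_nonneg.2 hst),
      ← ENNReal.toReal_mul]
    refine ENNReal.toReal_mono (ENNReal.mul_ne_top ENNReal.ofReal_ne_top
      (ENNReal.pow_ne_top mE.2.ne)) ?_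
    refine le_trans ?_ h1
    rw [eLpNorm_two_sq]
    exact lintegral_mono' Measure.restrict_le_self le_rfl
  have main' : ∀ s t, dist (avgCurve Ω hT hκ sv mv t) (avgCurve Ω hT hκ sv mv s) ≤
      √|t - s| * M := by
    intro s t
    rcases le_total s t with h | h
    · exact main s t h
    · rw [dist_comm, abs_sub_comm]
      exact main t s h
  rw [continuous_iff_continuousAt]
  intro s
  rw [ContinuousAt, tendsto_iff_dist_tendsto_zero]
  refine squeeze_zero (fun _ => dist_nonneg) (main' s) ?_
  have hc : Continuous fun t : ℝ => √|t - s| * M := by fun_prop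
  simpa using hc.tendsto s

lemma ZeroTraceData.uniformCauchySeqOn_avgCurve (D : ZeroTraceData Tend Ω v τ σ g)
    (hT : 0 < Tend) (hΩ : IsBoundedLipschitzDomain Ω) {κ : ℕ → ℝ} (h0 : ∀ n, 0 < κ n)
    (h1 : ∀ n, κ n ≤ 1 / 2) (h2 : Tendsto κ atTop (𝓝 0)) :
    UniformCauchySeqOn (fun n => avgCurve Ω hT (h0 n) D.sv D.mv) atTop (Icc 0 Tend) := by
  have hκ : Tendsto κ atTop (𝓝[>] 0) :=
    tendsto_nhdsWithin_iff.2 ⟨h2, Eventually.of_forall h0⟩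
  have conv : ∀ {F : Type} [NormedAddCommGroup F] [NormedSpace ℝ F] [CompleteSpace F]
      {q : SpaceTime d → F}, StronglyMeasurable q → MemLp q 2 volume →
      Tendsto (fun p : ℕ × ℕ => l2norm (timeAvg Tend (κ p.1) q - q) volume +
        l2norm (timeAvg Tend (κ p.2) q - q) volume) (atTop ×ˢ atTop) (𝓝 0) ∧
      ∀ n m, l2norm (timeAvg Tend (κ n) q - timeAvg Tend (κ m) q) volume ≤
        l2norm (timeAvg Tend (κ n) q - q) volume + l2norm (timeAvg Tend (κ m) q - q) volume := by
    intro F _ _ _ q sq mq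
    have t1 : Tendsto (fun n => l2norm (timeAvg Tend (κ n) q - q) volume) atTop (𝓝 0) := by
      have := (ENNReal.tendsto_toReal ENNReal.zero_ne_top).comp
        ((tendsto_timeAvg Tend sq mq).comp hκ)
      simpa [l2norm, Function.comp_def] using this
    refine ⟨by simpa using (t1.comp tendsto_fst).add (t1.comp tendsto_snd), fun n m => ?_⟩
    have e : timeAvg Tend (κ n) q - timeAvg Tend (κ m) q =
        (timeAvg Tend (κ n) q - q) - (timeAvg Tend (κ m) q - q) := by abel
    rw [e]
    exact l2norm_sub_le ((memLp_timeAvg (h1 n) sq mq).sub mq)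
      ((memLp_timeAvg (h1 m) sq mq).sub mq)
  obtain ⟨v1, v2⟩ := conv D.sv D.mv
  obtain ⟨s1, s2⟩ := conv D.sσ D.mσ
  have hΦ := ((v1.pow 2).add (((v1.const_mul (4 * l2norm g volume)).add
    (s1.const_mul (4 * l2norm τ volume))).const_mul (2 * Tend)))
  simp only [mul_zero, add_zero, ne_eq, OfNat.ofNat_ne_zero, not_false_eq_true, zero_pow] at hΦ
  -- The bound of the preceding estimate tends to zero and does not depend on `t`; it is made
  -- smaller than `Tend ε²`.
  intro u hu
  obtain ⟨ε, hε, hεu⟩ := Metric.mem_uniformity_dist.1 hu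
  have hev := hΦ.eventually (gt_mem_nhds (show 0 < Tend * ε ^ 2 by positivity))
  filter_upwards [hev] with p hp t ht
  refine hεu ?_
  have := D.norm_avgCurve_sub_sq_le hT hΩ (h0 p.1) (h1 p.1) (h0 p.2) (h1 p.2) ht
    (v2 p.1 p.2) (s2 p.1 p.2)
  rw [dist_eq_norm]
  exact lt_of_pow_lt_pow_left₀ 2 hε.le (lt_of_mul_lt_mul_left (this.trans_lt hp) hT.le)

/-- A function in `U₀` has a representative in `C([0, Tend]; L²(Ω))`. -/
theorem ZeroTraceData.exists_continuous_representative (D : ZeroTraceData Tend Ω v τ σ g)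
    (hT : 0 < Tend) (hΩ : IsBoundedLipschitzDomain Ω) :
    ∃ V : ℝ → L2Space Ω, ContinuousOn V (Icc 0 Tend) ∧
      ∀ᵐ t ∂(volume.restrict (Ioo 0 Tend)),
        (fun x => v (t, x)) =ᵐ[volume.restrict Ω] (V t : Space d → ℝ) := by
  -- The shift by two gives `κ n ≤ 1/2`, as all bounds on the averages require.
  set κ : ℕ → ℝ := fun n => 1 / ((n : ℝ) + 1 + 1) with hκdef
  have h0 : ∀ n, 0 < κ n := fun n => by positivity
  have h1 : ∀ n, κ n ≤ 1 / 2 := fun n => by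
    refine one_div_le_one_div_of_le (by norm_num) ?_
    have : (0 : ℝ) ≤ n := Nat.cast_nonneg n
    linarith
  have h2 : Tendsto κ atTop (𝓝 0) := by
    have := (tendsto_add_atTop_iff_nat 1).2 (tendsto_one_div_add_atTop_nhds_zero_nat (𝕜 := ℝ))
    simpa [hκdef] using this
  have hC := D.uniformCauchySeqOn_avgCurve hT hΩ h0 h1 h2
  have hlim : ∀ t ∈ Icc 0 Tend, ∃ y : L2Space Ω,
      Tendsto (fun n => avgCurve Ω hT (h0 n) D.sv D.mv t) atTop (𝓝 y) := fun t ht =>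
    cauchySeq_tendsto_of_complete (hC.cauchySeq ht)
  choose! V hV using hlim
  have hU := hC.tendstoUniformlyOn_of_tendsto hV
  refine ⟨V, hU.continuousOn (Eventually.of_forall fun n =>
    (continuous_avgCurve hT (h0 n) (by linarith [h1 n]) D.sv D.mv D.zv).continuousOn).frequently, ?_⟩
  set a : ℕ → ℝ → ENNReal := fun n t =>
    ∫⁻ x in Ω, ‖timeAvg Tend (κ n) v (t, x) - v (t, x)‖ₑ ^ 2 with ha
  have sm : ∀ n, StronglyMeasurable (timeAvg Tend (κ n) v - v) := fun n =>
    (stronglyMeasurable_timeAvg D.sv).sub D.sv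
  have ma : ∀ n, Measurable (a n) := fun n =>
    (show Measurable fun z => ‖(timeAvg Tend (κ n) v - v) z‖ₑ ^ 2 from
      (sm n).enorm.pow_const 2).lintegral_prod_right'
  have hint : ∀ n, ∫⁻ t in Ioo 0 Tend, a n t ≤
      eLpNorm (timeAvg Tend (κ n) v - v) 2 volume ^ 2 := by
    intro n
    have hm : Measurable fun z => ‖(timeAvg Tend (κ n) v - v) z‖ₑ ^ 2 :=
      (sm n).enorm.pow_const 2
    rw [eLpNorm_two_sq]
    refine le_trans (le_of_eq ?_) (lintegral_mono' (Measure.restrict_le_self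
      (s := Ioo 0 Tend ×ˢ Ω)) le_rfl)
    rw [Measure.volume_eq_prod, ← Measure.prod_restrict, lintegral_prod _ hm.aemeasurable]
    rfl
  -- Fatou's lemma. At almost every time a subsequence of the averages converges to `v (t, ·)`, and
  -- that is enough since the whole sequence converges to `V t`.
  have hz : ∫⁻ t in Ioo 0 Tend, liminf (fun n => a n t) atTop = 0 := by
    refine le_antisymm ((lintegral_liminf_le ma).trans ?_) bot_le
    have t1 : Tendsto (fun n => eLpNorm (timeAvg Tend (κ n) v - v) 2 volume ^ 2) atTop (𝓝 0) := by
      have := ((ENNReal.continuous_pow 2).tendsto 0).comp ((tendsto_timeAvg Tend D.sv D.mv).comp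
        (tendsto_nhdsWithin_iff.2 ⟨h2, Eventually.of_forall h0⟩))
      simpa [Function.comp_def] using this
    rw [← t1.liminf_eq]
    exact liminf_le_liminf (Eventually.of_forall hint)
  rw [lintegral_eq_zero_iff (Measurable.liminf ma)] at hz
  filter_upwards [hz, ae_restrict_mem measurableSet_Ioo] with t ht htI
  have hVt := hV t ⟨htI.1.le, htI.2.le⟩
  have mt : AEStronglyMeasurable (fun x => v (t, x)) (volume.restrict Ω) :=
    (D.sv.comp_measurable (g := fun x => (t, x)) (by fun_prop)).aestronglyMeasurable
  have key : eLpNorm (fun x => v (t, x) - V t x) 2 (volume.restrict Ω) ≤ 0 := by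
    refine ENNReal.le_of_forall_pos_le_add fun ε hε _ => ?_
    rw [zero_add]
    have hε' : (0 : ENNReal) < ε / 2 := ENNReal.div_pos (by simpa using hε.ne') (by norm_num)
    have f1 : ∃ᶠ n in atTop, a n t < (ε / 2 : ENNReal) ^ 2 := by
      refine frequently_lt_of_liminf_lt (by isBoundedDefault) ?_
      rw [ht]
      exact ENNReal.pow_pos hε' 2
    have f2 : ∀ᶠ n in atTop, eLpNorm ((avgCurve Ω hT (h0 n) D.sv D.mv t : Space d → ℝ) -
        (V t : Space d → ℝ)) 2 (volume.restrict Ω) < ε / 2 :=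
      ((Lp.tendsto_Lp_iff_tendsto_eLpNorm' _ _).1 hVt).eventually (gt_mem_nhds hε')
    obtain ⟨n, hn1, hn2⟩ := (f1.and_eventually f2).exists
    have mn := (memLp_slice_timeAvg hT (h0 n) D.sv D.mv t).restrict Ω
    have hc : (avgCurve Ω hT (h0 n) D.sv D.mv t : Space d → ℝ) =ᵐ[volume.restrict Ω]
        fun x => timeAvg Tend (κ n) v (t, x) := mn.coeFn_toLp
    have b1 : eLpNorm (fun x => timeAvg Tend (κ n) v (t, x) - v (t, x)) 2 (volume.restrict Ω) ≤
        ε / 2 := by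
      rw [eLpNorm_two_le_iff]
      exact hn1.le
    have e : (fun x => v (t, x) - V t x) =ᵐ[volume.restrict Ω]
        ((avgCurve Ω hT (h0 n) D.sv D.mv t : Space d → ℝ) - (V t : Space d → ℝ)) -
          fun x => timeAvg Tend (κ n) v (t, x) - v (t, x) := by
      filter_upwards [hc] with x hx
      simp only [Pi.sub_apply, hx]
      ring
    rw [eLpNorm_congr_ae e]
    calc _ ≤ eLpNorm ((avgCurve Ω hT (h0 n) D.sv D.mv t : Space d → ℝ) - (V t : Space d → ℝ)) 2
          (volume.restrict Ω) + eLpNorm (fun x => timeAvg Tend (κ n) v (t, x) - v (t, x)) 2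
          (volume.restrict Ω) :=
        eLpNorm_sub_le ((Lp.aestronglyMeasurable _).sub (Lp.aestronglyMeasurable _))
          (mn.1.sub mt) (by norm_num)
      _ ≤ ε / 2 + ε / 2 := add_le_add hn2.le b1
      _ = ε := ENNReal.add_halves _
  have h3 := (eLpNorm_eq_zero_iff (mt.sub (Lp.aestronglyMeasurable (V t))) (by norm_num)).1
    (le_antisymm key bot_le)
  filter_upwards [h3] with x hx
  exact sub_eq_zero.1 hx

end Estimate

/-! ### The initial trace -/

section Trace

variable {d : ℕ} {Tend : ℝ} {Ω : Set (Space d)}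

/-- Continuous curves that agree at almost every time agree on the closed interval, in particular at
`0`. -/
lemma HasInitialTrace.unique (hT : 0 < Tend) {v : L2 (cylinder Tend Ω)} {g g' : L2Space Ω}
    (h : HasInitialTrace v g) (h' : HasInitialTrace v g') : g = g' := by
  obtain ⟨V, V1, V2, rfl⟩ := h
  obtain ⟨V', V1', V2', rfl⟩ := h'
  have hae : V =ᵐ[volume.restrict (Icc 0 Tend)] V' := by
    rw [← Measure.restrict_congr_set Ioo_ae_eq_Icc]
    filter_upwards [V2, V2'] with t h1 h2
    exact Lp.ext (h1.symm.trans h2)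
  exact Measure.eqOn_of_ae_eq hae V1 V1' (by rw [interior_Icc, closure_Ioo hT.ne])
    (left_mem_Icc.2 hT.le)

lemma ae_slice {p : SpaceTime d → Prop} (h : ∀ᵐ z ∂volume.restrict (cylinder Tend Ω), p z) :
    ∀ᵐ t ∂volume.restrict (Ioo 0 Tend), ∀ᵐ x ∂volume.restrict Ω, p (t, x) := by
  rw [restrict_cylinder] at h
  exact Measure.ae_ae_of_ae_prod h

lemma integral_cylinder {f : SpaceTime d → ℝ}
    (hf : Integrable f (volume.restrict (cylinder Tend Ω))) :
    ∫ z in cylinder Tend Ω, f z = ∫ t in Ioo 0 Tend, ∫ x in Ω, f (t, x) := by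
  rw [restrict_cylinder] at hf ⊢
  exact integral_prod f hf

lemma integrable_integral_cylinder_slice {f : SpaceTime d → ℝ}
    (hf : Integrable f (volume.restrict (cylinder Tend Ω))) :
    Integrable (fun t => ∫ x in Ω, f (t, x)) (volume.restrict (Ioo 0 Tend)) := by
  rw [restrict_cylinder] at hf
  exact hf.integral_prod_left

lemma ae_integrable_cylinder_slice {f : SpaceTime d → ℝ}
    (hf : Integrable f (volume.restrict (cylinder Tend Ω))) :
    ∀ᵐ t ∂volume.restrict (Ioo 0 Tend), Integrable (fun x => f (t, x)) (volume.restrict Ω) := by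
  rw [restrict_cylinder] at hf
  exact hf.prod_right_ae

lemma HasInitialTrace.add {v v' : L2 (cylinder Tend Ω)} {g g' : L2Space Ω}
    (h : HasInitialTrace v g) (h' : HasInitialTrace v' g') :
    HasInitialTrace (v + v') (g + g') := by
  obtain ⟨V, V1, V2, rfl⟩ := h
  obtain ⟨V', V1', V2', rfl⟩ := h'
  refine ⟨V + V', V1.add V1', ?_, rfl⟩
  filter_upwards [V2, V2', ae_slice (Lp.coeFn_add v v')] with t h1 h2 h3
  filter_upwards [h1, h2, h3, Lp.coeFn_add (V t) (V' t)] with x a b c e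
  rw [Pi.add_apply, e, c, Pi.add_apply, Pi.add_apply, a, b]

lemma gamma0_eq (hT : 0 < Tend) {v : L2Pair (cylinder Tend Ω)} {g : L2Space Ω}
    (h : HasInitialTrace v.fst g) : gamma0 v = g := by
  have hex : ∃ g : L2Space Ω, HasInitialTrace v.fst g := ⟨g, h⟩
  rw [gamma0, dif_pos hex]
  exact hex.choose_spec.unique hT h

/-- The mesh whose only cell is `Q`. -/
def Mesh.trivial {Q : Set (SpaceTime d)} (hQ : IsOpen Q) (hne : Q.Nonempty) : Mesh Q where
  cells := {Q}
  isOpen K hK := by rwa [Finset.mem_singleton.1 hK]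
  nonempty K hK := by rwa [Finset.mem_singleton.1 hK]
  subset K hK := by rw [Finset.mem_singleton.1 hK]
  disjoint := by simp
  covers := by simp

lemma mem_brokenSpace_trivial {Q : Set (SpaceTime d)} (hQ : IsOpen Q) (hne : Q.Nonempty)
    {v : L2Pair Q} (hv : v ∈ spaceU Q) : v ∈ brokenSpace (Mesh.trivial hQ hne) := by
  intro K hK
  rw [Finset.mem_singleton.1 hK]
  exact hv

lemma hasWeakDiv_cellDiv {Q : Set (SpaceTime d)} (hQ : IsOpen Q) (hne : Q.Nonempty)
    {v : L2Pair Q} (hv : v ∈ spaceU Q) : HasWeakDiv Q v.fst v.snd (cellDiv {Q} v) :=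
  cellDiv_spec (Mesh.trivial hQ hne) (mem_brokenSpace_trivial hQ hne hv) Q
    (Finset.mem_singleton_self Q)

lemma HasZeroTraceGrad.congr {Q : Set (SpaceTime d)} {v v' : SpaceTime d → ℝ}
    {σ σ' : SpaceTime d → Space d} (h : HasZeroTraceGrad Q v σ)
    (hv : v =ᵐ[volume.restrict Q] v') (hσ : σ =ᵐ[volume.restrict Q] σ') :
    HasZeroTraceGrad Q v' σ' := by
  intro χ hχ
  have e1 : ∫ z in Q, ⟪σ' z, χ z⟫_ℝ = ∫ z in Q, ⟪σ z, χ z⟫_ℝ := by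
    refine integral_congr_ae ?_
    filter_upwards [hσ] with z a
    simp only [a]
  have e2 : ∫ z in Q, v' z * divX χ z = ∫ z in Q, v z * divX χ z := by
    refine integral_congr_ae ?_
    filter_upwards [hv] with z a
    simp only [a]
  rw [e1, e2, h χ hχ]

lemma IsBoundedLipschitzDomain.nonempty_cylinder (hΩ : IsBoundedLipschitzDomain Ω)
    (hT : 0 < Tend) : (cylinder Tend Ω).Nonempty :=
  (nonempty_Ioo.2 hT).prod hΩ.nonempty

/-- The zero extensions of `v`, `τ` and their weak derivatives supply the data for the continuous
representative. -/
lemma exists_hasInitialTrace (hT : 0 < Tend) (hΩ : IsBoundedLipschitzDomain Ω)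
    {v : L2Pair (cylinder Tend Ω)} (hv : v ∈ spaceU0 (cylinder Tend Ω)) :
    ∃ g : L2Space Ω, HasInitialTrace v.fst g := by
  have hQ := hΩ.isOpen_cylinder (Tend := Tend)
  have hm := hQ.measurableSet
  have hdiv := hasWeakDiv_cellDiv hQ (hΩ.nonempty_cylinder hT) hv.1
  have hgrad : HasZeroTraceGrad (cylinder Tend Ω) v.fst (cellGrad {cylinder Tend Ω} v) := hv.2
  have ae1 : ∀ {F : Type} [NormedAddCommGroup F] (f : SpaceTime d → F),
      f =ᵐ[volume.restrict (cylinder Tend Ω)] (cylinder Tend Ω).indicator f := fun f => (indicator_ae_eq_restrict hm).symm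
  have D : ZeroTraceData Tend Ω ((cylinder Tend Ω).indicator v.fst) ((cylinder Tend Ω).indicator v.snd)
      ((cylinder Tend Ω).indicator (cellGrad {cylinder Tend Ω} v)) ((cylinder Tend Ω).indicator (cellDiv {cylinder Tend Ω} v)) :=
    { sv := (Lp.stronglyMeasurable _).indicator hm
      sτ := (Lp.stronglyMeasurable _).indicator hm
      sσ := (Lp.stronglyMeasurable _).indicator hm
      sg := (Lp.stronglyMeasurable _).indicator hm
      mv := (memLp_indicator_iff_restrict hm).2 (Lp.memLp _)
      mτ := (memLp_indicator_iff_restrict hm).2 (Lp.memLp _)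
      mσ := (memLp_indicator_iff_restrict hm).2 (Lp.memLp _)
      mg := (memLp_indicator_iff_restrict hm).2 (Lp.memLp _)
      zv := fun z hz => indicator_of_notMem hz _
      zτ := fun z hz => indicator_of_notMem hz _
      zσ := fun z hz => indicator_of_notMem hz _
      zg := fun z hz => indicator_of_notMem hz _
      div := hdiv.congr (ae1 _) (ae1 _) (ae1 _)
      grad := hgrad.congr (ae1 _) (ae1 _) }
  obtain ⟨V, V1, V2⟩ := D.exists_continuous_representative hT hΩ
  refine ⟨V 0, V, V1, ?_, rfl⟩
  filter_upwards [V2, ae_restrict_mem measurableSet_Ioo] with t h1 ht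
  filter_upwards [h1, ae_restrict_mem hΩ.isOpen.measurableSet] with x h2 hx
  rw [← h2, indicator_of_mem (show (t, x) ∈ cylinder Tend Ω from ⟨ht, hx⟩)]

lemma hasInitialTrace_gamma0 (hT : 0 < Tend) (hΩ : IsBoundedLipschitzDomain Ω)
    {v : L2Pair (cylinder Tend Ω)} (hv : v ∈ spaceU0 (cylinder Tend Ω)) :
    HasInitialTrace v.fst (gamma0 v) := by
  obtain ⟨g, hg⟩ := exists_hasInitialTrace hT hΩ hv
  rwa [gamma0_eq hT hg]

lemma dt_mul_of_prod {θ : ℝ → ℝ} {ψ : Space d → ℝ} (h1 : ContDiff ℝ ∞ θ) (h2 : ContDiff ℝ ∞ ψ)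
    (z : SpaceTime d) : dt (fun z => θ z.1 * ψ z.2) z = deriv θ z.1 * ψ z.2 := by
  have k1 : HasFDerivAt (fun z : SpaceTime d => θ z.1)
      ((fderiv ℝ θ z.1).comp (ContinuousLinearMap.fst ℝ ℝ (Space d))) z :=
    ((h1.differentiable (by simp)) z.1).hasFDerivAt.comp z hasFDerivAt_fst
  have k2 : HasFDerivAt (fun z : SpaceTime d => ψ z.2)
      ((fderiv ℝ ψ z.2).comp (ContinuousLinearMap.snd ℝ ℝ (Space d))) z :=
    ((h2.differentiable (by simp)) z.2).hasFDerivAt.comp z hasFDerivAt_snd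
  have k3 : fderiv ℝ (fun z : SpaceTime d => θ z.1 * ψ z.2) z = _ := (k1.mul k2).fderiv
  simp [dt, k3, mul_comm]

lemma gradX_mul_of_time {θ : ℝ → ℝ} {η : SpaceTime d → ℝ} (h1 : ContDiff ℝ ∞ θ)
    (h2 : ContDiff ℝ ∞ η) (z : SpaceTime d) :
    gradX (fun z => θ z.1 * η z) z = θ z.1 • gradX η z := by
  have k0 := gradX_comp_fst (d := d) h1 z
  ext i
  have k1 : fderiv ℝ (fun z : SpaceTime d => θ z.1) z (0, EuclideanSpace.single i 1) = 0 :=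
    congrArg (fun y : Space d => y i) k0
  have k2 : fderiv ℝ (fun z : SpaceTime d => θ z.1 * η z) z = _ := (((contDiff_comp_fst (d := d) h1).differentiable (by simp) z).hasFDerivAt.mul
    (h2.differentiable (by simp) z).hasFDerivAt).fderiv
  simp [gradX, k2, k1]

/-- If the weak form of `div (v, τ) = g` holds for all smooth functions, without boundary terms,
then the initial trace of `v` vanishes. -/
lemma HasInitialTrace.eq_zero (hT : 0 < Tend) (hΩ : IsBoundedLipschitzDomain Ω)
    {v g : L2 (cylinder Tend Ω)} {τ : L2Vec (cylinder Tend Ω)} {y : L2Space Ω}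
    (h : HasInitialTrace v y)
    (hweak : ∀ φ : SpaceTime d → ℝ, ContDiff ℝ ∞ φ →
      ∫ z in cylinder Tend Ω, g z * φ z =
        - ∫ z in cylinder Tend Ω, (v z * dt φ z + ⟪τ z, gradX φ z⟫_ℝ)) : y = 0 := by
  obtain ⟨V, V1, V2, rfl⟩ := h
  have hQ := hΩ.isOpen_cylinder (Tend := Tend)
  have hb := hΩ.isBounded_cylinder (Tend := Tend)
  have key : ∀ ψ : Space d → ℝ, ContDiff ℝ ∞ ψ → HasCompactSupport ψ →
      ∫ x in Ω, ψ x * V 0 x = 0 := by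
    intro ψ c1 c2
    have mψ : MemLp ψ 2 (volume.restrict Ω) := c1.continuous.memLp_of_hasCompactSupport c2
    set η : SpaceTime d → ℝ := fun z => ψ z.2 with hη
    have cη : ContDiff ℝ ∞ η := c1.comp contDiff_snd
    set M : ℝ → ℝ := fun t => ⟪mψ.toLp ψ, V t⟫_ℝ with hM
    have cM : ContinuousOn M (Icc 0 Tend) := continuousOn_const.inner V1
    have hM' : ∀ t, M t = ∫ x in Ω, ψ x * V t x := by
      intro t
      change ⟪mψ.toLp ψ, V t⟫_ℝ = _
      rw [L2.inner_def]
      refine integral_congr_ae ?_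
      filter_upwards [mψ.coeFn_toLp] with x hx
      simp [hx, mul_comm]
    set n : ℝ → ℝ := (Ioo 0 Tend).indicator fun t =>
      ∫ x in Ω, (g (t, x) * η (t, x) + ⟪τ (t, x), gradX η (t, x)⟫_ℝ) with hn
    have iG : Integrable (fun z => g z * η z + ⟪τ z, gradX η z⟫_ℝ)
        (volume.restrict (cylinder Tend Ω)) :=
      integrable_const_mul_inner_add (Lp.memLp g) (Lp.memLp τ)
        (memLp_of_continuous hQ hb cη.continuous)
        (memLp_of_continuous hQ hb (continuous_gradX cη))
    have i_n : Integrable n := by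
      rw [hn, integrable_indicator_iff measurableSet_Ioo]
      exact integrable_integral_cylinder_slice iG
    -- The tests `θ(t) ψ(x)` reduce the weak equation to one for the moments `M` of the curve: `M' =
    -- n` on `(0, Tend)`, with tests that are free at both ends.
    have hθ : ∀ θ : ℝ → ℝ, ContDiff ℝ ∞ θ →
        ∫ t in Ioo 0 Tend, (deriv θ t * M t + θ t * n t) = 0 := by
      intro θ hθ
      have cφ : ContDiff ℝ ∞ fun z : SpaceTime d => θ z.1 * η z :=
        (contDiff_comp_fst hθ).mul cη
      have h0 := hweak _ cφ
      have j1 : Integrable (fun z => g z * (θ z.1 * η z)) (volume.restrict (cylinder Tend Ω)) :=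
        (Lp.memLp g).integrable_mul (memLp_of_continuous hQ hb cφ.continuous)
      have j2 := integrable_const_mul_inner_add (Lp.memLp v) (Lp.memLp τ)
        (memLp_of_continuous hQ hb (continuous_dt cφ))
        (memLp_of_continuous hQ hb (continuous_gradX cφ))
      have j12 : Integrable (fun z => g z * (θ z.1 * η z) +
          (v z * dt (fun z : SpaceTime d => θ z.1 * η z) z +
            ⟪τ z, gradX (fun z : SpaceTime d => θ z.1 * η z) z⟫_ℝ))
          (volume.restrict (cylinder Tend Ω)) := j1.add j2
      rw [eq_neg_iff_add_eq_zero, ← integral_add j1 j2, integral_cylinder j12] at h0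
      refine Eq.trans (integral_congr_ae ?_) h0
      have hv2 : Integrable (fun z => v z * η z) (volume.restrict (cylinder Tend Ω)) :=
        (Lp.memLp v).integrable_mul (memLp_of_continuous hQ hb cη.continuous)
      filter_upwards [V2, ae_restrict_mem measurableSet_Ioo, ae_integrable_cylinder_slice iG,
        ae_integrable_cylinder_slice hv2]
        with t h1 ht k1 k2
      rw [hM' t, hn, indicator_of_mem ht, ← integral_const_mul, ← integral_const_mul]
      have k3 : Integrable (fun x => ψ x * V t x) (volume.restrict Ω) :=
        k2.congr (by
          filter_upwards [h1] with x hx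
          rw [hx, mul_comm])
      rw [← integral_add (k3.const_mul _) (k1.const_mul _)]
      refine integral_congr_ae ?_
      filter_upwards [h1] with x hx
      rw [dt_mul_of_prod hθ c1, gradX_mul_of_time hθ cη, real_inner_smul_right, hx]
      ring
    set N : ℝ → ℝ := fun t => ∫ s in (0 : ℝ)..t, n s with hN
    have cN : Continuous N := intervalIntegral.continuous_primitive
      (fun a b => i_n.intervalIntegrable) 0
    have N0 : N 0 = 0 := intervalIntegral.integral_same
    have iM : IntegrableOn M (Ioo 0 Tend) :=
      (cM.integrableOn_Icc).mono_set Ioo_subset_Icc_self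
    have iN : IntegrableOn N (Ioo 0 Tend) :=
      (cN.continuousOn.integrableOn_Icc).mono_set Ioo_subset_Icc_self
    have bdd : ∀ {c f : ℝ → ℝ}, Continuous c → IntegrableOn f (Ioo 0 Tend) →
        IntegrableOn (fun t => c t * f t) (Ioo 0 Tend) := by
      intro c f hc hf
      obtain ⟨C, hC⟩ := isCompact_Icc.exists_bound_of_continuousOn (s := Icc 0 Tend) hc.continuousOn
      refine hf.bdd_mul hc.aestronglyMeasurable (c := C) ?_
      filter_upwards [ae_restrict_mem measurableSet_Ioo] with t ht
      exact hC t (Ioo_subset_Icc_self ht)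
    have hθ2 : ∀ θ : ℝ → ℝ, ContDiff ℝ ∞ θ →
        ∫ t in Ioo 0 Tend, deriv θ t * (M t - N t) = - (θ Tend * N Tend) := by
      intro θ c
      have cd : Continuous (deriv θ) := c.continuous_deriv (by simp)
      have hp := integral_mul_add_mul_of_primitive (F := θ) (f := deriv θ) (G := N) (g := n)
        (a := 0) (b := Tend) (cd.intervalIntegrable _ _) i_n.intervalIntegrable
        (fun t _ => (intervalIntegral.integral_deriv_eq_sub
          (fun s _ => c.differentiable (by simp) s) (cd.intervalIntegrable _ _)).symm)
        (fun t _ => by rw [N0, sub_zero])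
      rw [N0, mul_zero, sub_zero, intervalIntegral.integral_of_le hT.le,
        integral_Ioc_eq_integral_Ioo] at hp
      have h0 := hθ θ c
      have l1 := bdd cd iM
      have l2 := bdd cd iN
      have l3 := bdd c.continuous (i_n.integrableOn (s := Ioo 0 Tend))
      rw [integral_add l1 l3] at h0
      rw [integral_add l2 l3] at hp
      simp only [mul_sub]
      rw [integral_sub l1 l2]
      linarith
    -- The constant test `θ = 1` removes the boundary term at the final time.
    have NT : N Tend = 0 := by
      have := hθ2 (fun _ => 1) contDiff_const
      simpa using this
    have hae : ∀ᵐ t ∂volume, t ∈ Ioo 0 Tend → M t - N t = 0 := by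
      refine isOpen_Ioo.ae_eq_zero_of_integral_contDiff_smul_eq_zero
        (iM.sub iN).locallyIntegrableOn fun ρ r1 r2 r3 => ?_
      have hder : deriv (fun t => ∫ s in (0 : ℝ)..t, ρ s) = ρ :=
        funext fun t => r1.continuous.deriv_integral ρ 0 t
      -- Every `ρ` is the derivative of an admissible `θ` because `θ` need not vanish at the end
      -- points. So `M` equals the primitive `N`, with no additive constant, and `M 0 = N 0 = 0`.
      have cθ : ContDiff ℝ ∞ fun t => ∫ s in (0 : ℝ)..t, ρ s := by
        rw [contDiff_infty_iff_deriv, hder]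
        exact ⟨fun t => (intervalIntegral.integral_hasDerivAt_right
          (r1.continuous.intervalIntegrable _ _)
          (r1.continuous.stronglyMeasurableAtFilter _ _)
          r1.continuous.continuousAt).differentiableAt, r1⟩
      have := hθ2 _ cθ
      rw [hder, NT, mul_zero, neg_zero] at this
      rw [← setIntegral_eq_integral_of_forall_compl_eq_zero (s := Ioo 0 Tend)
        fun t ht => by rw [image_eq_zero_of_notMem_tsupport fun h => ht (r3 h), zero_smul]]
      exact this
    have hEq : EqOn M N (Icc 0 Tend) := by
      refine Measure.eqOn_of_ae_eq (μ := volume) ?_ cM cN.continuousOn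
        (by rw [interior_Icc, closure_Ioo hT.ne])
      rw [← Measure.restrict_congr_set Ioo_ae_eq_Icc, EventuallyEq,
        ae_restrict_iff' measurableSet_Ioo]
      filter_upwards [hae] with t ht hmem
      exact sub_eq_zero.1 (ht hmem)
    rw [← hM', hEq (left_mem_Icc.2 hT.le), N0]
  refine Lp.ext (EventuallyEq.trans ?_ (Lp.coeFn_zero _ _ _).symm)
  rw [EventuallyEq, ae_restrict_iff' hΩ.isOpen.measurableSet]
  refine hΩ.isOpen.ae_eq_zero_of_integral_contDiff_smul_eq_zero
    (locallyIntegrableOn_of_locallyIntegrable_restrict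
      ((Lp.memLp (V 0)).locallyIntegrable (by norm_num))) fun ψ c1 c2 c3 => ?_
  rw [← setIntegral_eq_integral_of_forall_compl_eq_zero (s := Ω)
    fun t ht => by rw [image_eq_zero_of_notMem_tsupport fun h => ht (c3 h), zero_smul]]
  exact key ψ c1 c2

end Trace

/-! ### Smooth functions as broken test functions -/

section SmoothTests

variable {d : ℕ}

/-- Integration by parts against the constant `1`. -/
lemma integral_fderiv_eq_zero {f : SpaceTime d → ℝ} (h1 : ContDiff ℝ ∞ f)
    (h2 : HasCompactSupport f) (v : SpaceTime d) : ∫ z, fderiv ℝ f z v = 0 := by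
  have c : Continuous fun z => fderiv ℝ f z v :=
    (h1.continuous_fderiv (by simp)).clm_apply continuous_const
  have := integral_mul_fderiv_eq_neg_fderiv_mul_of_integrable (μ := volume)
    (f := fun _ : SpaceTime d => (1 : ℝ)) (g := f) (v := v) (by simp)
    (by simpa using c.integrable_of_hasCompactSupport (h2.fderiv_apply (𝕜 := ℝ) v))
    (by simpa using h1.continuous.integrable_of_hasCompactSupport h2)
    (fun _ _ => differentiableAt_const _) (fun z _ => h1.differentiable (by simp) z)
  simpa using this

lemma integral_dt_eq_zero {f : SpaceTime d → ℝ} (h1 : ContDiff ℝ ∞ f)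
    (h2 : HasCompactSupport f) : ∫ z, dt f z = 0 :=
  integral_fderiv_eq_zero h1 h2 _

lemma integral_divX_eq_zero {χ : SpaceTime d → Space d} (h1 : ContDiff ℝ ∞ χ)
    (h2 : HasCompactSupport χ) : ∫ z, divX χ z = 0 := by
  have c : ∀ i : Fin d, ContDiff ℝ ∞ fun z => χ z i := fun i =>
    (EuclideanSpace.proj i : Space d →L[ℝ] ℝ).contDiff.comp h1
  have k : ∀ i : Fin d, HasCompactSupport fun z => χ z i := fun i =>
    h2.comp_left (g := fun x : Space d => x i) rfl
  have e : ∀ (i : Fin d) (z : SpaceTime d), (fderiv ℝ χ z (0, EuclideanSpace.single i 1)) i =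
      fderiv ℝ (fun z => χ z i) z (0, EuclideanSpace.single i 1) := fun i z => by
    have := ((EuclideanSpace.proj i : Space d →L[ℝ] ℝ).hasFDerivAt.comp z
      (h1.differentiable (by simp) z).hasFDerivAt).fderiv
    exact (congrArg (fun L : SpaceTime d →L[ℝ] ℝ => L (0, EuclideanSpace.single i 1)) this).symm
  simp only [divX, e]
  rw [integral_finsetSum]
  · exact Finset.sum_eq_zero fun i _ => integral_fderiv_eq_zero (c i) (k i) _
  · intro i _
    exact (((c i).continuous_fderiv (by simp)).clm_apply
      continuous_const).integrable_of_hasCompactSupport ((k i).fderiv_apply (𝕜 := ℝ) _)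

lemma dt_mul {φ ψ : SpaceTime d → ℝ} {z : SpaceTime d} (h1 : DifferentiableAt ℝ φ z)
    (h2 : DifferentiableAt ℝ ψ z) :
    dt (fun y => φ y * ψ y) z = φ z * dt ψ z + ψ z * dt φ z := by
  simp [dt, fderiv_fun_mul h1 h2]

/-- The sum of the two integrands is `∂ₜ(φ ψ) + divₓ(ψ χ)`, a total divergence of compactly
supported functions. -/
lemma hasWeakDiv_of_contDiff {K : Set (SpaceTime d)} {φ : SpaceTime d → ℝ}
    {χ : SpaceTime d → Space d} (hφ : ContDiff ℝ ∞ φ) (hχ : ContDiff ℝ ∞ χ) :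
    HasWeakDiv K φ χ (fun z => dt φ z + divX χ z) := by
  intro ψ h1 h2 h3
  have c1 : Continuous fun z => (dt φ z + divX χ z) * ψ z :=
    ((continuous_dt hφ).add (continuous_divX hχ)).mul h1.continuous
  have c2 : Continuous fun z => φ z * dt ψ z + ⟪χ z, gradX ψ z⟫_ℝ :=
    (hφ.continuous.mul (continuous_dt h1)).add (hχ.continuous.inner (continuous_gradX h1))
  have z1 : ∀ z, z ∉ tsupport ψ → ψ z = 0 := fun z hz => image_eq_zero_of_notMem_tsupport hz
  have z2 : ∀ z, z ∉ tsupport ψ → fderiv ℝ ψ z = 0 := fun z hz =>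
    image_eq_zero_of_notMem_tsupport fun h => hz (tsupport_fderiv_subset ℝ h)
  have s1 : ∀ z, z ∉ tsupport ψ → (dt φ z + divX χ z) * ψ z = 0 := fun z hz => by
    rw [z1 z hz, mul_zero]
  have s2 : ∀ z, z ∉ tsupport ψ → φ z * dt ψ z + ⟪χ z, gradX ψ z⟫_ℝ = 0 := fun z hz => by
    rw [real_inner_comm, inner_gradX]
    simp [dt, z2 z hz]
  rw [setIntegral_eq_integral_of_forall_compl_eq_zero fun z hz => s1 z fun h => hz (h3 h),
    setIntegral_eq_integral_of_forall_compl_eq_zero fun z hz => s2 z fun h => hz (h3 h),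
    eq_neg_iff_add_eq_zero,
    ← integral_add (c1.integrable_of_hasCompactSupport (HasCompactSupport.intro h2 s1))
      (c2.integrable_of_hasCompactSupport (HasCompactSupport.intro h2 s2))]
  have c3 : ContDiff ℝ ∞ fun z => φ z * ψ z := hφ.mul h1
  have c4 : ContDiff ℝ ∞ fun z => ψ z • χ z := h1.smul hχ
  have k3 : HasCompactSupport fun z => φ z * ψ z := h2.mul_left
  have k4 : HasCompactSupport fun z => ψ z • χ z := h2.smul_right
  have := integral_add
    ((continuous_dt c3).integrable_of_hasCompactSupport (μ := volume) (compact_dt k3))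
    ((continuous_divX c4).integrable_of_hasCompactSupport (compact_divX k4))
  rw [integral_dt_eq_zero c3 k3, integral_divX_eq_zero c4 k4, add_zero] at this
  rw [← this]
  refine integral_congr_ae (Eventually.of_forall fun z => ?_)
  simp only
  rw [dt_mul (hφ.differentiable (by simp) z) (h1.differentiable (by simp) z),
    divX_smul (h1.differentiable (by simp) z) (hχ.differentiable (by simp) z),
    real_inner_comm]
  ring

lemma hasWeakGrad_of_contDiff {K : Set (SpaceTime d)} {φ : SpaceTime d → ℝ}
    (hφ : ContDiff ℝ ∞ φ) : HasWeakGrad K φ (gradX φ) := by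
  intro χ h1 h2 h3
  have c1 : Continuous fun z => ⟪gradX φ z, χ z⟫_ℝ := (continuous_gradX hφ).inner h1.continuous
  have c2 : Continuous fun z => φ z * divX χ z := hφ.continuous.mul (continuous_divX h1)
  have s1 : ∀ z, z ∉ tsupport χ → ⟪gradX φ z, χ z⟫_ℝ = 0 := fun z hz => by
    rw [image_eq_zero_of_notMem_tsupport hz, inner_zero_right]
  have s2 : ∀ z, z ∉ tsupport χ → φ z * divX χ z = 0 := fun z hz => by
    have : fderiv ℝ χ z = 0 :=
      image_eq_zero_of_notMem_tsupport fun h => hz (tsupport_fderiv_subset ℝ h)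
    simp [divX, this]
  rw [setIntegral_eq_integral_of_forall_compl_eq_zero fun z hz => s1 z fun h => hz (h3 h),
    setIntegral_eq_integral_of_forall_compl_eq_zero fun z hz => s2 z fun h => hz (h3 h),
    eq_neg_iff_add_eq_zero,
    ← integral_add (c1.integrable_of_hasCompactSupport (HasCompactSupport.intro h2 s1))
      (c2.integrable_of_hasCompactSupport (HasCompactSupport.intro h2 s2))]
  have c4 : ContDiff ℝ ∞ fun z => φ z • χ z := hφ.smul h1
  have k4 : HasCompactSupport fun z => φ z • χ z :=
    HasCompactSupport.intro h2 fun z hz => by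
      rw [image_eq_zero_of_notMem_tsupport hz, smul_zero]
  rw [← integral_divX_eq_zero c4 k4]
  refine integral_congr_ae (Eventually.of_forall fun z => ?_)
  simp only
  rw [divX_smul (hφ.differentiable (by simp) z) (h1.differentiable (by simp) z)]
  ring

variable {Q : Set (SpaceTime d)}

lemma smooth_mem_brokenSpace (𝒯 : Mesh Q) {φ : SpaceTime d → ℝ} {χ : SpaceTime d → Space d} (hφ : ContDiff ℝ ∞ φ)
    (hχ : ContDiff ℝ ∞ χ) (mφ : MemLp φ 2 (volume.restrict Q))
    (mχ : MemLp χ 2 (volume.restrict Q)) (mδ : MemLp (fun z => dt φ z + divX χ z) 2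
      (volume.restrict Q)) (mσ : MemLp (gradX φ) 2 (volume.restrict Q)) :
    (WithLp.toLp 2 (mφ.toLp φ, mχ.toLp χ) : L2Pair Q) ∈ brokenSpace 𝒯 ∧
      opAstarH 𝒯 (WithLp.toLp 2 (mφ.toLp φ, mχ.toLp χ)) =
        WithLp.toLp 2 (-mδ.toLp _, -mσ.toLp _ + mχ.toLp χ) := by
  have h1 : ∀ K ∈ 𝒯.cells, HasWeakDiv K (mφ.toLp φ) (mχ.toLp χ) (mδ.toLp _) := fun K hK =>
    (hasWeakDiv_of_contDiff hφ hχ).congr (𝒯.ae_cell hK mφ.coeFn_toLp).symm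
      (𝒯.ae_cell hK mχ.coeFn_toLp).symm (𝒯.ae_cell hK mδ.coeFn_toLp).symm
  have h2 : ∀ K ∈ 𝒯.cells, HasWeakGrad K (mφ.toLp φ) (mσ.toLp _) := fun K hK =>
    (hasWeakGrad_of_contDiff hφ).congr (𝒯.ae_cell hK mφ.coeFn_toLp).symm
      (𝒯.ae_cell hK mσ.coeFn_toLp).symm
  have hw : (WithLp.toLp 2 (mφ.toLp φ, mχ.toLp χ) : L2Pair Q) ∈ brokenSpace 𝒯 := fun K hK =>
    ⟨⟨_, (Lp.memLp _).mono_measure (𝒯.restrict_le hK), h1 K hK⟩,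
      _, (Lp.memLp _).mono_measure (𝒯.restrict_le hK), h2 K hK⟩
  exact ⟨hw, by rw [opAstarH, cellDiv_eq 𝒯 hw h1, cellGrad_eq 𝒯 hw h2]; rfl⟩

lemma inner_Lp_toLp {F : Type*} [NormedAddCommGroup F] [InnerProductSpace ℝ F]
    {μ : Measure (SpaceTime d)} (e : Lp F 2 μ) {f : SpaceTime d → F} (hf : MemLp f 2 μ) :
    ⟪e, hf.toLp f⟫_ℝ = ∫ z, ⟪e z, f z⟫_ℝ ∂μ := by
  conv_lhs => rw [← Lp.toLp_coeFn e (Lp.memLp e)]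
  exact inner_toLp _ _

lemma divX_zero (z : SpaceTime d) : divX (fun _ : SpaceTime d => (0 : Space d)) z = 0 := by
  simp [divX]

lemma dt_zero (z : SpaceTime d) : dt (fun _ : SpaceTime d => (0 : ℝ)) z = 0 := by
  simp [dt]

lemma gradX_zero (z : SpaceTime d) : gradX (fun _ : SpaceTime d => (0 : ℝ)) z = 0 := by
  ext i
  simp [gradX]

/-- The test is `w = (φ, 0)`, for which `A*ₕ w = (-∂ₜ φ, -∇ₓ φ)`. Since `φ` is arbitrary on the
boundary, these tests see the equation and the initial value. -/
lemma exists_scalar_test (𝒯 : Mesh Q) (hQ : IsOpen Q) (hb : Bornology.IsBounded Q)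
    {φ : SpaceTime d → ℝ} (hφ : ContDiff ℝ ∞ φ) :
    ∃ w ∈ brokenSpace 𝒯, ∀ e : L2Pair Q, ⟪e, w⟫_ℝ = ∫ z in Q, e.fst z * φ z ∧
      ⟪e, opAstarH 𝒯 w⟫_ℝ = -∫ z in Q, (e.fst z * dt φ z + ⟪e.snd z, gradX φ z⟫_ℝ) := by
  have c0 : ContDiff ℝ ∞ fun _ : SpaceTime d => (0 : Space d) := contDiff_const
  have mφ := memLp_of_continuous hQ hb hφ.continuous
  have mχ := memLp_of_continuous hQ hb c0.continuous
  have mδ : MemLp (fun z => dt φ z + divX (fun _ : SpaceTime d => (0 : Space d)) z) 2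
      (volume.restrict Q) :=
    memLp_of_continuous hQ hb ((continuous_dt hφ).add (continuous_divX c0))
  have mσ := memLp_of_continuous hQ hb (continuous_gradX hφ)
  obtain ⟨hw, hA⟩ := smooth_mem_brokenSpace 𝒯 hφ c0 mφ mχ mδ mσ
  refine ⟨_, hw, fun e => ⟨?_, ?_⟩⟩
  · rw [WithLp.prod_inner_apply]
    change ⟪e.fst, mφ.toLp φ⟫_ℝ + ⟪e.snd, mχ.toLp _⟫_ℝ = _
    rw [inner_Lp_toLp, inner_Lp_toLp]
    simp only [inner_zero_right, integral_zero, add_zero]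
    exact integral_congr_ae (Eventually.of_forall fun z => mul_comm _ _)
  · rw [hA, WithLp.prod_inner_apply]
    change ⟪e.fst, -mδ.toLp _⟫_ℝ + ⟪e.snd, -mσ.toLp _ + mχ.toLp _⟫_ℝ = _
    rw [inner_add_right, inner_neg_right, inner_neg_right, inner_Lp_toLp, inner_Lp_toLp,
      inner_Lp_toLp, integral_add]
    · have h1 : ∫ z in Q, ⟪e.fst z, dt φ z + divX (fun _ : SpaceTime d => (0 : Space d)) z⟫_ℝ =
          ∫ z in Q, e.fst z * dt φ z :=
        integral_congr_ae (Eventually.of_forall fun z => by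
          simp only [divX_zero, add_zero]
          exact mul_comm _ _)
      rw [h1]
      simp only [inner_zero_right, integral_zero, add_zero]
      ring
    · exact (Lp.memLp e.fst).integrable_mul (memLp_of_continuous hQ hb (continuous_dt hφ))
    · exact integrable_inner_of_memLp (Lp.memLp e.snd) mσ

/-- The test is `w = (0, χ)`, for which `A*ₕ w = (-divₓ χ, χ)`. These tests see the gradient and the
lateral condition. -/
lemma exists_vector_test (𝒯 : Mesh Q) (hQ : IsOpen Q) (hb : Bornology.IsBounded Q)
    {χ : SpaceTime d → Space d} (hχ : ContDiff ℝ ∞ χ) :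
    ∃ w ∈ brokenSpace 𝒯, ∀ e : L2Pair Q, ⟪e, w⟫_ℝ = ∫ z in Q, ⟪e.snd z, χ z⟫_ℝ ∧
      ⟪e, opAstarH 𝒯 w⟫_ℝ =
        (∫ z in Q, ⟪e.snd z, χ z⟫_ℝ) - ∫ z in Q, e.fst z * divX χ z := by
  have c0 : ContDiff ℝ ∞ fun _ : SpaceTime d => (0 : ℝ) := contDiff_const
  have mφ := memLp_of_continuous hQ hb c0.continuous
  have mχ := memLp_of_continuous hQ hb hχ.continuous
  have mδ : MemLp (fun z => dt (fun _ : SpaceTime d => (0 : ℝ)) z + divX χ z) 2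
      (volume.restrict Q) :=
    memLp_of_continuous hQ hb ((continuous_dt c0).add (continuous_divX hχ))
  have mσ := memLp_of_continuous hQ hb (continuous_gradX c0)
  obtain ⟨hw, hA⟩ := smooth_mem_brokenSpace 𝒯 c0 hχ mφ mχ mδ mσ
  refine ⟨_, hw, fun e => ⟨?_, ?_⟩⟩
  · rw [WithLp.prod_inner_apply]
    change ⟪e.fst, mφ.toLp _⟫_ℝ + ⟪e.snd, mχ.toLp χ⟫_ℝ = _
    rw [inner_Lp_toLp, inner_Lp_toLp]
    simp
  · rw [hA, WithLp.prod_inner_apply]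
    change ⟪e.fst, -mδ.toLp _⟫_ℝ + ⟪e.snd, -mσ.toLp _ + mχ.toLp χ⟫_ℝ = _
    rw [inner_add_right, inner_neg_right, inner_neg_right, inner_Lp_toLp, inner_Lp_toLp,
      inner_Lp_toLp]
    have h1 : ∫ z in Q, ⟪e.fst z, dt (fun _ : SpaceTime d => (0 : ℝ)) z + divX χ z⟫_ℝ =
        ∫ z in Q, e.fst z * divX χ z :=
      integral_congr_ae (Eventually.of_forall fun z => by
        simp only [dt_zero, zero_add]
        exact mul_comm _ _)
    rw [h1]
    simp only [gradX_zero, inner_zero_right, integral_zero]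
    ring

end SmoothTests

/-! ### Equivalence of the two problems -/

section Main

variable {d : ℕ} {Q : Set (SpaceTime d)}

lemma HasZeroTraceGrad.mem_spaceU0 (hQ : IsOpen Q) (hne : Q.Nonempty) {e : L2Pair Q} {g : L2 Q}
    {σ : L2Vec Q} (hg : HasWeakDiv Q e.fst e.snd g) (hσ : HasZeroTraceGrad Q e.fst σ) :
    e ∈ spaceU0 Q ∧ cellDiv {Q} e = g ∧ cellGrad {Q} e = σ := by
  have hw : HasWeakGrad Q e.fst σ := fun χ h1 _ _ => hσ χ h1
  have hU : e ∈ spaceU Q := ⟨⟨g, Lp.memLp g, hg⟩, σ, Lp.memLp σ, hw⟩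
  have hb := mem_brokenSpace_trivial hQ hne hU
  have h1 : cellDiv {Q} e = g := cellDiv_eq (Mesh.trivial hQ hne) hb fun K hK => by
    rwa [Finset.mem_singleton.1 hK]
  have h2 : cellGrad {Q} e = σ := cellGrad_eq (Mesh.trivial hQ hne) hb fun K hK => by
    rwa [Finset.mem_singleton.1 hK]
  exact ⟨⟨hU, by rw [h2]; exact hσ⟩, h1, h2⟩

lemma spaceU0_add (hQ : IsOpen Q) (hb : Bornology.IsBounded Q) (hne : Q.Nonempty) {a b : L2Pair Q}
    (ha : a ∈ spaceU0 Q) (hb' : b ∈ spaceU0 Q) :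
    a + b ∈ spaceU0 Q ∧ opA (a + b) = opA a + opA b := by
  have h1 := mem_brokenSpace_trivial hQ hne ha.1
  have h2 := mem_brokenSpace_trivial hQ hne hb'.1
  have e1 : cellDiv {Q} (a + b) = cellDiv {Q} a + cellDiv {Q} b :=
    cellDiv_add (Mesh.trivial hQ hne) h1 h2
  have e2 : cellGrad {Q} (a + b) = cellGrad {Q} a + cellGrad {Q} b :=
    cellGrad_add (Mesh.trivial hQ hne) h1 h2
  have e3 : (a + b).snd = a.snd + b.snd := rfl
  refine ⟨⟨add_mem h1 h2 Q (Finset.mem_singleton_self Q), fun χ hχ => ?_⟩, ?_⟩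
  · have m1 := memLp_of_continuous hQ hb hχ.continuous
    have m2 := memLp_of_continuous hQ hb (continuous_divX hχ)
    have l : ∫ z in Q, ⟪cellGrad {Q} (a + b) z, χ z⟫_ℝ =
        (∫ z in Q, ⟪cellGrad {Q} a z, χ z⟫_ℝ) + ∫ z in Q, ⟪cellGrad {Q} b z, χ z⟫_ℝ := by
      rw [e2, ← inner_Lp_toLp _ m1, ← inner_Lp_toLp _ m1, ← inner_Lp_toLp _ m1, inner_add_left]
    have r : ∀ f : L2 Q, ∫ z in Q, f z * divX χ z = ⟪f, m2.toLp _⟫_ℝ := fun f => by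
      rw [inner_Lp_toLp]
      simp [mul_comm]
    rw [l, ha.2 χ hχ, hb'.2 χ hχ, r, r, r, ← neg_add, ← inner_add_left]
    rfl
  · rw [opA, e1, e2, e3]
    refine congrArg (WithLp.toLp 2) (Prod.ext rfl ?_)
    change _ + _ + (_ + _) = (_ + _) + (_ + _)
    abel

variable {Tend : ℝ} {Ω : Set (Space d)}

/-- The term `⟨u, A*ₕ w⟩` cancels against its negative in the definition of `γ_A u`. -/
lemma solvesBrokenProblem_of_solvesFirstOrderSystem (𝒯 : Mesh (cylinder Tend Ω))
    {f u : L2Pair (cylinder Tend Ω)} {u₀ : L2Space Ω} (h : SolvesFirstOrderSystem f u₀ u) :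
    SolvesBrokenProblem 𝒯 (load 𝒯 f u₀) (u, gammaA 𝒯 u) := by
  obtain ⟨h1, h2, h3⟩ := h
  refine ⟨⟨mem_univ _, u, h1, rfl⟩, fun y => ?_⟩
  simp only [formB, gammaA, load, h2, h3, add_apply,
    sub_apply, ContinuousLinearMap.comp_apply, innerSL_apply_apply]
  ring

/-- A weak solution of the homogeneous initial boundary value problem, tested with all smooth
functions, is a strong solution. -/
lemma mem_spaceU0_of_forall_inner_eq (hT : 0 < Tend) (hΩ : IsBoundedLipschitzDomain Ω)
    (𝒯 : Mesh (cylinder Tend Ω)) {e G : L2Pair (cylinder Tend Ω)}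
    (h : ∀ w ∈ brokenSpace 𝒯, ⟪e, opAstarH 𝒯 w⟫_ℝ = ⟪G, w⟫_ℝ) :
    e ∈ spaceU0 (cylinder Tend Ω) ∧ opA e = G ∧ gamma0 e = 0 := by
  have hQ := hΩ.isOpen_cylinder (Tend := Tend)
  have hb := hΩ.isBounded_cylinder (Tend := Tend)
  have h1 : ∀ φ : SpaceTime d → ℝ, ContDiff ℝ ∞ φ → ∫ z in cylinder Tend Ω, G.fst z * φ z =
      -∫ z in cylinder Tend Ω, (e.fst z * dt φ z + ⟪e.snd z, gradX φ z⟫_ℝ) := by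
    intro φ hφ
    obtain ⟨w, hw, hw'⟩ := exists_scalar_test 𝒯 hQ hb hφ
    rw [← (hw' G).1, ← (hw' e).2, h w hw]
  -- The second row of `A e = G` dictates the gradient: `∇ₓ e₁ = G₂ - e₂`.
  have h2 : HasZeroTraceGrad (cylinder Tend Ω) e.fst (G.snd - e.snd : L2Vec _) := by
    intro χ hχ
    obtain ⟨w, hw, hw'⟩ := exists_vector_test 𝒯 hQ hb hχ
    have := h w hw
    rw [(hw' G).1, (hw' e).2] at this
    have m1 := memLp_of_continuous hQ hb hχ.continuous
    rw [← inner_Lp_toLp _ m1, ← inner_Lp_toLp _ m1] at this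
    rw [← inner_Lp_toLp _ m1, inner_sub_left]
    linarith
  obtain ⟨k1, k2, k3⟩ := HasZeroTraceGrad.mem_spaceU0 hQ (hΩ.nonempty_cylinder hT)
    (fun φ c _ _ => h1 φ c) h2
  refine ⟨k1, ?_, (hasInitialTrace_gamma0 hT hΩ k1).eq_zero hT hΩ h1⟩
  rw [opA, k2, k3, sub_add_cancel]
  rfl

/-- With `s = γ_A a`, the difference `u - a` is a weak solution with right-hand side `f - A a` and
without traces, hence a strong one in `U₀` with zero initial value. Adding `a` back gives `u`. -/
lemma solvesFirstOrderSystem_of_solvesBrokenProblem (hT : 0 < Tend)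
    (hΩ : IsBoundedLipschitzDomain Ω) (𝒯 : Mesh (cylinder Tend Ω))
    {f u : L2Pair (cylinder Tend Ω)} {u₀ : L2Space Ω} {s : StrongDual ℝ (TestSpace 𝒯)}
    (h : SolvesBrokenProblem 𝒯 (load 𝒯 f u₀) (u, s)) :
    s = gammaA 𝒯 u ∧ SolvesFirstOrderSystem f u₀ u := by
  obtain ⟨⟨-, a, ha, rfl⟩, hs⟩ := h
  have hform : ∀ (w : brokenSpace 𝒯) (ξ : L2Space Ω),
      ⟪u, opAstarH 𝒯 w⟫_ℝ + (⟪opA a, (w : L2Pair _)⟫_ℝ - ⟪a, opAstarH 𝒯 w⟫_ℝ + ⟪gamma0 a, ξ⟫_ℝ) =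
        ⟪f, (w : L2Pair _)⟫_ℝ + ⟪u₀, ξ⟫_ℝ := fun w ξ => hs ((w, ξ) : brokenSpace 𝒯 × L2Space Ω)
  have hA0 : opAstarH 𝒯 ((0 : brokenSpace 𝒯) : L2Pair (cylinder Tend Ω)) = 0 :=
    (TestSpace.astarLin 𝒯).map_zero
  have ha0 : gamma0 a = u₀ := by
    refine ext_inner_right ℝ fun ξ => ?_
    have := hform 0 ξ
    rw [hA0] at this
    simpa only [ZeroMemClass.coe_zero, inner_zero_right, sub_zero, zero_add] using this
  obtain ⟨e1, e2, e3⟩ := mem_spaceU0_of_forall_inner_eq hT hΩ 𝒯 (e := u - a) (G := f - opA a)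
    fun w hw => by
      have := hform ⟨w, hw⟩ 0
      simp only [inner_zero_right, add_zero] at this
      rw [inner_sub_left, inner_sub_left]
      linarith
  obtain ⟨k1, k2⟩ := spaceU0_add hΩ.isOpen_cylinder hΩ.isBounded_cylinder
    (hΩ.nonempty_cylinder hT) ha e1
  have k3 : gamma0 (a + (u - a)) = u₀ := by
    have : gamma0 (a + (u - a)) = gamma0 a + gamma0 (u - a) := gamma0_eq hT
      ((hasInitialTrace_gamma0 hT hΩ ha).add (hasInitialTrace_gamma0 hT hΩ e1))
    rw [this, e3, add_zero, ha0]
  rw [e2, add_sub_cancel] at k2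
  rw [add_sub_cancel] at k1 k2 k3
  have hu : SolvesFirstOrderSystem f u₀ u := ⟨k1, k2, k3⟩
  refine ⟨ContinuousLinearMap.ext fun y => ?_, hu⟩
  -- Both `s` and `γ_A u` satisfy `(*)` with the same `u`, so the common term `⟨u, A*ₕ w⟩` can be
  -- cancelled.
  exact add_left_cancel
    ((hs y).trans ((solvesBrokenProblem_of_solvesFirstOrderSystem 𝒯 hu).2 y).symm)

end Main

end HeatDPG

theorem mainTheorem3 {d : ℕ} (hd : 1 ≤ d) {Tend : ℝ} (hT : 0 < Tend)
    {Ω : Set (HeatDPG.Space d)} (hΩ : HeatDPG.IsBoundedLipschitzDomain Ω)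
    (𝒯 : HeatDPG.Mesh (HeatDPG.cylinder Tend Ω))
    (f : HeatDPG.L2Pair (HeatDPG.cylinder Tend Ω)) (u₀ : HeatDPG.L2Space Ω) :
    (∀ v ∈ HeatDPG.spaceU0 (HeatDPG.cylinder Tend Ω),
      ∃! g : HeatDPG.L2Space Ω, HeatDPG.HasInitialTrace v.fst g) ∧
    (∀ u : HeatDPG.L2Pair (HeatDPG.cylinder Tend Ω),
      HeatDPG.SolvesFirstOrderSystem f u₀ u →
        HeatDPG.SolvesBrokenProblem 𝒯 (HeatDPG.load 𝒯 f u₀) (u, HeatDPG.gammaA 𝒯 u)) ∧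
    (∀ (u : HeatDPG.L2Pair (HeatDPG.cylinder Tend Ω))
      (s : StrongDual ℝ (HeatDPG.TestSpace 𝒯)),
      HeatDPG.SolvesBrokenProblem 𝒯 (HeatDPG.load 𝒯 f u₀) (u, s) →
        s = HeatDPG.gammaA 𝒯 u ∧ HeatDPG.SolvesFirstOrderSystem f u₀ u) := by
  refine ⟨fun v hv => ?_, fun u hu => ?_, fun u s h => ?_⟩
  · obtain ⟨g, hg⟩ := HeatDPG.exists_hasInitialTrace hT hΩ hv
    exact ⟨g, hg, fun g' hg' => hg'.unique hT hg⟩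
  · exact HeatDPG.solvesBrokenProblem_of_solvesFirstOrderSystem 𝒯 hu
  · exact HeatDPG.solvesFirstOrderSystem_of_solvesBrokenProblem hT hΩ 𝒯 h
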